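/- Let $k$ be a coherent commutative ring (every finitely generated ideal is finitely presented). **Forms on simplices.** Let $A$ be the free graded $k$-module with basis the constant function $1$ and, for $s\in\mathbf Z$, the Heaviside function $Y_s$ on $\mathbf Z$ (equal to $1$ for $x\le s$ and $0$ otherwise), all in degree $0$, and the Dirac function $\omega_s$ at $s$, in degree $1$; the differential is $d1=0$, $dY_s=-\omega_s$, $d\omega_s=0$. The singular support of $1$ is empty, that of $Y_s$ and of $\omega_s$ is $\{s\}$; the singular support of a pure tensor of basis elements is the union of those of its factors. Let $\mathcal D^*(\Delta_n)$ be the quotient of the graded tensor power $A^{\otimes(n+1)}$ (forms in the variables $x_0,\dots,x_n$) by the submodule spanned by the $f_0\otimes\dots\otimes f_n$ where every $f_i$ is some $Y_s$ or $\omega_s$. The $\mathcal D^*(\Delta_n)$ form a simplicial differential graded module: the face $\partial_i$ sets $x_i=-\infty$ ($1\mapsto1$, $Y_s\mapsto1$, $\omega_s\mapsto0$ in the $i$-th factor), and the degeneracy $s_i$ applies to the $i$-th factor the map $1\mapsto1\otimes1$, $Y_s\mapsto Y_s\otimes Y_s$, $\omega_s\mapsto\omega_s\otimes Y_s+Y_s\otimes\omega_s$.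 For $S\subset\mathbf Z$, ${}_S\mathcal D^*(\Delta_n)$ is spanned by the classes of the pure tensors with singular support in $S$. The reduced tensor product ${}_S\mathcal D^*(\Delta_p)\,\overline\otimes\,{}_T\mathcal D^*(\Delta_q)$ is the submodule of ${}_S\mathcal D^*(\Delta_p)\otimes{}_T\mathcal D^*(\Delta_q)$ spanned by the $f\otimes g$, with $f$, $g$ classes of pure tensors of basis elements with singular supports contained in $S$ and $T$ respectively and disjoint. **Forms with coefficients.** Let $M$ be a cosimplicial $k$-module. For $S\subset\mathbf Z$ finite, ${}_S\mathcal D^*(M)$ is the differential graded module of the families $\theta=(\theta_n)$, $\theta_n\in M^n\otimes{}_S\mathcal D^*(\Delta_n)$, such that $(u_*\otimes1)\theta_p=(1\otimes u^*)\theta_n$ for every non-decreasing $u:[p]\to[n]$ and such that, for $n$ large, $\theta_n$ is a combination of degenerate forms (that is, its image in the tensor product of the normalized modules vanishes). For $S$ infinite, it is the direct limit of the ${}_{S'}\mathcal D^*(M)$ over the finite $S'\subset S$. If $N$ is another cosimplicial module, the reduced tensor product ${}_S\mathcal D^*(M)\,\overline\otimes\,{}_T\mathcal D^*(N)$ is the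 submodule of the ordinary tensor product ${}_S\mathcal D^*(M)\otimes{}_T\mathcal D^*(N)$ formed of the elements whose associated bisimplicial family, with components in $M^p\otimes N^q\otimes\mathcal D^*(\Delta_p)\otimes\mathcal D^*(\Delta_q)$, takes its values in the $M^p\otimes N^q\otimes(\mathcal D^*(\Delta_p)\,\overline\otimes\,\mathcal D^*(\Delta_q))$. For $r$ factors, the reduced tensor product is the intersection in the ordinary tensor product, over all pairs $i\neq j$, of the images of the tensor products of the reduced tensor product of the $i$-th and $j$-th factors with all the other factors. For a simplicial set $X$, ${}_S\mathcal D^*(X)={}_S\mathcal D^*(C^*(X))$, where $C^n(X)=k^{X_n}$, and $\mathcal D^*(X)={}_{\mathbf Z}\mathcal D^*(X)$. Two subsets $S,T$ of $\mathbf Z$ are *transversal* if there are $s\in S\setminus T$ and $t\in T\setminus S$; subsets $S_1,\dots,S_r$ are *transversal* if each $S_i$ is transversal to the union of the others. **Theorem.** 1. If $S$ and $T$ are transversal subsets of $\mathbf Z$ and $M$, $N$ are flat cosimplicial $k$-modules (each $M^n$ and $N^n$ is flat), the inclusion $${}_S\mathcal D^*(M)\,\overline\otimes\,{}_T\mathcal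 D^*(N)\longrightarrow{}_S\mathcal D^*(M)\otimes{}_T\mathcal D^*(N)$$ is a quasi-isomorphism. 2. In particular, if $S$ and $T$ are transversal and $X$, $Y$ are arbitrary simplicial sets, the inclusion ${}_S\mathcal D^*(X)\,\overline\otimes\,{}_T\mathcal D^*(Y)\to{}_S\mathcal D^*(X)\otimes{}_T\mathcal D^*(Y)$ is a quasi-isomorphism. 3. If $S_1,\dots,S_r$ are transversal subsets of $\mathbf Z$ and $X_1,\dots,X_r$ are simplicial sets, the inclusion $${}_{S_1}\mathcal D^*(X_1)\,\overline\otimes\cdots\overline\otimes\,{}_{S_r}\mathcal D^*(X_r)\longrightarrow{}_{S_1}\mathcal D^*(X_1)\otimes\cdots\otimes{}_{S_r}\mathcal D^*(X_r)$$ is a quasi-isomorphism. 4. For all simplicial sets $X_1,\dots,X_r$, the inclusion $$\mathcal D^*(X_1)\,\overline\otimes\cdots\overline\otimes\,\mathcal D^*(X_r)\longrightarrow\mathcal D^*(X_1)\otimes\cdots\otimes\mathcal D^*(X_r)$$ is a quasi-isomorphism. -/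

import Mathlib

open CategoryTheory TensorProduct

universe u v w z

namespace QuasiCommutative

/-! ## The simplicial differential graded module of forms on the standard simplices -/

/-- The standard basis of the module of forms in one variable `x : ℤ`: the constant function `1`,
the Heaviside functions `heav s` (equal to `1` for `x ≤ s` and to `0` otherwise), of degree `0`, and the
Dirac functions `dirac s` (the indicator function of `s`, seen as a form of degree `1`). -/
inductive Letter : Type
  | one : Letter
  | heav (s : ℤ) : Letter
  | dirac (s : ℤ) : Letter

namespace Letter

/-- The cohomological degree. -/
def deg : Letter → ℕ
  | one => 0
  | heav _ => 0
  | dirac _ => 1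

/-- The singular support. -/
def supp : Letter → Set ℤ
  | one => ∅
  | heav s => {s}
  | dirac s => {s}

/-- The differential in one variable is `d 1 = 0`, `d (heav s) = - dirac s`, `d (dirac s) = 0`, that is
`d a = (diffCoeff a) • (diff a)`. -/
def diff : Letter → Letter
  | one => one
  | heav s => dirac s
  | dirac s => dirac s

/-- The coefficient of `diff a` in the differential of `a`. -/
def diffCoeff (k : Type u) [CommRing k] : Letter → k
  | one => 0
  | heav _ => -1
  | dirac _ => 0

/-- The value at `x = -∞`. -/
def atBot (k : Type u) [CommRing k] : Letter → k
  | one => 1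
  | heav _ => 1
  | dirac _ => 0

lemma deg_heav (s : ℤ) : (heav s).deg = 0 := rfl

lemma deg_dirac (s : ℤ) : (dirac s).deg = 1 := rfl

lemma diff_heav (s : ℤ) : (heav s).diff = dirac s := rfl

lemma diffCoeff_heav (k : Type u) [CommRing k] (s : ℤ) : (heav s).diffCoeff k = -1 := rfl

lemma diffCoeff_dirac (k : Type u) [CommRing k] (s : ℤ) : (dirac s).diffCoeff k = 0 := rfl

end Letter

/-- A pure tensor `f 0 ⊗ ⋯ ⊗ f n` of basis forms in the variables `x 0, …, x n`. -/
abbrev Word (n : ℕ) : Type := Fin (n + 1) → Letter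

namespace Word

variable {n : ℕ}

/-- The degree of a pure tensor. -/
def deg (f : Word n) : ℕ := ∑ i, (f i).deg

/-- The singular support of a pure tensor: the union of those of its factors. -/
def supp (f : Word n) : Set ℤ := ⋃ i, (f i).supp

/-- The Koszul exponent: the degree of the part of the tensor standing before place `i`. -/
def koszul (f : Word n) (i : Fin (n + 1)) : ℕ := ∑ j, if j < i then (f j).deg else 0

end Word

/-- The forms on the `(n+1)`-cube, in the variables `x 0, …, x n`: the `(n+1)`-st tensor power of the
module of forms in one variable, described by its basis of pure tensors. -/
abbrev Cube (k : Type u) [CommRing k] (n : ℕ) : Type u := Word n →₀ k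

namespace Cube

variable (k : Type u) [CommRing k]

/-- The differential on the forms on the cube, given by the graded Leibniz rule. -/
noncomputable def d (n : ℕ) : Cube k n →ₗ[k] Cube k n :=
  Finsupp.lift _ k _ fun f => ∑ i, ((-1) ^ f.koszul i * (f i).diffCoeff k) •
    Finsupp.single (Function.update f i (f i).diff) 1

/-- The grading involution, equal to `(-1)^j` in degree `j`. -/
noncomputable def sgn (n : ℕ) : Cube k n →ₗ[k] Cube k n :=
  Finsupp.lift _ k _ fun f => (-1 : k) ^ f.deg • Finsupp.single f 1

/-- The `i`-th face: set `x i = -∞`. -/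
noncomputable def face (n : ℕ) (i : Fin (n + 2)) : Cube k (n + 1) →ₗ[k] Cube k n :=
  Finsupp.lift _ k _ fun f => (f i).atBot k • Finsupp.single (i.removeNth f) 1

/-- `insert i a h` inserts the letter `a` at place `i`, just before the `i`-th letter of `h`. -/
def insert {n : ℕ} (i : Fin (n + 1)) (a : Letter) (h : Word n) : Word (n + 1) :=
  i.castSucc.insertNth (α := fun _ => Letter) a h

/-- The `i`-th degeneracy: replace the form in the `i`-th variable by its image under the coproduct
`1 ↦ 1 ⊗ 1`, `heav s ↦ heav s ⊗ heav s`, `dirac s ↦ dirac s ⊗ heav s + heav s ⊗ dirac s`. -/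
noncomputable def degen (n : ℕ) (i : Fin (n + 1)) : Cube k n →ₗ[k] Cube k (n + 1) :=
  Finsupp.lift _ k _ fun f => match f i with
    | .one => Finsupp.single (insert i .one f) 1
    | .heav s => Finsupp.single (insert i (.heav s) f) 1
    | .dirac s => Finsupp.single (insert i (.dirac s) (Function.update f i (.heav s))) 1 +
        Finsupp.single (insert i (.heav s) f) 1

/-- The submodule of the forms on the cube which vanish when one of the variables is `+∞`. At `+∞`
the functions `heav s` and `dirac s` vanish, while `1` does not. -/
noncomputable def vanishing (n : ℕ) : Submodule k (Cube k n) :=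
  Submodule.span k {x | ∃ f : Word n, (∀ i, f i ≠ .one) ∧ x = Finsupp.single f 1}

variable {k}

lemma d_single {n : ℕ} (f : Word n) : d k n (Finsupp.single f 1) =
    ∑ i, ((-1) ^ f.koszul i * (f i).diffCoeff k) •
      Finsupp.single (Function.update f i (f i).diff) 1 := by
  rw [d, Finsupp.lift_apply, Finsupp.sum_single_index, one_smul]
  exact zero_smul _ _

lemma sgn_single {n : ℕ} (f : Word n) : sgn k n (Finsupp.single f 1) =
    (-1 : k) ^ f.deg • Finsupp.single f 1 := by
  rw [sgn, Finsupp.lift_apply, Finsupp.sum_single_index, one_smul]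
  exact zero_smul _ _

lemma face_single {n : ℕ} (i : Fin (n + 2)) (f : Word (n + 1)) :
    face k n i (Finsupp.single f 1) =
      (f i).atBot k • Finsupp.single (i.removeNth f) 1 := by
  rw [face, Finsupp.lift_apply, Finsupp.sum_single_index, one_smul]
  exact zero_smul _ _

lemma degen_single {n : ℕ} (i : Fin (n + 1)) (f : Word n) :
    degen k n i (Finsupp.single f 1) = match f i with
    | .one => Finsupp.single (insert i .one f) 1
    | .heav s => Finsupp.single (insert i (.heav s) f) 1
    | .dirac s => Finsupp.single (insert i (.dirac s) (Function.update f i (.heav s))) 1 +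
        Finsupp.single (insert i (.heav s) f) 1 := by
  rw [degen, Finsupp.lift_apply, Finsupp.sum_single_index, one_smul]
  exact zero_smul _ _

lemma koszul_update_of_deg {n : ℕ} (f : Word n) (i j : Fin (n + 1)) (a : Letter)
    (h : ¬ i < j) : Word.koszul (Function.update f i a) j = f.koszul j := by
  unfold Word.koszul
  refine Finset.sum_congr rfl fun l _ => ?_
  by_cases hl : l = i
  · subst hl; simp [h]
  · simp [hl]

lemma koszul_update_lt {n : ℕ} (f : Word n) (i j : Fin (n + 1)) (a : Letter)
    (h : i < j) : Word.koszul (Function.update f i a) j + (f i).deg = f.koszul j + a.deg := by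
  unfold Word.koszul
  rw [← Finset.add_sum_erase _ _ (Finset.mem_univ i), ← Finset.add_sum_erase _ (fun l => if l < j then (f l).deg else 0) (Finset.mem_univ i)]
  have : ∀ l ∈ Finset.univ.erase i, (if l < j then (Function.update f i a l).deg else 0) =
      if l < j then (f l).deg else 0 := by
    intro l hl
    have := Finset.ne_of_mem_erase hl
    simp [this]
  rw [Finset.sum_congr rfl this]
  simp [h]; ring

lemma d_d {n : ℕ} (x : Cube k n) : d k n (d k n x) = 0 := by
  suffices h : d k n ∘ₗ d k n = 0 from LinearMap.congr_fun h x
  refine Finsupp.lhom_ext' fun f => LinearMap.ext_ring ?_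
  simp only [LinearMap.comp_apply, Finsupp.lsingle_apply, d_single, map_sum, map_smul,
    LinearMap.zero_apply, Finset.smul_sum, smul_smul]
  rw [← Finset.sum_product']
  refine Finset.sum_involution (fun a _ => (a.2, a.1)) ?_ ?_ (by simp) (by simp)
  · rintro ⟨i, j⟩ -
    by_cases hij : i = j
    · subst hij
      rcases h : f i with _ | s | s <;> simp [Letter.diff, Letter.diffCoeff]
    · have hji : j ≠ i := Ne.symm hij
      simp only [Function.update_of_ne hij, Function.update_of_ne hji]
      rw [Function.update_comm hij]
      rw [← add_smul]
      convert zero_smul k _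
      rcases h : f i with _ | s | s <;> rcases h' : f j with _ | t | t <;>
        simp only [Letter.diffCoeff, mul_zero, zero_mul, add_zero]
      rcases lt_or_gt_of_ne hij with hlt | hlt
      · have e1 := koszul_update_lt f i j (Letter.dirac s) hlt
        have e2 := koszul_update_of_deg f j i (Letter.dirac t) (not_lt.2 hlt.le)
        simp only [h, Letter.deg, add_zero] at e1
        simp only [Letter.diff]
        rw [e1, e2, pow_succ]; ring
      · have e1 := koszul_update_lt f j i (Letter.dirac t) hlt
        have e2 := koszul_update_of_deg f i j (Letter.dirac s) (not_lt.2 hlt.le)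
        simp only [h', Letter.deg, add_zero] at e1
        simp only [Letter.diff]
        rw [e1, e2, pow_succ]; ring
  · rintro ⟨i, j⟩ - hne heq
    apply hne
    simp only [Prod.mk.injEq] at heq
    obtain rfl : j = i := heq.1
    rcases h : f j with _ | s | s <;> simp [Letter.diff, Letter.diffCoeff]

lemma deg_update {n : ℕ} (f : Word n) (i : Fin (n + 1)) (a : Letter) :
    Word.deg (Function.update f i a) + (f i).deg = f.deg + a.deg := by
  unfold Word.deg
  rw [← Finset.add_sum_erase _ _ (Finset.mem_univ i),
    ← Finset.add_sum_erase _ (fun l => (f l).deg) (Finset.mem_univ i)]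
  have : ∀ l ∈ Finset.univ.erase i, (Function.update f i a l).deg = (f l).deg := by
    intro l hl
    have := Finset.ne_of_mem_erase hl
    simp [this]
  rw [Finset.sum_congr rfl this]
  simp; ring

lemma sgn_d {n : ℕ} (x : Cube k n) : sgn k n (d k n x) = - d k n (sgn k n x) := by
  suffices h : sgn k n ∘ₗ d k n = - (d k n ∘ₗ sgn k n) from LinearMap.congr_fun h x
  refine Finsupp.lhom_ext' fun f => LinearMap.ext_ring ?_
  simp only [LinearMap.comp_apply, Finsupp.lsingle_apply, d_single, sgn_single, map_sum, map_smul,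
    LinearMap.neg_apply, Finset.smul_sum, smul_smul, ← Finset.sum_neg_distrib]
  refine Finset.sum_congr rfl fun i _ => ?_
  rcases h : f i with _ | s | s <;> simp only [Letter.diffCoeff, mul_zero, zero_mul, zero_smul,
    neg_zero]
  have e := deg_update f i (Letter.dirac s)
  simp only [h, Letter.deg, add_zero] at e
  simp only [Letter.diff]
  rw [e, ← neg_smul, pow_succ]
  congr 1; ring

/-- The differential in terms of a distinguished place. -/
lemma d_insertNth {n : ℕ} (p : Fin (n + 2)) (a : Letter) (h : Word n) :
    d k (n + 1) (Finsupp.single (p.insertNth (α := fun _ => Letter) a h) 1) =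
      ((-1) ^ (∑ l, if p.succAbove l < p then (h l).deg else 0) * a.diffCoeff k) •
        Finsupp.single (p.insertNth (α := fun _ => Letter) a.diff h) 1 +
      ∑ j, ((-1) ^ ((if p < p.succAbove j then a.deg else 0) + h.koszul j) *
        (h j).diffCoeff k) •
        Finsupp.single (p.insertNth (α := fun _ => Letter) a
          (Function.update h j (h j).diff)) 1 := by
  rw [d_single, Fin.sum_univ_succAbove _ p]
  congr 1
  · simp only [Word.koszul, Fin.sum_univ_succAbove _ p, Fin.insertNth_apply_same, lt_irrefl,
      if_false, zero_add, Fin.insertNth_apply_succAbove, Fin.update_insertNth]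
  · refine Finset.sum_congr rfl fun j _ => ?_
    simp only [Word.koszul, Fin.sum_univ_succAbove _ p, Fin.insertNth_apply_same,
      Fin.insertNth_apply_succAbove, Fin.insertNth_update, Fin.succAbove_lt_succAbove_iff]

lemma face_d {n : ℕ} (i : Fin (n + 2)) (x : Cube k (n + 1)) :
    face k n i (d k (n + 1) x) = d k n (face k n i x) := by
  suffices h : face k n i ∘ₗ d k (n + 1) = d k n ∘ₗ face k n i from LinearMap.congr_fun h x
  refine Finsupp.lhom_ext' fun f => LinearMap.ext_ring ?_
  obtain ⟨a, h, rfl⟩ : ∃ a h, f = i.insertNth (α := fun _ => Letter) a h :=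
    ⟨f i, i.removeNth f, (Fin.insertNth_self_removeNth i f).symm⟩
  simp only [LinearMap.comp_apply, Finsupp.lsingle_apply]
  rw [d_insertNth]
  simp only [map_add, map_sum, map_smul, face_single, Fin.insertNth_apply_same,
    Fin.removeNth_insertNth, d_single]
  rcases a with _ | s | s <;> simp only [Letter.atBot, Letter.deg, Letter.diff, Letter.diffCoeff,
    one_smul, zero_smul, smul_zero, Finset.sum_const_zero, mul_zero, add_zero, zero_add, ite_self]

lemma face_sgn {n : ℕ} (i : Fin (n + 2)) (x : Cube k (n + 1)) :
    face k n i (sgn k (n + 1) x) = sgn k n (face k n i x) := by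
  suffices h : face k n i ∘ₗ sgn k (n + 1) = sgn k n ∘ₗ face k n i from LinearMap.congr_fun h x
  refine Finsupp.lhom_ext' fun f => LinearMap.ext_ring ?_
  simp only [LinearMap.comp_apply, Finsupp.lsingle_apply, map_smul, face_single, sgn_single]
  have e : f.deg = (f i).deg + Word.deg (i.removeNth f) := by
    simp [Word.deg, Fin.sum_univ_succAbove _ i, Fin.removeNth]
  rw [e]
  rcases h : f i with _ | s | s <;> simp only [Letter.atBot, Letter.deg, zero_add, one_smul,
    zero_smul, smul_zero]

lemma deg_insert {n : ℕ} (i : Fin (n + 1)) (a : Letter) (h : Word n) :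
    (insert i a h).deg = a.deg + h.deg := by
  simp [Word.deg, insert, Fin.sum_univ_succAbove _ i.castSucc]

lemma degen_sgn {n : ℕ} (i : Fin (n + 1)) (x : Cube k n) :
    degen k n i (sgn k n x) = sgn k (n + 1) (degen k n i x) := by
  suffices h : degen k n i ∘ₗ sgn k n = sgn k (n + 1) ∘ₗ degen k n i from LinearMap.congr_fun h x
  refine Finsupp.lhom_ext' fun f => LinearMap.ext_ring ?_
  simp only [LinearMap.comp_apply, Finsupp.lsingle_apply, map_smul, sgn_single, degen_single]
  rcases h : f i with _ | s | s
  · simp only [sgn_single, deg_insert, Letter.deg, zero_add]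
  · simp only [sgn_single, deg_insert, Letter.deg, zero_add]
  · have e := deg_update f i (Letter.heav s)
    simp only [h, Letter.deg] at e
    simp only [map_add, sgn_single, deg_insert, Letter.deg, zero_add, smul_add]
    rw [add_comm 1, e, add_zero]

lemma d_insert {n : ℕ} (i : Fin (n + 1)) (a : Letter) (h : Word n) :
    d k (n + 1) (Finsupp.single (insert i a h) 1) =
      ((-1) ^ h.koszul i * a.diffCoeff k) • Finsupp.single (insert i a.diff h) 1 +
      ∑ j, ((-1) ^ ((if i ≤ j then a.deg else 0) + h.koszul j) * (h j).diffCoeff k) •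
        Finsupp.single (insert i a (Function.update h j (h j).diff)) 1 := by
  unfold insert
  rw [d_insertNth]
  have e1 : ∀ l : Fin (n + 1), i.castSucc.succAbove l < i.castSucc ↔ l < i := by
    intro l
    rw [Fin.succAbove_lt_iff_castSucc_lt]; simp
  have e2 : ∀ l : Fin (n + 1), i.castSucc < i.castSucc.succAbove l ↔ i ≤ l := by
    intro l
    rw [Fin.lt_succAbove_iff_le_castSucc]; simp
  simp only [e1, e2]
  rfl

lemma degen_d {n : ℕ} (i : Fin (n + 1)) (x : Cube k n) :
    degen k n i (d k n x) = d k (n + 1) (degen k n i x) := by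
  suffices h : degen k n i ∘ₗ d k n = d k (n + 1) ∘ₗ degen k n i from LinearMap.congr_fun h x
  refine Finsupp.lhom_ext' fun f => LinearMap.ext_ring ?_
  simp only [LinearMap.comp_apply, Finsupp.lsingle_apply, d_single, map_sum, map_smul]
  have hj : ∀ (a : Letter) (j : Fin (n + 1)), j ≠ i → Function.update f j a i = f i :=
    fun a j h => Function.update_of_ne h.symm _ _
  rcases h : f i with _ | s | s
  · have e : degen k n i (Finsupp.single f 1) = Finsupp.single (insert i .one f) 1 := by
      rw [degen_single, h]
    rw [e, d_insert]
    simp only [Letter.diffCoeff, Letter.deg, ite_self, zero_add, mul_zero, zero_smul]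
    refine Finset.sum_congr rfl fun j _ => ?_
    by_cases hji : j = i
    · subst hji; simp only [h, mul_zero, zero_smul]
    · rw [degen_single, hj _ _ hji, h]
  · have e : degen k n i (Finsupp.single f 1) = Finsupp.single (insert i (.heav s) f) 1 := by
      rw [degen_single, h]
    rw [e, d_insert, ← Finset.add_sum_erase _ _ (Finset.mem_univ i),
      ← Finset.add_sum_erase Finset.univ (fun j => ((-1 : k) ^ ((if i ≤ j then
        (Letter.heav s).deg else 0) + f.koszul j) * (f j).diffCoeff k) •
        Finsupp.single (insert i (.heav s) (Function.update f j (f j).diff)) (1 : k))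
        (Finset.mem_univ i), ← add_assoc]
    congr 1
    · rw [degen_single]
      simp only [h, Function.update_self, Letter.diff, Letter.diffCoeff, Letter.deg, ite_self,
        zero_add, Function.update_idem, smul_add]
      rw [← h, Function.update_eq_self]
    · refine Finset.sum_congr rfl fun j hj' => ?_
      have hji := Finset.ne_of_mem_erase hj'
      rw [degen_single, hj _ _ hji, h]
      simp only [Letter.deg, ite_self, zero_add]
  · have e : degen k n i (Finsupp.single f 1) =
        Finsupp.single (insert i (.dirac s) (Function.update f i (.heav s))) 1 +
        Finsupp.single (insert i (.heav s) f) 1 := by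
      rw [degen_single, h]
    rw [e, map_add, d_insert, d_insert]
    simp only [Letter.diffCoeff_heav, Letter.diffCoeff_dirac, Letter.deg_heav, Letter.deg_dirac,
      Letter.diff_heav, ite_self, zero_add, mul_zero, zero_smul]
    rw [← Finset.add_sum_erase _ _ (Finset.mem_univ i)]
    simp only [h, Letter.diffCoeff_dirac, mul_zero, zero_smul, zero_add]
    have hk : Word.koszul (Function.update f i (.heav s)) i = f.koszul i :=
      koszul_update_of_deg f i i _ (lt_irrefl i)
    have e1 : ∑ j, ((-1 : k) ^ ((if i ≤ j then 1 else 0) +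
        Word.koszul (Function.update f i (.heav s)) j) *
        Letter.diffCoeff k (Function.update f i (.heav s) j)) •
        Finsupp.single (insert i (.dirac s) (Function.update (Function.update f i (.heav s)) j
          (Function.update f i (.heav s) j).diff)) (1 : k) =
        (-1 : k) ^ f.koszul i • Finsupp.single (insert i (.dirac s) f) 1 +
        ∑ j ∈ Finset.univ.erase i, ((-1 : k) ^ f.koszul j * (f j).diffCoeff k) •
          Finsupp.single (insert i (.dirac s)
            (Function.update (Function.update f j (f j).diff) i (.heav s))) (1 : k) := by
      rw [← Finset.add_sum_erase _ _ (Finset.mem_univ i)]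
      congr 1
      · rw [hk]
        simp only [le_refl, if_true, Function.update_self, Letter.diff_heav, Letter.diffCoeff_heav,
          Function.update_idem]
        rw [← h, Function.update_eq_self, pow_add, pow_one]
        congr 1; ring
      · refine Finset.sum_congr rfl fun j hj' => ?_
        have hji := Finset.ne_of_mem_erase hj'
        rw [Function.update_of_ne hji, Function.update_comm hji]
        congr 3
        rcases lt_or_gt_of_ne hji with hlt | hlt
        · rw [if_neg (not_le.2 hlt), zero_add, koszul_update_of_deg f i j _ (not_lt.2 hlt.le)]
        · have := koszul_update_lt f i j (.heav s) hlt
          simp only [h, Letter.deg, add_zero] at this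
          rw [if_pos hlt.le, add_comm, this]
    have e2 : ∑ j, ((-1 : k) ^ f.koszul j * (f j).diffCoeff k) •
        Finsupp.single (insert i (.heav s) (Function.update f j (f j).diff)) (1 : k) =
        ∑ j ∈ Finset.univ.erase i, ((-1 : k) ^ f.koszul j * (f j).diffCoeff k) •
          Finsupp.single (insert i (.heav s) (Function.update f j (f j).diff)) (1 : k) := by
      rw [← Finset.add_sum_erase _ _ (Finset.mem_univ i)]
      simp only [h, Letter.diffCoeff_dirac, mul_zero, zero_smul, zero_add]
    have e3 : ∑ j ∈ Finset.univ.erase i, ((-1 : k) ^ f.koszul j * (f j).diffCoeff k) •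
        degen k n i (Finsupp.single (Function.update f j (f j).diff) 1) =
        ∑ j ∈ Finset.univ.erase i, ((-1 : k) ^ f.koszul j * (f j).diffCoeff k) •
          Finsupp.single (insert i (.dirac s)
            (Function.update (Function.update f j (f j).diff) i (.heav s))) (1 : k) +
        ∑ j ∈ Finset.univ.erase i, ((-1 : k) ^ f.koszul j * (f j).diffCoeff k) •
          Finsupp.single (insert i (.heav s) (Function.update f j (f j).diff)) (1 : k) := by
      rw [← Finset.sum_add_distrib]
      refine Finset.sum_congr rfl fun j hj' => ?_
      rw [degen_single, hj _ _ (Finset.ne_of_mem_erase hj'), h, ← smul_add]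
    rw [e1, e2, e3]
    simp only [mul_neg, mul_one, neg_smul]
    abel

lemma vanishing_le_comap {m n : ℕ} (φ : Cube k m →ₗ[k] Cube k n)
    (h : ∀ f : Word m, (∀ i, f i ≠ .one) → φ (Finsupp.single f 1) ∈ vanishing k n) :
    vanishing k m ≤ (vanishing k n).comap φ := by
  refine Submodule.span_le.2 ?_
  rintro _ ⟨f, hf, rfl⟩
  exact h f hf

lemma single_mem_vanishing {n : ℕ} {f : Word n} (hf : ∀ i, f i ≠ .one) :
    Finsupp.single f 1 ∈ vanishing k n := Submodule.subset_span ⟨f, hf, rfl⟩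

lemma update_ne_one {n : ℕ} {f : Word n} (hf : ∀ i, f i ≠ .one) (i : Fin (n + 1)) {a : Letter}
    (ha : a ≠ .one) (j : Fin (n + 1)) : Function.update f i a j ≠ .one := by
  by_cases hj : j = i
  · subst hj; simpa using ha
  · simpa [hj] using hf j

lemma insert_ne_one {n : ℕ} {f : Word n} (hf : ∀ i, f i ≠ .one) (i : Fin (n + 1)) {a : Letter}
    (ha : a ≠ .one) (j : Fin (n + 2)) : insert i a f j ≠ .one := by
  unfold insert
  induction j using Fin.succAboveCases i.castSucc with
  | x => simpa using ha
  | p j => simpa using hf j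

variable (k)

lemma vanishing_d (n : ℕ) : vanishing k n ≤ (vanishing k n).comap (d k n) :=
  vanishing_le_comap _ fun f hf => by
    rw [d_single]
    refine Submodule.sum_mem _ fun i _ => Submodule.smul_mem _ _ (single_mem_vanishing ?_)
    refine update_ne_one hf i ?_
    rcases h : f i with _ | s | s
    · exact absurd h (hf i)
    · simp [Letter.diff]
    · simp [Letter.diff]

lemma vanishing_sgn (n : ℕ) : vanishing k n ≤ (vanishing k n).comap (sgn k n) :=
  vanishing_le_comap _ fun f hf => by
    rw [sgn_single]
    exact Submodule.smul_mem _ _ (single_mem_vanishing hf)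

lemma vanishing_face (n : ℕ) (i : Fin (n + 2)) :
    vanishing k (n + 1) ≤ (vanishing k n).comap (face k n i) :=
  vanishing_le_comap _ fun f hf => by
    rw [face_single]
    exact Submodule.smul_mem _ _ (single_mem_vanishing fun j => hf _)

lemma vanishing_degen (n : ℕ) (i : Fin (n + 1)) :
    vanishing k n ≤ (vanishing k (n + 1)).comap (degen k n i) :=
  vanishing_le_comap _ fun f hf => by
    rw [degen_single]
    rcases h : f i with _ | s | s
    · exact absurd h (hf i)
    · exact single_mem_vanishing (insert_ne_one hf i (by simp))
    · exact Submodule.add_mem _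
        (single_mem_vanishing (insert_ne_one (update_ne_one hf i (by simp)) i (by simp)))
        (single_mem_vanishing (insert_ne_one hf i (by simp)))

end Cube

/-- The forms on the standard simplex `Δ_n`, seen as the part of the `(n+1)`-cube where at least one
of the variables is `+∞`. -/
abbrev Forms (k : Type u) [CommRing k] (n : ℕ) : Type u := Cube k n ⧸ Cube.vanishing k n

namespace Forms

variable (k : Type u) [CommRing k]

/-- The differential. -/
noncomputable def d (n : ℕ) : Forms k n →ₗ[k] Forms k n :=
  Submodule.mapQ _ _ (Cube.d k n) (Cube.vanishing_d k n)

/-- The grading involution, equal to `(-1)^j` in degree `j`. -/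
noncomputable def sgn (n : ℕ) : Forms k n →ₗ[k] Forms k n :=
  Submodule.mapQ _ _ (Cube.sgn k n) (Cube.vanishing_sgn k n)

/-- The faces of the simplicial module `n ↦ Forms k n`. -/
noncomputable def face (n : ℕ) (i : Fin (n + 2)) : Forms k (n + 1) →ₗ[k] Forms k n :=
  Submodule.mapQ _ _ (Cube.face k n i) (Cube.vanishing_face k n i)

/-- The degeneracies of the simplicial module `n ↦ Forms k n`. -/
noncomputable def degen (n : ℕ) (i : Fin (n + 1)) : Forms k n →ₗ[k] Forms k (n + 1) :=
  Submodule.mapQ _ _ (Cube.degen k n i) (Cube.vanishing_degen k n i)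

variable {k} in
/-- The class on the simplex of a pure tensor of basis forms on the cube. -/
noncomputable def of {n : ℕ} (f : Word n) : Forms k n :=
  Submodule.Quotient.mk (Finsupp.single f 1)

/-- The forms of degree `j`. -/
noncomputable def gr (n j : ℕ) : Submodule k (Forms k n) :=
  Submodule.span k {x | ∃ f : Word n, f.deg = j ∧ x = of f}

/-- The forms with singular support in `S`. -/
noncomputable def supported (n : ℕ) (S : Set ℤ) : Submodule k (Forms k n) :=
  Submodule.span k {x | ∃ f : Word n, f.supp ⊆ S ∧ x = of f}

/-- The submodule generated by the degenerate forms on `Δ_{n+1}`. -/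
noncomputable def degenerate (n : ℕ) : Submodule k (Forms k (n + 1)) :=
  ⨆ i : Fin (n + 1), LinearMap.range (degen k n i)

/-- The reduced tensor product of the forms on `Δ_p` and of the forms on `Δ_q`: the span of the tensor
products of pure tensors of basis forms with disjoint singular supports. -/
noncomputable def reduced (p q : ℕ) : Submodule k (Forms k p ⊗[k] Forms k q) :=
  Submodule.span k {x | ∃ (f : Word p) (g : Word q), Disjoint f.supp g.supp ∧ x = of f ⊗ₜ of g}

variable {k}

lemma d_d {n : ℕ} (x : Forms k n) : d k n (d k n x) = 0 := by
  obtain ⟨x, rfl⟩ := Submodule.Quotient.mk_surjective _ x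
  simp [d, Cube.d_d]

lemma sgn_d {n : ℕ} (x : Forms k n) : sgn k n (d k n x) = - d k n (sgn k n x) := by
  obtain ⟨x, rfl⟩ := Submodule.Quotient.mk_surjective _ x
  simp [d, sgn, Cube.sgn_d]

lemma face_d {n : ℕ} (i : Fin (n + 2)) :
    face k n i ∘ₗ d k (n + 1) = d k n ∘ₗ face k n i := by
  refine LinearMap.ext fun x => ?_
  obtain ⟨x, rfl⟩ := Submodule.Quotient.mk_surjective _ x
  simp [d, face, Cube.face_d]

lemma face_sgn {n : ℕ} (i : Fin (n + 2)) :
    face k n i ∘ₗ sgn k (n + 1) = sgn k n ∘ₗ face k n i := by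
  refine LinearMap.ext fun x => ?_
  obtain ⟨x, rfl⟩ := Submodule.Quotient.mk_surjective _ x
  simp [sgn, face, Cube.face_sgn]

lemma degen_d {n : ℕ} (i : Fin (n + 1)) :
    degen k n i ∘ₗ d k n = d k (n + 1) ∘ₗ degen k n i := by
  refine LinearMap.ext fun x => ?_
  obtain ⟨x, rfl⟩ := Submodule.Quotient.mk_surjective _ x
  simp [d, degen, Cube.degen_d]

lemma degen_sgn {n : ℕ} (i : Fin (n + 1)) :
    degen k n i ∘ₗ sgn k n = sgn k (n + 1) ∘ₗ degen k n i := by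
  refine LinearMap.ext fun x => ?_
  obtain ⟨x, rfl⟩ := Submodule.Quotient.mk_surjective _ x
  simp [sgn, degen, Cube.degen_sgn]

lemma d_of {n : ℕ} (f : Word n) : d k n (of f) =
    ∑ i, ((-1) ^ f.koszul i * (f i).diffCoeff k) • of (Function.update f i (f i).diff) := by
  unfold d of
  rw [Submodule.mapQ_apply, Cube.d_single, ← Submodule.mkQ_apply, map_sum]
  simp only [map_smul, Submodule.mkQ_apply]

lemma sgn_of {n : ℕ} (f : Word n) : sgn k n (of f) = (-1 : k) ^ f.deg • of f := by
  unfold sgn of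
  rw [Submodule.mapQ_apply, Cube.sgn_single, ← Submodule.mkQ_apply, map_smul]
  rfl

lemma supp_update_diff {n : ℕ} (f : Word n) (i : Fin (n + 1)) :
    Word.supp (Function.update f i (f i).diff) = f.supp := by
  unfold Word.supp
  refine Set.iUnion_congr fun j => ?_
  by_cases h : j = i
  · subst h
    rw [Function.update_self]
    cases f j <;> rfl
  · rw [Function.update_of_ne h]

/-- The differential does not increase the singular support. -/
lemma d_of_mem {n : ℕ} (f : Word n) (W : Submodule k (Forms k n))
    (h : ∀ g : Word n, g.supp = f.supp → of g ∈ W) : d k n (of f) ∈ W := by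
  rw [d_of]
  exact Submodule.sum_mem _ fun i _ => Submodule.smul_mem _ _ (h _ (supp_update_diff f i))

lemma gr_d {n j : ℕ} : gr k n j ≤ (gr k n (j + 1)).comap (d k n) := by
  refine Submodule.span_le.2 ?_
  rintro _ ⟨f, rfl, rfl⟩
  rw [SetLike.mem_coe, Submodule.mem_comap, d_of]
  refine Submodule.sum_mem _ fun i _ => ?_
  rcases h : f i with _ | s | s
  · simp [Letter.diffCoeff]
  · refine Submodule.smul_mem _ _ (Submodule.subset_span ⟨_, ?_, rfl⟩)
    have := Cube.deg_update f i (Letter.dirac s)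
    rwa [h, Letter.deg_heav, Letter.deg_dirac, add_zero] at this
  · simp [Letter.diffCoeff]

lemma sgn_gr {n j : ℕ} (x : Forms k n) (hx : x ∈ gr k n j) : sgn k n x = (-1 : k) ^ j • x := by
  have : gr k n j ≤ LinearMap.ker (sgn k n - (-1 : k) ^ j • LinearMap.id) := by
    refine Submodule.span_le.2 ?_
    rintro _ ⟨f, rfl, rfl⟩
    simp [sgn_of]
  simpa [sub_eq_zero] using this hx

lemma supported_d {n : ℕ} {S : Set ℤ} : supported k n S ≤ (supported k n S).comap (d k n) := by
  refine Submodule.span_le.2 ?_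
  rintro _ ⟨f, hf, rfl⟩
  exact d_of_mem f (supported k n S) fun g hg => Submodule.subset_span ⟨g, hg.trans_subset hf, rfl⟩

lemma supported_sgn {n : ℕ} {S : Set ℤ} :
    supported k n S ≤ (supported k n S).comap (sgn k n) := by
  refine Submodule.span_le.2 ?_
  rintro _ ⟨f, hf, rfl⟩
  rw [SetLike.mem_coe, Submodule.mem_comap, sgn_of]
  exact Submodule.smul_mem _ _ (Submodule.subset_span ⟨f, hf, rfl⟩)

lemma supported_mono {n : ℕ} {S T : Set ℤ} (h : S ⊆ T) : supported k n S ≤ supported k n T := by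
  refine Submodule.span_mono ?_
  rintro _ ⟨f, hf, rfl⟩
  exact ⟨f, hf.trans h, rfl⟩

lemma degenerate_d {n : ℕ} : degenerate k n ≤ (degenerate k n).comap (d k (n + 1)) := by
  refine iSup_le fun i => ?_
  rintro _ ⟨x, rfl⟩
  refine Submodule.mem_iSup_of_mem i ⟨d k n x, ?_⟩
  exact LinearMap.congr_fun (degen_d i) x

lemma degenerate_sgn {n : ℕ} : degenerate k n ≤ (degenerate k n).comap (sgn k (n + 1)) := by
  refine iSup_le fun i => ?_
  rintro _ ⟨x, rfl⟩
  refine Submodule.mem_iSup_of_mem i ⟨sgn k n x, ?_⟩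
  exact LinearMap.congr_fun (degen_sgn i) x

lemma reduced_le_comap {p q : ℕ} {φ : Forms k p →ₗ[k] Forms k p} {ψ : Forms k q →ₗ[k] Forms k q}
    (hφ : ∀ (f : Word p) (W : Submodule k (Forms k p)),
      (∀ g : Word p, g.supp = f.supp → of g ∈ W) → φ (of f) ∈ W)
    (hψ : ∀ (f : Word q) (W : Submodule k (Forms k q)),
      (∀ g : Word q, g.supp = f.supp → of g ∈ W) → ψ (of f) ∈ W) :
    reduced k p q ≤ (reduced k p q).comap (TensorProduct.map φ ψ) := by
  refine Submodule.span_le.2 ?_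
  rintro _ ⟨f, g, hfg, rfl⟩
  rw [SetLike.mem_coe, Submodule.mem_comap, TensorProduct.map_tmul]
  refine hφ f ((reduced k p q).comap ((TensorProduct.mk k _ _).flip (ψ (of g)))) fun f' hf' => ?_
  refine hψ g ((reduced k p q).comap (TensorProduct.mk k _ _ (of f'))) fun g' hg' => ?_
  exact Submodule.subset_span ⟨f', g', by rwa [hf', hg'], rfl⟩

lemma id_of_mem {n : ℕ} (f : Word n) (W : Submodule k (Forms k n))
    (h : ∀ g : Word n, g.supp = f.supp → of g ∈ W) : (LinearMap.id : _ →ₗ[k] _) (of f) ∈ W :=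
  h f rfl

lemma sgn_of_mem {n : ℕ} (f : Word n) (W : Submodule k (Forms k n))
    (h : ∀ g : Word n, g.supp = f.supp → of g ∈ W) : sgn k n (of f) ∈ W := by
  rw [sgn_of]
  exact W.smul_mem _ (h f rfl)

end Forms

/-! ## Differential graded modules and their tensor products -/

/-- A differential graded `k`-module (graded by `ℕ`, with a differential of degree `1`): a module with
its homogeneous submodules `gr n`, the involution `sgn` equal to `(-1)^n` on `gr n`, and the
differential `d`. -/
structure DGModule (k : Type u) [CommRing k] where
  carrier : Type v
  [addCommGroup : AddCommGroup carrier]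
  [module : Module k carrier]
  gr : ℕ → Submodule k carrier
  sgn : carrier →ₗ[k] carrier
  d : carrier →ₗ[k] carrier
  sgn_gr : ∀ n x, x ∈ gr n → sgn x = (-1 : k) ^ n • x
  d_gr : ∀ n x, x ∈ gr n → d x ∈ gr (n + 1)
  sgn_d : ∀ x, sgn (d x) = - d (sgn x)
  d_d : ∀ x, d (d x) = 0

namespace DGModule

attribute [instance] DGModule.addCommGroup DGModule.module

variable {k : Type u} [CommRing k]

/-- The cochain complex underlying a submodule of a differential graded module which is stable under
the differential. -/
noncomputable def subcomplex (A : DGModule.{u, v} k) (F : Submodule k A.carrier)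
    (hF : F ≤ F.comap A.d) : CochainComplex (ModuleCat.{v} k) ℕ :=
  CochainComplex.of (fun n => ModuleCat.of k ↥(F ⊓ A.gr n))
    (fun n => ModuleCat.ofHom (A.d.restrict (q := F ⊓ A.gr (n + 1))
      fun x hx => ⟨hF hx.1, A.d_gr n x hx.2⟩))
    (fun _ => ModuleCat.hom_ext (LinearMap.ext fun x => Subtype.ext (A.d_d x.1)))

/-- The cochain complex underlying a differential graded module. -/
noncomputable def complex (A : DGModule.{u, v} k) : CochainComplex (ModuleCat.{v} k) ℕ :=
  CochainComplex.of (fun n => ModuleCat.of k ↥(A.gr n))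
    (fun n => ModuleCat.ofHom (A.d.restrict (q := A.gr (n + 1)) fun x hx => A.d_gr n x hx))
    (fun _ => ModuleCat.hom_ext (LinearMap.ext fun x => Subtype.ext (A.d_d x.1)))

/-- The inclusion of a subcomplex. -/
noncomputable def inclusion (A : DGModule.{u, v} k) (F : Submodule k A.carrier)
    (hF : F ≤ F.comap A.d) : A.subcomplex F hF ⟶ A.complex :=
  CochainComplex.ofHom (X := A.subcomplex F hF) (Y := A.complex)
    (fun n => ModuleCat.ofHom (Submodule.inclusion (inf_le_right : F ⊓ A.gr n ≤ A.gr n)))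
    (fun n => by
      simp only [subcomplex, complex, CochainComplex.of_d]
      rfl)

/-- The tensor product of two differential graded modules, with
`d (a ⊗ b) = d a ⊗ b + (-1)^i a ⊗ d b` for `a` of degree `i`. -/
noncomputable def tensor (A : DGModule.{u, v} k) (B : DGModule.{u, w} k) :
    DGModule.{u, max v w} k where
  carrier := A.carrier ⊗[k] B.carrier
  gr n := Submodule.span k {x | ∃ i j, i + j = n ∧ ∃ a ∈ A.gr i, ∃ b ∈ B.gr j, x = a ⊗ₜ b}
  sgn := TensorProduct.map A.sgn B.sgn
  d := TensorProduct.map A.d LinearMap.id + TensorProduct.map A.sgn B.d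
  sgn_gr n x hx := by
    induction hx using Submodule.span_induction with
    | mem x h =>
      obtain ⟨i, j, rfl, a, ha, b, hb, rfl⟩ := h
      rw [TensorProduct.map_tmul, A.sgn_gr i a ha, B.sgn_gr j b hb, TensorProduct.smul_tmul_smul,
        pow_add]
    | zero => simp
    | add x y _ _ hx hy => rw [map_add, hx, hy, smul_add]
    | smul c x _ hx => rw [map_smul, hx, smul_comm]
  d_gr n x hx := by
    induction hx using Submodule.span_induction with
    | mem x h =>
      obtain ⟨i, j, rfl, a, ha, b, hb, rfl⟩ := h
      rw [LinearMap.add_apply, TensorProduct.map_tmul, TensorProduct.map_tmul]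
      refine Submodule.add_mem _ (Submodule.subset_span ?_) (Submodule.subset_span ?_)
      · exact ⟨i + 1, j, by ring, _, A.d_gr i a ha, b, hb, rfl⟩
      · refine ⟨i, j + 1, by ring, _, ?_, _, B.d_gr j b hb, rfl⟩
        rw [A.sgn_gr i a ha]
        exact Submodule.smul_mem _ _ ha
    | zero => simp
    | add x y _ _ hx hy => rw [map_add]; exact Submodule.add_mem _ hx hy
    | smul c x _ hx => rw [map_smul]; exact Submodule.smul_mem _ _ hx
  sgn_d x := by
    induction x with
    | zero => simp
    | add x y hx hy => simp only [map_add, hx, hy, neg_add]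
    | tmul a b =>
      simp [A.sgn_d, B.sgn_d, TensorProduct.neg_tmul, TensorProduct.tmul_neg, add_comm]
  d_d x := by
    induction x with
    | zero => simp
    | add x y hx hy => rw [map_add, map_add, hx, hy, add_zero]
    | tmul a b =>
      simp [A.sgn_d, A.d_d, B.d_d, TensorProduct.neg_tmul]

section Pi

variable {r : ℕ} (A : Fin r → DGModule.{u, v} k)

/-- The endomorphism `sgn ⊗ ⋯ ⊗ sgn ⊗ d ⊗ id ⊗ ⋯ ⊗ id`, with `d` at place `i`. -/
noncomputable def piAt (i j : Fin r) : (A j).carrier →ₗ[k] (A j).carrier :=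
  if j < i then (A j).sgn else if j = i then (A j).d else LinearMap.id

lemma piAt_comp_piAt {i j : Fin r} (h : i < j) (x : ∀ l, (A l).carrier) :
    PiTensorProduct.tprod k (fun l => piAt A i l (piAt A j l (x l))) =
      - PiTensorProduct.tprod k (fun l => piAt A j l (piAt A i l (x l))) := by
  have e : (fun l => piAt A j l (piAt A i l (x l))) =
      Function.update (fun l => piAt A i l (piAt A j l (x l))) i
        ((-1 : k) • piAt A i i (piAt A j i (x i))) := by
    funext l
    by_cases hl : l = i
    · subst hl
      simp [piAt, h, (A l).sgn_d]
    · rw [Function.update_of_ne hl]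
      rcases lt_or_gt_of_ne hl with h1 | h1
      · simp [piAt, h1, h1.trans h]
      · simp [piAt, hl, not_lt.2 h1.le]
  rw [e, MultilinearMap.map_update_smul, Function.update_eq_self]
  simp

/-- The tensor product of a finite family of differential graded modules, with the differential
`d (x 0 ⊗ ⋯ ⊗ x (r-1)) = ∑ i, ± x 0 ⊗ ⋯ ⊗ d (x i) ⊗ ⋯ ⊗ x (r-1)`, where the sign is that of the sum
of the degrees of `x 0, …, x (i-1)`. -/
noncomputable def pi : DGModule.{u, max u v} k where
  carrier := PiTensorProduct k fun i => (A i).carrier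
  gr n := Submodule.span k {x | ∃ (e : Fin r → ℕ) (a : ∀ i, (A i).carrier),
    ∑ i, e i = n ∧ (∀ i, a i ∈ (A i).gr (e i)) ∧ x = PiTensorProduct.tprod k a}
  sgn := PiTensorProduct.map fun i => (A i).sgn
  d := ∑ i, PiTensorProduct.map fun j => piAt A i j
  sgn_gr n x hx := by
    induction hx using Submodule.span_induction with
    | mem x h =>
      obtain ⟨e, a, rfl, ha, rfl⟩ := h
      rw [PiTensorProduct.map_tprod]
      simp_rw [fun i => (A i).sgn_gr (e i) (a i) (ha i)]
      rw [MultilinearMap.map_smul_univ, Finset.prod_pow_eq_pow_sum]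
    | zero => simp
    | add x y _ _ hx hy => rw [map_add, hx, hy, smul_add]
    | smul c x _ hx => rw [map_smul, hx, smul_comm]
  d_gr n x hx := by
    induction hx using Submodule.span_induction with
    | mem x h =>
      obtain ⟨e, a, rfl, ha, rfl⟩ := h
      rw [LinearMap.sum_apply]
      refine Submodule.sum_mem _ fun i _ => ?_
      rw [PiTensorProduct.map_tprod]
      refine Submodule.subset_span ⟨fun j => e j + if j = i then 1 else 0, _, ?_, ?_, rfl⟩
      · simp [Finset.sum_add_distrib]
      · intro j
        unfold piAt
        rcases lt_trichotomy j i with h | h | h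
        · simp only [h, h.ne, if_true, if_false, add_zero]
          rw [(A j).sgn_gr _ _ (ha j)]
          exact Submodule.smul_mem _ _ (ha j)
        · simp only [h, lt_irrefl, if_true, if_false]
          exact h ▸ (A j).d_gr _ _ (ha j)
        · simp only [not_lt.2 h.le, h.ne', if_false, add_zero]
          exact ha j
    | zero => simp
    | add x y _ _ hx hy => rw [map_add]; exact Submodule.add_mem _ hx hy
    | smul c x _ hx => rw [map_smul]; exact Submodule.smul_mem _ _ hx
  sgn_d x := by
    induction x using PiTensorProduct.induction_on with
    | smul_tprod c a =>
      simp only [map_smul, LinearMap.sum_apply, map_sum, PiTensorProduct.map_tprod, ← smul_neg]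
      congr 1
      rw [← Finset.sum_neg_distrib]
      refine Finset.sum_congr rfl fun i _ => ?_
      have e : (fun l => (A l).sgn (piAt A i l (a l))) =
          Function.update (fun l => piAt A i l ((A l).sgn (a l))) i
            ((-1 : k) • piAt A i i ((A i).sgn (a i))) := by
        funext l
        by_cases hl : l = i
        · subst hl
          simp [piAt, (A l).sgn_d]
        · rw [Function.update_of_ne hl]
          unfold piAt
          split_ifs <;> rfl
      rw [e, MultilinearMap.map_update_smul, Function.update_eq_self]
      simp
    | add x y hx hy => simp only [map_add, hx, hy, neg_add]
  d_d x := by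
    induction x using PiTensorProduct.induction_on with
    | smul_tprod c a =>
      simp only [map_smul, LinearMap.sum_apply, map_sum, PiTensorProduct.map_tprod]
      rw [← Finset.sum_product', Finset.sum_involution (fun a _ => (a.2, a.1)) ?_ ?_ (by simp)
        (by simp), smul_zero]
      · rintro ⟨i, j⟩ -
        rcases lt_trichotomy i j with h | rfl | h
        · exact add_eq_zero_iff_eq_neg'.2 (piAt_comp_piAt A h a)
        · have : PiTensorProduct.tprod k (fun l => piAt A i l (piAt A i l (a l))) = 0 :=
            MultilinearMap.map_coord_zero _ i (by simp [piAt, (A i).d_d])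
          exact (congrArg₂ (· + ·) this this).trans (add_zero 0)
        · exact add_eq_zero_iff_eq_neg.2 (piAt_comp_piAt A h a)
      · rintro ⟨i, j⟩ - hne heq
        apply hne
        simp only [Prod.mk.injEq] at heq
        obtain rfl : j = i := heq.1
        exact MultilinearMap.map_coord_zero _ j (by simp [piAt, (A j).d_d])
    | add x y hx hy => rw [map_add, map_add, hx, hy, add_zero]

end Pi

end DGModule

/-! ## The differential graded modules of forms -/

section Cosimplicial

variable {k : Type u} [CommRing k]

/-- The families `(θ n)` with `θ n ∈ M^n ⊗ Forms k n`. -/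
abbrev Family (M : CosimplicialObject (ModuleCat.{v} k)) : Type max u v :=
  ∀ n : ℕ, M.obj (SimplexCategory.mk n) ⊗[k] Forms k n

namespace Family

variable (M : CosimplicialObject (ModuleCat.{v} k))

/-- Apply an endomorphism of the forms in every simplicial degree. -/
noncomputable def mapForms (φ : ∀ n, Forms k n →ₗ[k] Forms k n) : Family M →ₗ[k] Family M :=
  LinearMap.pi fun n => LinearMap.lTensor _ (φ n) ∘ₗ LinearMap.proj n

/-- The families compatible with the simplicial structures: `(u_* ⊗ 1) (θ p) = (1 ⊗ u^*) (θ n)` for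
all `u : [p] → [n]`. It suffices to ask for it when `u` is a coface or a codegeneracy. -/
noncomputable def compatible : Submodule k (Family M) where
  carrier := {θ |
    (∀ (n : ℕ) (i : Fin (n + 2)), LinearMap.rTensor (Forms k n) (M.δ i).hom (θ n) =
      LinearMap.lTensor (M.obj (SimplexCategory.mk (n + 1))) (Forms.face k n i) (θ (n + 1))) ∧
    (∀ (n : ℕ) (i : Fin (n + 1)), LinearMap.rTensor (Forms k (n + 1)) (M.σ i).hom (θ (n + 1)) =
      LinearMap.lTensor (M.obj (SimplexCategory.mk n)) (Forms.degen k n i) (θ n))}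
  add_mem' ha hb := ⟨fun n i => by simp only [Pi.add_apply, map_add, ha.1, hb.1],
    fun n i => by simp only [Pi.add_apply, map_add, ha.2, hb.2]⟩
  zero_mem' := ⟨fun n i => by simp, fun n i => by simp⟩
  smul_mem' c a ha := ⟨fun n i => by simp only [Pi.smul_apply, map_smul, ha.1],
    fun n i => by simp only [Pi.smul_apply, map_smul, ha.2]⟩

/-- The families which are finite: for `n` large, `θ n` is a combination of degenerate forms, that is,
vanishes in the tensor product of `M^n` with the normalized module (the quotient by the degenerate
forms). For a compatible family, this image lies in the tensor product of the normalized modules (it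
is killed by the codegeneracies), so that this says that the family belongs to the restricted
product. -/
noncomputable def finite : Submodule k (Family M) where
  carrier := {θ | ∃ N : ℕ, ∀ n ≥ N, LinearMap.lTensor (M.obj (SimplexCategory.mk (n + 1)))
    (Forms.degenerate k n).mkQ (θ (n + 1)) = 0}
  add_mem' := by
    rintro a b ⟨N, hN⟩ ⟨N', hN'⟩
    exact ⟨max N N', fun n hn => by
      rw [Pi.add_apply, map_add, hN n (le_of_max_le_left hn), hN' n (le_of_max_le_right hn),
        add_zero]⟩
  zero_mem' := ⟨0, fun n _ => by simp⟩
  smul_mem' := by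
    rintro c a ⟨N, hN⟩
    exact ⟨N, fun n hn => by rw [Pi.smul_apply, map_smul, hN n hn, smul_zero]⟩

variable {M}

/-- The families with `θ n ∈ M^n ⊗ W n`. -/
noncomputable def valuesIn (M : CosimplicialObject (ModuleCat.{v} k)) (W : ∀ n, Submodule k (Forms k n)) :
    Submodule k (Family M) where
  carrier := {θ | ∀ n, θ n ∈ LinearMap.range
    (LinearMap.lTensor (M.obj (SimplexCategory.mk n)) (W n).subtype)}
  add_mem' ha hb n := Submodule.add_mem _ (ha n) (hb n)
  zero_mem' _ := Submodule.zero_mem _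
  smul_mem' c _ ha n := Submodule.smul_mem _ c (ha n)

lemma valuesIn_mono {W W' : ∀ n, Submodule k (Forms k n)} (h : ∀ n, W n ≤ W' n) :
    valuesIn M W ≤ valuesIn M W' := by
  intro θ hθ n
  obtain ⟨y, hy⟩ := hθ n
  refine ⟨LinearMap.lTensor _ (Submodule.inclusion (h n)) y, ?_⟩
  rw [← LinearMap.comp_apply, ← LinearMap.lTensor_comp, Submodule.subtype_comp_inclusion, hy]

lemma valuesIn_le_comap {W W' : ∀ n, Submodule k (Forms k n)} {φ : ∀ n, Forms k n →ₗ[k] Forms k n}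
    (h : ∀ n, W n ≤ (W' n).comap (φ n)) : valuesIn M W ≤ (valuesIn M W').comap (mapForms M φ) := by
  intro θ hθ n
  obtain ⟨y, hy⟩ := hθ n
  refine ⟨LinearMap.lTensor _ ((φ n).restrict (h n)) y, ?_⟩
  change _ = LinearMap.lTensor _ (φ n) (θ n)
  rw [← hy, ← LinearMap.comp_apply, ← LinearMap.comp_apply, ← LinearMap.lTensor_comp,
    ← LinearMap.lTensor_comp]
  rfl

variable (M) in
/-- The families whose values are forms with singular support in a finite subset of `S`. -/
noncomputable def supported (S : Set ℤ) : Submodule k (Family M) where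
  carrier := {θ | ∃ S' : Finset ℤ, ↑S' ⊆ S ∧ θ ∈ valuesIn M fun n => Forms.supported k n S'}
  add_mem' := by
    rintro a b ⟨S₁, h₁, ha⟩ ⟨S₂, h₂, hb⟩
    classical
    refine ⟨S₁ ∪ S₂, by simpa using ⟨h₁, h₂⟩, Submodule.add_mem _ ?_ ?_⟩
    · exact valuesIn_mono (fun n => Forms.supported_mono (by simp)) ha
    · exact valuesIn_mono (fun n => Forms.supported_mono (by simp)) hb
  zero_mem' := ⟨∅, by simp, Submodule.zero_mem _⟩
  smul_mem' := by
    rintro c a ⟨S', h, ha⟩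
    exact ⟨S', h, Submodule.smul_mem _ c ha⟩

/-- The module `_S D^*(M)` of forms with values in the cosimplicial module `M` and with singular support
in `S`: it is the coproduct of the cosimplicial module `M` and of the simplicial module of the forms on
the standard simplices with singular support in `S` when `S` is finite, and the union (direct limit)
of these over the finite subsets of `S` in general. -/
noncomputable def forms (S : Set ℤ) (M : CosimplicialObject (ModuleCat.{v} k)) : Submodule k (Family M) :=
  compatible M ⊓ finite M ⊓ supported M S

lemma forms_le_comap (S : Set ℤ) (φ : ∀ n, Forms k n →ₗ[k] Forms k n)
    (hface : ∀ n i, Forms.face k n i ∘ₗ φ (n + 1) = φ n ∘ₗ Forms.face k n i)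
    (hdegen : ∀ n i, Forms.degen k n i ∘ₗ φ n = φ (n + 1) ∘ₗ Forms.degen k n i)
    (hdeg : ∀ n, Forms.degenerate k n ≤ (Forms.degenerate k n).comap (φ (n + 1)))
    (hsupp : ∀ n T, Forms.supported k n T ≤ (Forms.supported k n T).comap (φ n)) :
    forms S M ≤ (forms S M).comap (mapForms M φ) := by
  rintro θ ⟨⟨h1, ⟨N, h2⟩⟩, ⟨T, hT, h3⟩⟩
  refine ⟨⟨⟨fun n i => ?_, fun n i => ?_⟩, ⟨N, fun n hn => ?_⟩⟩, ⟨T, hT, ?_⟩⟩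
  · change LinearMap.rTensor _ _ (LinearMap.lTensor _ (φ n) (θ n)) =
      LinearMap.lTensor _ _ (LinearMap.lTensor _ (φ (n + 1)) (θ (n + 1)))
    rw [← LinearMap.comp_apply (LinearMap.lTensor _ _) (LinearMap.lTensor _ _),
      ← LinearMap.lTensor_comp, hface, LinearMap.lTensor_comp, LinearMap.comp_apply, ← h1.1 n i,
      ← LinearMap.comp_apply, ← LinearMap.comp_apply, LinearMap.rTensor_comp_lTensor,
      LinearMap.lTensor_comp_rTensor]
  · change LinearMap.rTensor _ _ (LinearMap.lTensor _ (φ (n + 1)) (θ (n + 1))) =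
      LinearMap.lTensor _ _ (LinearMap.lTensor _ (φ n) (θ n))
    rw [← LinearMap.comp_apply (LinearMap.lTensor _ _) (LinearMap.lTensor _ _),
      ← LinearMap.lTensor_comp, hdegen, LinearMap.lTensor_comp, LinearMap.comp_apply, ← h1.2 n i,
      ← LinearMap.comp_apply, ← LinearMap.comp_apply, LinearMap.rTensor_comp_lTensor,
      LinearMap.lTensor_comp_rTensor]
  · change LinearMap.lTensor _ _ (LinearMap.lTensor _ (φ (n + 1)) (θ (n + 1))) = 0
    have e : (Forms.degenerate k n).mkQ ∘ₗ φ (n + 1) =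
        Submodule.mapQ _ _ (φ (n + 1)) (hdeg n) ∘ₗ (Forms.degenerate k n).mkQ := rfl
    rw [← LinearMap.comp_apply, ← LinearMap.lTensor_comp, e, LinearMap.lTensor_comp,
      LinearMap.comp_apply, h2 n hn, map_zero]
  · exact valuesIn_le_comap (fun n => hsupp n T) h3

end Family

/-- The differential graded module `_S D^*(M)`. -/
noncomputable def formsDG (S : Set ℤ) (M : CosimplicialObject (ModuleCat.{v} k)) :
    DGModule.{u, max u v} k where
  carrier := Family.forms S M
  gr j := (Family.valuesIn M fun n => Forms.gr k n j).comap (Family.forms S M).subtype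
  sgn := (Family.mapForms M (Forms.sgn k)).restrict (Family.forms_le_comap S _
    (fun _ i => Forms.face_sgn i) (fun _ i => Forms.degen_sgn i) (fun _ => Forms.degenerate_sgn)
    (fun _ _ => Forms.supported_sgn))
  d := (Family.mapForms M (Forms.d k)).restrict (Family.forms_le_comap S _
    (fun _ i => Forms.face_d i) (fun _ i => Forms.degen_d i) (fun _ => Forms.degenerate_d)
    (fun _ _ => Forms.supported_d))
  sgn_gr j θ hθ := by
    refine Subtype.ext (funext fun n => ?_)
    obtain ⟨y, hy⟩ := hθ n
    change LinearMap.lTensor _ (Forms.sgn k n) (θ.1 n) = (-1 : k) ^ j • θ.1 n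
    have e : Forms.sgn k n ∘ₗ (Forms.gr k n j).subtype =
        (-1 : k) ^ j • (Forms.gr k n j).subtype :=
      LinearMap.ext fun x => Forms.sgn_gr x.1 x.2
    change LinearMap.lTensor _ (Forms.gr k n j).subtype y = θ.1 n at hy
    rw [← hy, ← LinearMap.comp_apply, ← LinearMap.lTensor_comp, e, LinearMap.lTensor_smul,
      LinearMap.smul_apply]
  d_gr j θ hθ := Family.valuesIn_le_comap (fun _ => Forms.gr_d) hθ
  sgn_d θ := by
    refine Subtype.ext (funext fun n => ?_)
    change LinearMap.lTensor _ (Forms.sgn k n) (LinearMap.lTensor _ (Forms.d k n) (θ.1 n)) =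
      - LinearMap.lTensor _ (Forms.d k n) (LinearMap.lTensor _ (Forms.sgn k n) (θ.1 n))
    have e : Forms.sgn k n ∘ₗ Forms.d k n = - (Forms.d k n ∘ₗ Forms.sgn k n) :=
      LinearMap.ext fun x => Forms.sgn_d x
    rw [← LinearMap.comp_apply, ← LinearMap.comp_apply, ← LinearMap.lTensor_comp,
      ← LinearMap.lTensor_comp, e, LinearMap.lTensor_neg, LinearMap.neg_apply]
  d_d θ := by
    refine Subtype.ext (funext fun n => ?_)
    change LinearMap.lTensor _ (Forms.d k n) (LinearMap.lTensor _ (Forms.d k n) (θ.1 n)) = 0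
    have e : Forms.d k n ∘ₗ Forms.d k n = 0 := LinearMap.ext fun x => Forms.d_d x
    rw [← LinearMap.comp_apply, ← LinearMap.lTensor_comp, e, LinearMap.lTensor_zero,
      LinearMap.zero_apply]

/-- The cochains on a simplicial set, as a cosimplicial module. -/
def cochains (k : Type u) [CommRing k] (X : SSet.{w}) :
    CosimplicialObject (ModuleCat.{max u w} k) where
  obj n := ModuleCat.of k (X.obj (Opposite.op n) → k)
  map u := ModuleCat.ofHom (LinearMap.funLeft k k (X.map u.op))
  map_id n := by
    ext f x
    simp
  map_comp u v := by
    ext f x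
    simp

/-! ## The reduced tensor products -/

section Reduced

variable (S T : Set ℤ) (M : CosimplicialObject (ModuleCat.{v} k))
  (N : CosimplicialObject (ModuleCat.{w} k))

/-- The component of bidegree `(p, q)` of the bisimplicial family defined by an element of the tensor
product `_S D^*(M) ⊗ _T D^*(N)`. -/
noncomputable def component (p q : ℕ) :
    (formsDG S M).carrier ⊗[k] (formsDG T N).carrier →ₗ[k]
      (M.obj (SimplexCategory.mk p) ⊗[k] N.obj (SimplexCategory.mk q)) ⊗[k]
        (Forms k p ⊗[k] Forms k q) :=
  (TensorProduct.tensorTensorTensorComm k _ _ _ _).toLinearMap ∘ₗ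
    TensorProduct.map (LinearMap.proj p ∘ₗ (Family.forms S M).subtype)
      (LinearMap.proj q ∘ₗ (Family.forms T N).subtype)

/-- The reduced tensor product of `_S D^*(M)` and `_T D^*(N)`: the submodule of their tensor product
formed of the elements whose associated bisimplicial family takes its values in the reduced tensor
products of the forms on the standard simplices. -/
noncomputable def reduced : Submodule k ((formsDG S M).carrier ⊗[k] (formsDG T N).carrier) :=
  ⨅ (p : ℕ) (q : ℕ), (LinearMap.range (LinearMap.lTensor
    (M.obj (SimplexCategory.mk p) ⊗[k] N.obj (SimplexCategory.mk q))
      (Forms.reduced k p q).subtype)).comap (component S T M N p q)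

variable {S T M N}

lemma reduced_le_comap_map {φ φ' : ∀ n, Forms k n →ₗ[k] Forms k n}
    (f : (formsDG S M).carrier →ₗ[k] (formsDG S M).carrier)
    (g : (formsDG T N).carrier →ₗ[k] (formsDG T N).carrier)
    (hf : ∀ θ n, (f θ).1 n = LinearMap.lTensor _ (φ n) (θ.1 n))
    (hg : ∀ θ n, (g θ).1 n = LinearMap.lTensor _ (φ' n) (θ.1 n))
    (h : ∀ p q, Forms.reduced k p q ≤
      (Forms.reduced k p q).comap (TensorProduct.map (φ p) (φ' q))) :
    reduced S T M N ≤ (reduced S T M N).comap (TensorProduct.map f g) := by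
  intro z hz
  simp only [reduced, Submodule.mem_comap, Submodule.mem_iInf] at hz ⊢
  intro p q
  obtain ⟨y, hy⟩ := hz p q
  refine ⟨LinearMap.lTensor _ ((TensorProduct.map (φ p) (φ' q)).restrict (h p q)) y, ?_⟩
  have e : component S T M N p q ∘ₗ TensorProduct.map f g =
      LinearMap.lTensor _ (TensorProduct.map (φ p) (φ' q)) ∘ₗ component S T M N p q := by
    refine TensorProduct.ext' fun a b => ?_
    change TensorProduct.tensorTensorTensorComm k _ _ _ _ ((f a).1 p ⊗ₜ (g b).1 q) =
      LinearMap.lTensor _ _ (TensorProduct.tensorTensorTensorComm k _ _ _ _ (a.1 p ⊗ₜ b.1 q))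
    rw [hf, hg]
    generalize a.1 p = x
    generalize b.1 q = y
    induction x with
    | zero => simp
    | add x x' hx hx' => simp only [map_add, TensorProduct.add_tmul, hx, hx']
    | tmul m α =>
      induction y with
      | zero => simp
      | add y y' hy hy' => simp only [map_add, TensorProduct.tmul_add, hy, hy']
      | tmul n β => simp
  have e' := LinearMap.congr_fun e z
  simp only [LinearMap.comp_apply] at e'
  rw [e', ← hy, ← LinearMap.comp_apply, ← LinearMap.comp_apply, ← LinearMap.lTensor_comp,
    ← LinearMap.lTensor_comp]
  rfl

lemma reduced_d_id : reduced S T M N ≤ (reduced S T M N).comap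
    (TensorProduct.map (formsDG S M).d LinearMap.id) :=
  reduced_le_comap_map (φ := Forms.d k) (φ' := fun _ => LinearMap.id) _ _ (fun _ _ => rfl)
    (fun _ _ => by simp) fun _ _ => Forms.reduced_le_comap Forms.d_of_mem Forms.id_of_mem

lemma reduced_id_d : reduced S T M N ≤ (reduced S T M N).comap
    (TensorProduct.map LinearMap.id (formsDG T N).d) :=
  reduced_le_comap_map (φ := fun _ => LinearMap.id) (φ' := Forms.d k) _ _ (fun _ _ => by simp)
    (fun _ _ => rfl) fun _ _ => Forms.reduced_le_comap Forms.id_of_mem Forms.d_of_mem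

lemma reduced_sgn_d : reduced S T M N ≤ (reduced S T M N).comap
    (TensorProduct.map (formsDG S M).sgn (formsDG T N).d) :=
  reduced_le_comap_map (φ := Forms.sgn k) (φ' := Forms.d k) _ _ (fun _ _ => rfl)
    (fun _ _ => rfl) fun _ _ => Forms.reduced_le_comap Forms.sgn_of_mem Forms.d_of_mem

lemma reduced_d_sgn : reduced S T M N ≤ (reduced S T M N).comap
    (TensorProduct.map (formsDG S M).d (formsDG T N).sgn) :=
  reduced_le_comap_map (φ := Forms.d k) (φ' := Forms.sgn k) _ _ (fun _ _ => rfl)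
    (fun _ _ => rfl) fun _ _ => Forms.reduced_le_comap Forms.d_of_mem Forms.sgn_of_mem

lemma reduced_sgn_sgn : reduced S T M N ≤ (reduced S T M N).comap
    (TensorProduct.map (formsDG S M).sgn (formsDG T N).sgn) :=
  reduced_le_comap_map (φ := Forms.sgn k) (φ' := Forms.sgn k) _ _ (fun _ _ => rfl)
    (fun _ _ => rfl) fun _ _ => Forms.reduced_le_comap Forms.sgn_of_mem Forms.sgn_of_mem

lemma reduced_sgn_id : reduced S T M N ≤ (reduced S T M N).comap
    (TensorProduct.map (formsDG S M).sgn LinearMap.id) :=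
  reduced_le_comap_map (φ := Forms.sgn k) (φ' := fun _ => LinearMap.id) _ _ (fun _ _ => rfl)
    (fun _ _ => by simp) fun _ _ => Forms.reduced_le_comap Forms.sgn_of_mem Forms.id_of_mem

lemma reduced_id_sgn : reduced S T M N ≤ (reduced S T M N).comap
    (TensorProduct.map LinearMap.id (formsDG T N).sgn) :=
  reduced_le_comap_map (φ := fun _ => LinearMap.id) (φ' := Forms.sgn k) _ _ (fun _ _ => by simp)
    (fun _ _ => rfl) fun _ _ => Forms.reduced_le_comap Forms.id_of_mem Forms.sgn_of_mem

variable (S T M N)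

lemma reduced_d : reduced S T M N ≤
    (reduced S T M N).comap (TensorProduct.map (formsDG S M).d LinearMap.id +
      TensorProduct.map (formsDG S M).sgn (formsDG T N).d) := by
  intro z hz
  rw [Submodule.mem_comap, LinearMap.add_apply]
  exact Submodule.add_mem _ (reduced_d_id hz) (reduced_sgn_d hz)

/-- The inclusion of the reduced tensor product of `_S D^*(M)` and `_T D^*(N)` into their tensor
product, as a morphism of cochain complexes. -/
noncomputable def reducedInclusion :
    ((formsDG S M).tensor (formsDG T N)).subcomplex (reduced S T M N) (reduced_d S T M N) ⟶
      ((formsDG S M).tensor (formsDG T N)).complex :=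
  DGModule.inclusion _ _ _

end Reduced

section PiReduced

/-- Given `x : ∀ l, A l` and two places `i ≠ j`, the linear map from `A i ⊗ A j` to the tensor product
of all the `A l` which sends `a ⊗ b` to the pure tensor with `a` at place `i`, with `b` at place `j`
and with `x l` at the other places `l`. -/
noncomputable def insertPair {r : ℕ} (A : Fin r → DGModule.{u, v} k) {i j : Fin r} (hij : i ≠ j)
    (x : ∀ l, (A l).carrier) : (A i).carrier ⊗[k] (A j).carrier →ₗ[k]
      PiTensorProduct k fun l => (A l).carrier :=
  TensorProduct.lift (LinearMap.mk₂ k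
    (fun a b => PiTensorProduct.tprod k (Function.update (Function.update x i a) j b))
    (fun a a' b => by simp only [Function.update_comm hij, MultilinearMap.map_update_add])
    (fun c a b => by simp only [Function.update_comm hij, MultilinearMap.map_update_smul])
    (fun a b b' => by simp only [MultilinearMap.map_update_add])
    (fun c a b => by simp only [MultilinearMap.map_update_smul]))

variable {r : ℕ} (S : Fin r → Set ℤ) (M : Fin r → CosimplicialObject (ModuleCat.{v} k))

/-- The submodule `Γ_{i,j}` of the tensor product of the `_{S l} D^*(M l)`: the image of the tensor
product of the reduced tensor product of the factors `i` and `j` with all the other factors. -/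
noncomputable def pairReduced {i j : Fin r} (hij : i ≠ j) :
    Submodule k (PiTensorProduct k fun l => (formsDG (S l) (M l)).carrier) :=
  ⨆ x : ∀ l, (formsDG (S l) (M l)).carrier,
    (reduced (S i) (S j) (M i) (M j)).map (insertPair (fun l => formsDG (S l) (M l)) hij x)

/-- The reduced tensor product of the family of the `_{S l} D^*(M l)`: the intersection of the
submodules `Γ_{i,j}`. -/
noncomputable def piReduced :
    Submodule k (PiTensorProduct k fun l => (formsDG (S l) (M l)).carrier) :=
  ⨅ (i : Fin r) (j : Fin r) (hij : i ≠ j), pairReduced S M hij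

lemma map_insertPair {A : Fin r → DGModule.{u, v} k} {i j : Fin r} (hij : i ≠ j)
    (φ : ∀ l, (A l).carrier →ₗ[k] (A l).carrier) (x : ∀ l, (A l).carrier)
    (z : (A i).carrier ⊗[k] (A j).carrier) :
    PiTensorProduct.map φ (insertPair A hij x z) =
      insertPair A hij (fun l => φ l (x l)) (TensorProduct.map (φ i) (φ j) z) := by
  induction z with
  | zero => simp
  | add z z' h h' => simp only [map_add, h, h']
  | tmul a b =>
    change PiTensorProduct.map φ (PiTensorProduct.tprod k _) = PiTensorProduct.tprod k _
    rw [PiTensorProduct.map_tprod]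
    congr 1
    funext l
    by_cases hl : l = j
    · subst hl; simp
    · by_cases hl' : l = i
      · subst hl'; simp [hij]
      · simp [hl, hl']

lemma pairReduced_d {i j : Fin r} (hij : i ≠ j) : pairReduced S M hij ≤
    (pairReduced S M hij).comap (∑ l, PiTensorProduct.map fun m =>
      DGModule.piAt (fun l => formsDG (S l) (M l)) l m) := by
  refine iSup_le fun x => ?_
  rintro _ ⟨z, hz, rfl⟩
  rw [Submodule.mem_comap, LinearMap.sum_apply]
  refine Submodule.sum_mem _ fun l _ => ?_
  rw [map_insertPair]
  refine Submodule.mem_iSup_of_mem _ ⟨_, ?_, rfl⟩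
  unfold DGModule.piAt
  rcases lt_trichotomy i l with hi | rfl | hi
  · rcases lt_trichotomy j l with hj | rfl | hj
    · simp only [hi, hj, if_true]
      exact reduced_sgn_sgn hz
    · simp only [hi, lt_irrefl, if_true, if_false]
      exact reduced_sgn_d hz
    · simp only [hi, not_lt.2 hj.le, hj.ne', if_true, if_false]
      exact reduced_sgn_id hz
  · rcases lt_trichotomy j i with hj | rfl | hj
    · simp only [hj, lt_irrefl, if_true, if_false]
      exact reduced_d_sgn hz
    · exact absurd rfl hij
    · simp only [lt_irrefl, not_lt.2 hj.le, hj.ne', if_true, if_false]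
      exact reduced_d_id hz
  · rcases lt_trichotomy j l with hj | rfl | hj
    · simp only [hj, not_lt.2 hi.le, hi.ne', if_true, if_false]
      exact reduced_id_sgn hz
    · simp only [lt_irrefl, not_lt.2 hi.le, hi.ne', if_true, if_false]
      exact reduced_id_d hz
    · simp only [not_lt.2 hj.le, hj.ne', not_lt.2 hi.le, hi.ne', if_false]
      rw [TensorProduct.map_id]
      exact hz

lemma piReduced_d : piReduced S M ≤
    (piReduced S M).comap (∑ l, PiTensorProduct.map fun m =>
      DGModule.piAt (fun l => formsDG (S l) (M l)) l m) := by
  intro z hz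
  simp only [piReduced, Submodule.mem_comap, Submodule.mem_iInf] at hz ⊢
  exact fun i j hij => pairReduced_d S M hij (hz i j hij)

/-- The inclusion of the reduced tensor product of the `_{S l} D^*(M l)` into their tensor product, as a
morphism of cochain complexes. -/
noncomputable def piReducedInclusion :
    (DGModule.pi fun l => formsDG (S l) (M l)).subcomplex (piReduced S M) (piReduced_d S M) ⟶
      (DGModule.pi fun l => formsDG (S l) (M l)).complex :=
  DGModule.inclusion _ _ _

end PiReduced

end Cosimplicial

/-- Two subsets of `ℤ` are transversal if neither is contained in the other. -/
def Transversal (S T : Set ℤ) : Prop := (∃ s ∈ S, s ∉ T) ∧ ∃ t ∈ T, t ∉ S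

/-- A family of subsets of `ℤ` is transversal if each of them is transversal to the union of the
others. -/
def TransversalFamily {r : ℕ} (S : Fin r → Set ℤ) : Prop :=
  ∀ i, Transversal (S i) (⋃ (j : Fin r) (_ : j ≠ i), S j)

/-- A commutative ring is coherent if its finitely generated ideals are finitely presented. -/
def IsCoherentRing (k : Type u) [CommRing k] : Prop :=
  ∀ I : Ideal k, I.FG → Module.FinitePresentation k I

end QuasiCommutative

/-! The proof moves singular supports. Fix an integer `s`. On the forms in one variable, the
collapse `1 ↦ 1`, `heav a ↦ heav s`, `dirac a ↦ dirac s` is homotopic to the identity through the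
map `h` with `h (dirac a) = heav s - heav a` and zero on the other letters. The collapse is a
morphism of coalgebras compatible with the value at `-∞`. The map `h` takes values vanishing at `-∞`
and is a coderivation between the collapse and the identity (`Letter.comulMap_homotopyMap`). Hence
the usual tensor homotopy, a signed sum of `c ⊗ ⋯ ⊗ c ⊗ h ⊗ 1 ⊗ ⋯ ⊗ 1` where `c` is the collapse,
commutes with all faces and degeneracies (`Cube.face_homotopy`, `Cube.degen_homotopy`). So it acts
on the forms with coefficients in any cosimplicial module. It adds at most the point `s` to a
singular support, so for `s ∈ S` it stays within the forms supported in `S`.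

For two factors, take `s ∈ S` outside `T` and `t ∈ T` outside `S`, and tensor the two homotopies.
The resulting endomorphism has values in the reduced tensor product, because `{s}` and `{t}` are
disjoint (`collapse_mem_reduced`). The homotopy preserves the reduced tensor product: the supports
of a reduced element are disjoint and lie in `S` and `T`, so adding `s` on the left and `t` on the
right keeps them disjoint (`map_mem_reduced`). Thus the identity deforms into the subcomplex, and
the inclusion is a quasi-isomorphism (`DGModule.quasiIso_inclusion`).

For `r` factors the argument is the same, pair by pair, with points `s i ∈ S i` lying in no other `S
j`. When every `S i` is `ℤ` no such points exist. But injectivity in cohomology needs only a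
homotopy that preserves one given cocycle `z`, and surjectivity needs only an endomorphism with
values in the subcomplex. Since `z` involves finitely many singular points, distinct points chosen
outside them do the job. This is why the criterion lets the homotopy depend on `z`. -/

namespace QuasiCommutative

namespace DGModule

variable {k : Type u} [CommRing k]

/-! ### Quasi-isomorphisms tested on cocycles, and inclusions of deformed subcomplexes. -/

section Elements

variable {K L : CochainComplex (ModuleCat.{v} k) ℕ}

lemma exists_toCycles_eq {i : ℕ} (c : K.cycles i) (hc : K.homologyπ i c = 0) :
    ∃ b : K.X ((ComplexShape.up ℕ).prev i), K.toCycles _ i b = c := by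
  have h : (ShortComplex.mk (K.toCycles ((ComplexShape.up ℕ).prev i) i) (K.homologyπ i)
      (by simp)).Exact :=
    ShortComplex.exact_of_g_is_cokernel _ (K.homologyIsCokernel _ i rfl)
  exact (ShortComplex.moduleCat_exact_iff _).1 h c hc

lemma iCycles_injective (i : ℕ) : Function.Injective (K.iCycles i) :=
  (ModuleCat.mono_iff_injective _).1 inferInstance

lemma homologyπ_surjective (i : ℕ) : Function.Surjective (K.homologyπ i) :=
  (ModuleCat.epi_iff_surjective _).1 inferInstance

lemma exists_iCycles_eq {i j : ℕ} (hij : i + 1 = j) (x : K.X i) (hx : K.d i j x = 0) :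
    ∃ c : K.cycles i, K.iCycles i c = x := by
  have h : (ShortComplex.mk (K.iCycles i) (K.d i j) (by simp)).Exact :=
    ShortComplex.exact_of_f_is_kernel _ (K.cyclesIsKernel i j (by simp [← hij]))
  exact (ShortComplex.moduleCat_exact_iff _).1 h x hx

lemma iCycles_toCycles_apply {i j : ℕ} (b : K.X i) :
    K.iCycles j (K.toCycles i j b) = K.d i j b := by
  rw [← ModuleCat.comp_apply, HomologicalComplex.toCycles_i]

lemma d_iCycles_apply {i j : ℕ} (c : K.cycles i) : K.d i j (K.iCycles i c) = 0 := by
  rw [← ModuleCat.comp_apply, HomologicalComplex.iCycles_d]; rfl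

lemma iCycles_cyclesMap_apply (f : K ⟶ L) {i : ℕ} (c : K.cycles i) :
    L.iCycles i (HomologicalComplex.cyclesMap f i c) = f.f i (K.iCycles i c) := by
  rw [← ModuleCat.comp_apply, ← ModuleCat.comp_apply, HomologicalComplex.cyclesMap_i]

lemma homologyMap_homologyπ_apply (f : K ⟶ L) {i : ℕ} (c : K.cycles i) :
    HomologicalComplex.homologyMap f i (K.homologyπ i c) =
      L.homologyπ i (HomologicalComplex.cyclesMap f i c) := by
  rw [← ModuleCat.comp_apply, ← ModuleCat.comp_apply, HomologicalComplex.homologyπ_naturality]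

lemma homologyπ_toCycles_apply {i j : ℕ} (b : K.X i) :
    K.homologyπ j (K.toCycles i j b) = 0 := by
  rw [← ModuleCat.comp_apply, HomologicalComplex.toCycles_comp_homologyπ]; rfl

/-- An elementwise criterion for a morphism of cochain complexes of modules to be a
quasi-isomorphism. -/
lemma quasiIso_of_elements (f : K ⟶ L)
    (hinj : ∀ i (x : K.X (i + 1)), K.d (i + 1) (i + 1 + 1) x = 0 →
      (∃ b : L.X i, L.d i (i + 1) b = f.f (i + 1) x) → ∃ a : K.X i, K.d i (i + 1) a = x)
    (hinj₀ : Function.Injective (f.f 0))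
    (hsurj : ∀ i (y : L.X (i + 1)), L.d (i + 1) (i + 1 + 1) y = 0 →
      ∃ (x : K.X (i + 1)) (b : L.X i), K.d (i + 1) (i + 1 + 1) x = 0 ∧
        y = f.f (i + 1) x + L.d i (i + 1) b)
    (hsurj₀ : ∀ y : L.X 0, L.d 0 1 y = 0 → ∃ x : K.X 0, K.d 0 1 x = 0 ∧ y = f.f 0 x) :
    QuasiIso f := by
  refine ⟨fun i => (quasiIsoAt_iff_isIso_homologyMap f i).2 ?_⟩
  have : Mono (HomologicalComplex.homologyMap f i) := by
    refine (ModuleCat.mono_iff_injective _).2 ((injective_iff_map_eq_zero _).2 fun x hx => ?_)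
    obtain ⟨c, rfl⟩ := homologyπ_surjective i x
    rw [homologyMap_homologyπ_apply] at hx
    obtain ⟨b, hb⟩ := exists_toCycles_eq _ hx
    have hb' := congrArg (L.iCycles i) hb
    rw [iCycles_toCycles_apply, iCycles_cyclesMap_apply] at hb'
    cases i with
    | zero =>
      -- In degree `0` the predecessor is `0` itself by convention, and the differential from `0` to
      -- `0` vanishes.
      rw [L.shape _ _ (by simp)] at hb'
      have : K.iCycles 0 c = 0 := hinj₀ (by rw [map_zero]; exact hb'.symm)
      rw [iCycles_injective 0 (this.trans (map_zero _).symm), map_zero]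
    | succ i =>
      obtain ⟨a, ha⟩ := hinj i (K.iCycles _ c) (d_iCycles_apply c)
        (by
          -- The predecessor occurs in the type of `b`, so `b` is reverted before the index is
          -- rewritten.
          have e : (ComplexShape.up ℕ).prev (i + 1) = i := by simp
          revert b
          rw [e]
          exact fun b _ hb' => ⟨b, hb'⟩)
      rw [← iCycles_toCycles_apply] at ha
      rw [← iCycles_injective _ ha, homologyπ_toCycles_apply]
  have : Epi (HomologicalComplex.homologyMap f i) := by
    refine (ModuleCat.epi_iff_surjective _).2 fun y => ?_
    obtain ⟨c, rfl⟩ := homologyπ_surjective i y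
    cases i with
    | zero =>
      obtain ⟨x, hx, e⟩ := hsurj₀ (L.iCycles _ c) (d_iCycles_apply c)
      obtain ⟨c', rfl⟩ := exists_iCycles_eq (zero_add 1) x hx
      refine ⟨K.homologyπ _ c', ?_⟩
      rw [homologyMap_homologyπ_apply]
      rw [← iCycles_cyclesMap_apply] at e
      rw [iCycles_injective _ e]
    | succ i =>
      obtain ⟨x, b, hx, e⟩ := hsurj i (L.iCycles _ c) (d_iCycles_apply c)
      obtain ⟨c', rfl⟩ := exists_iCycles_eq rfl x hx
      refine ⟨K.homologyπ _ c', ?_⟩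
      rw [homologyMap_homologyπ_apply]
      rw [← iCycles_cyclesMap_apply, ← iCycles_toCycles_apply, ← map_add] at e
      rw [iCycles_injective _ e, map_add, homologyπ_toCycles_apply, add_zero]
  exact isIso_of_mono_of_epi _

end Elements

/-- The inclusion of a subcomplex `F` is a quasi-isomorphism as soon as, for each `z ∈ F`, the identity
is homotopic to a map with values in `F` by a homotopy which sends `z` to `F`. -/
lemma quasiIso_inclusion (A : DGModule.{u, v} k) (F : Submodule k A.carrier)
    (hF : F ≤ F.comap A.d)
    (h : ∀ z ∈ F, ∃ ρ η : A.carrier →ₗ[k] A.carrier,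
      (∀ x, A.d (η x) + η (A.d x) = x - ρ x) ∧
      (∀ n, ∀ x ∈ A.gr n, ρ x ∈ A.gr n) ∧ (∀ n, ∀ x ∈ A.gr (n + 1), η x ∈ A.gr n) ∧
      (∀ x ∈ A.gr 0, η x = 0) ∧ (∀ x, ρ x ∈ F) ∧ η z ∈ F) :
    QuasiIso (inclusion A F hF) := by
  have hd (n) (x : A.complex.X n) :
      A.complex.d n (n + 1) x = (⟨A.d x.1, A.d_gr n x.1 x.2⟩ : A.gr (n + 1)) := by
    simp only [complex, CochainComplex.of_d]; rfl
  have hd' (n) (x : (A.subcomplex F hF).X n) : (A.subcomplex F hF).d n (n + 1) x =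
      (⟨A.d x.1, hF x.2.1, A.d_gr n x.1 x.2.2⟩ : ↥(F ⊓ A.gr (n + 1))) := by
    simp only [subcomplex, CochainComplex.of_d]; rfl
  -- That `ρ` is a chain map is automatic: `d η d x` is computed once by applying `d` to the
  -- homotopy formula and once by evaluating that formula at `d x`.
  have hρd (ρ η : A.carrier →ₗ[k] A.carrier) (h1 : ∀ x, A.d (η x) + η (A.d x) = x - ρ x) (x) :
      A.d (ρ x) = ρ (A.d x) := by
    have e1 := congrArg A.d (h1 x)
    have e2 := h1 (A.d x)
    simp only [map_add, map_sub, A.d_d, map_zero, zero_add, add_zero] at e1 e2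
    rw [e2] at e1
    exact (sub_right_injective e1).symm
  refine quasiIso_of_elements _ ?_ ?_ ?_ ?_
  · rintro i ⟨x, hxF, hx⟩ hdx ⟨⟨b, hb⟩, e⟩
    have hdx : A.d x = 0 := congrArg Subtype.val ((hd' _ _).symm.trans hdx)
    have e : A.d b = x := congrArg Subtype.val ((hd _ _).symm.trans e)
    -- The homotopy is the one adapted to `x`, so `η x` lies in `F`. If `d b = x`, then `η x + ρ b`
    -- is a primitive of `x` inside `F`.
    obtain ⟨ρ, η, h1, h2, h3, h4, h5, h6⟩ := h x hxF
    refine ⟨⟨η x + ρ b, F.add_mem h6 (h5 b), (A.gr i).add_mem (h3 i x hx) (h2 i b hb)⟩, ?_⟩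
    refine (hd' _ _).trans (Subtype.ext ?_)
    change A.d (η x + ρ b) = x
    have := h1 x
    rw [hdx, map_zero, add_zero] at this
    rw [map_add, this, hρd ρ η h1, e, sub_add_cancel]
  · exact Submodule.inclusion_injective (inf_le_right : F ⊓ A.gr 0 ≤ A.gr 0)
  · rintro i ⟨y, hy⟩ hdy
    have hdy : A.d y = 0 := congrArg Subtype.val ((hd _ _).symm.trans hdy)
    -- For surjectivity the correction `η y` need not lie in `F`, so any of the homotopies will do,
    -- for instance the one attached to `0`.
    obtain ⟨ρ, η, h1, h2, h3, h4, h5, h6⟩ := h 0 F.zero_mem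
    refine ⟨⟨ρ y, h5 y, h2 _ y hy⟩, ⟨η y, h3 i y hy⟩, ?_, ?_⟩
    · refine (hd' _ _).trans (Subtype.ext ?_)
      change A.d (ρ y) = 0
      rw [hρd ρ η h1, hdy, map_zero]
    · refine Subtype.ext ?_
      refine Eq.trans ?_ (congrArg (fun b => ρ y + Subtype.val b) (hd i ⟨η y, h3 i y hy⟩)).symm
      change y = ρ y + A.d (η y)
      have := h1 y
      rw [hdy, map_zero, add_zero] at this
      rw [this, add_sub_cancel]
  · rintro ⟨y, hy⟩ hdy
    have hdy : A.d y = 0 := congrArg Subtype.val ((hd 0 ⟨y, hy⟩).symm.trans hdy)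
    obtain ⟨ρ, η, h1, h2, h3, h4, h5, h6⟩ := h 0 F.zero_mem
    -- In degree `0` nothing is corrected: `η y = 0` and `d y = 0` force `y = ρ y ∈ F`.
    have e : y = ρ y := by
      have := h1 y
      rw [hdy, h4 y hy, map_zero, map_zero, add_zero] at this
      exact sub_eq_zero.1 this.symm
    refine ⟨⟨ρ y, h5 y, h2 _ y hy⟩, ?_, Subtype.ext e⟩
    refine (hd' 0 _).trans (Subtype.ext ?_)
    change A.d (ρ y) = 0
    rw [hρd ρ η h1, hdy, map_zero]

end DGModule

/-! ### Tensor products of homotopies, with Koszul signs. -/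

section Multilinear

variable {k : Type u} [CommRing k] {m : ℕ} {A : Fin m → Type v} {N : Type w}
  [∀ i, AddCommGroup (A i)] [∀ i, Module k (A i)] [AddCommGroup N] [Module k N]

/-- The family equal to `φ` before place `i`, to `ψ` at place `i` and to the identity after it. -/
def staircase (φ ψ : ∀ i, A i →ₗ[k] A i) (i l : Fin m) : A l →ₗ[k] A l :=
  if l < i then φ l else if l = i then ψ l else LinearMap.id

lemma staircase_of_lt (φ ψ : ∀ i, A i →ₗ[k] A i) {i l : Fin m} (h : l < i) :
    staircase φ ψ i l = φ l := if_pos h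

lemma staircase_self (φ ψ : ∀ i, A i →ₗ[k] A i) (i : Fin m) : staircase φ ψ i i = ψ i := by
  simp [staircase]

lemma staircase_of_gt (φ ψ : ∀ i, A i →ₗ[k] A i) {i l : Fin m} (h : i < l) :
    staircase φ ψ i l = LinearMap.id := by
  simp [staircase, not_lt.2 h.le, h.ne']

/-- Each Koszul cancellation below comes from a sign at a single place, and this extracts it. -/
lemma map_neg_of_eq_off (F : MultilinearMap k A N) {x y : ∀ i, A i} (i : Fin m)
    (h : ∀ l, l ≠ i → x l = y l) (hi : x i = - y i) : F x = - F y := by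
  have : x = Function.update y i ((-1 : k) • y i) := by
    funext l
    by_cases hl : l = i
    · subst hl; simp [hi]
    · simp [hl, h l hl]
  rw [this, F.map_update_smul, Function.update_eq_self, neg_one_smul]

/-- The tensor product homotopy: if `η i` is a homotopy from the identity to `ρ i`, then
`∑ i, ρ ⊗ ⋯ ⊗ ρ ⊗ η i ⊗ 1 ⊗ ⋯ ⊗ 1`, with the appropriate signs, is a homotopy from the identity to the
tensor product of the `ρ i`. -/
lemma sum_staircase_comm (F : MultilinearMap k A N) (sgn d ρ η : ∀ i, A i →ₗ[k] A i)
    (hss : ∀ i x, sgn i (sgn i x) = x) (hsd : ∀ i x, sgn i (d i x) = - d i (sgn i x))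
    (hsη : ∀ i x, sgn i (η i x) = - η i (sgn i x)) (hρs : ∀ i x, ρ i (sgn i x) = sgn i (ρ i x))
    (hρd : ∀ i x, ρ i (d i x) = d i (ρ i x))
    (hη : ∀ i x, d i (η i x) + η i (d i x) = x - ρ i x) (x : ∀ i, A i) :
    ∑ i, ∑ j, F (fun l => staircase sgn d j l
        (staircase (fun i => sgn i ∘ₗ ρ i) η i l (x l))) +
      ∑ j, ∑ i, F (fun l => staircase (fun i => sgn i ∘ₗ ρ i) η i l (staircase sgn d j l (x l))) =
    F x - F fun l => ρ l (x l) := by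
  rw [Finset.sum_comm (s := Finset.univ) (t := Finset.univ) (f := fun j i => F (fun l =>
    staircase (fun i => sgn i ∘ₗ ρ i) η i l (staircase sgn d j l (x l)))),
    ← Finset.sum_add_distrib]
  simp only [← Finset.sum_add_distrib]
  -- The interpolating family has `ρ` applied at the first `n` places. The terms with `d` and `η` at
  -- the same place `i` give `F (y i) - F (y (i + 1))`, and these telescope.
  let y (n : ℕ) : ∀ l, A l := fun l => if l.1 < n then ρ l (x l) else x l
  have key (i : Fin m) : ∑ j, (F (fun l => staircase sgn d j l
        (staircase (fun i => sgn i ∘ₗ ρ i) η i l (x l))) +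
      F (fun l => staircase (fun i => sgn i ∘ₗ ρ i) η i l (staircase sgn d j l (x l)))) =
      F (y i) - F (y (i + 1)) := by
    rw [Finset.sum_eq_single i]
    -- Before place `i` both orders of composition give `ρ`, since `sgn` is an involution commuting
    -- with `ρ`. After it nothing happens, so only `d η + η d` at place `i` remains.
    · have e1 : (fun l => staircase sgn d i l
          (staircase (fun i => sgn i ∘ₗ ρ i) η i l (x l))) =
          Function.update (y i) i (d i (η i (x i))) := by
        funext l
        rcases lt_trichotomy l i with h | rfl | h
        · simp [staircase, y, h, h.ne, hss]
        · simp [staircase]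
        · simp [staircase, y, not_lt.2 h.le, h.ne']
      have e2 : (fun l => staircase (fun i => sgn i ∘ₗ ρ i) η i l (staircase sgn d i l (x l))) =
          Function.update (y i) i (η i (d i (x i))) := by
        funext l
        rcases lt_trichotomy l i with h | rfl | h
        · simp [staircase, y, h, h.ne, hss, hρs]
        · simp [staircase]
        · simp [staircase, y, not_lt.2 h.le, h.ne']
      have e3 : y i = Function.update (y i) i (x i) := by
        rw [eq_comm, Function.update_eq_self_iff]; simp [y]
      have e4 : y (i + 1) = Function.update (y i) i (ρ i (x i)) := by
        funext l
        rcases lt_trichotomy l i with h | rfl | h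
        · have : l.1 < i.1 + 1 := by have : l.1 < i.1 := h; omega
          simp [y, h, h.ne, this]
        · simp [y]
        · have : ¬ l.1 < i.1 + 1 := by have : i.1 < l.1 := h; omega
          simp [y, not_lt.2 h.le, h.ne', this]
      rw [e1, e2, ← F.map_update_add, hη, F.map_update_sub, ← e4, ← e3]
    -- If `d` and `η` act at different places, the two orders of composition agree except at the
    -- smaller of these places. There `sgn` anticommutes with `d` or with `η`, so the terms cancel.
    · intro j _ hji
      rw [add_eq_zero_iff_eq_neg]
      rcases lt_or_gt_of_ne hji with h | h
      · refine map_neg_of_eq_off F j (fun l hl => ?_) ?_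
        · rcases lt_or_gt_of_ne hl with h1 | h1
          · simp [staircase, h1, h1.trans h, hρs]
          · simp [staircase, not_lt.2 h1.le, h1.ne']
        · simp [staircase, h, hρd, hsd]
      · refine map_neg_of_eq_off F i (fun l hl => ?_) ?_
        · rcases lt_or_gt_of_ne hl with h1 | h1
          · simp [staircase, h1, h1.trans h, hρs]
          · simp [staircase, not_lt.2 h1.le, h1.ne']
        · simp [staircase, h, hsη]
    · simp
  rw [Finset.sum_congr rfl fun i _ => key i,
    Fin.sum_univ_eq_sum_range (fun n => F (y n) - F (y (n + 1))), Finset.sum_range_sub']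
  congr 2
  funext l
  simp [y]

end Multilinear

end QuasiCommutative

namespace QuasiCommutative

/-! ## A natural homotopy which moves the singular supports to a given point

The coalgebra of forms in one variable has the endomorphism `collapseMap`, which moves all the singular
supports to `s`, and `homotopyMap` is a homotopy from the identity to it which is a coderivation. Hence
the induced homotopies on the forms on the simplices commute with the faces and the degeneracies. -/

namespace Letter

variable (k : Type u) [CommRing k] (s : ℤ)

/-- Move the singular support to `s`. -/
def collapse : Letter → Letter
  | one => one
  | heav _ => heav s
  | dirac _ => dirac s

lemma deg_collapse (a : Letter) : (a.collapse s).deg = a.deg := by cases a <;> rfl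

lemma supp_collapse (a : Letter) : (a.collapse s).supp ⊆ {s} := by cases a <;> simp [collapse, supp]

lemma collapse_ne_one {a : Letter} (h : a ≠ one) : a.collapse s ≠ one := by
  cases a <;> simp_all [collapse]

/-- The differential on the forms in one variable. -/
noncomputable def dMap : (Letter →₀ k) →ₗ[k] Letter →₀ k :=
  Finsupp.linearCombination k fun a => a.diffCoeff k • Finsupp.single a.diff 1

/-- The grading involution on the forms in one variable. -/
noncomputable def sgnMap : (Letter →₀ k) →ₗ[k] Letter →₀ k :=
  Finsupp.linearCombination k fun a => (-1 : k) ^ a.deg • Finsupp.single a 1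

/-- The evaluation at `-∞`. -/
noncomputable def atBotMap : (Letter →₀ k) →ₗ[k] k :=
  Finsupp.linearCombination k fun a => a.atBot k

/-- The endomorphism of the forms in one variable which moves the singular supports to `s`. -/
noncomputable def collapseMap : (Letter →₀ k) →ₗ[k] Letter →₀ k :=
  Finsupp.linearCombination k fun a => Finsupp.single (a.collapse s) 1

/-- The homotopy from the identity to `collapseMap`, which sends `dirac a` to `heav s - heav a`. -/
noncomputable def homotopyMap : (Letter →₀ k) →ₗ[k] Letter →₀ k :=
  Finsupp.linearCombination k fun
    | one => 0
    | heav _ => 0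
    | dirac a => Finsupp.single (heav s) 1 - Finsupp.single (heav a) 1

/-- The coproduct which defines the degeneracies. -/
noncomputable def comulMap : (Letter →₀ k) →ₗ[k] (Letter →₀ k) ⊗[k] (Letter →₀ k) :=
  Finsupp.linearCombination k fun
    | one => Finsupp.single one 1 ⊗ₜ Finsupp.single one 1
    | heav a => Finsupp.single (heav a) 1 ⊗ₜ Finsupp.single (heav a) 1
    | dirac a => Finsupp.single (dirac a) 1 ⊗ₜ Finsupp.single (heav a) 1 +
        Finsupp.single (heav a) 1 ⊗ₜ Finsupp.single (dirac a) 1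

variable {k}

lemma dMap_single (a : Letter) : dMap k (Finsupp.single a 1) =
    a.diffCoeff k • Finsupp.single a.diff 1 := by
  simp only [dMap, Finsupp.linearCombination_single, one_smul]

lemma sgnMap_single (a : Letter) : sgnMap k (Finsupp.single a 1) =
    (-1 : k) ^ a.deg • Finsupp.single a 1 := by
  simp only [sgnMap, Finsupp.linearCombination_single, one_smul]

lemma atBotMap_single (a : Letter) : atBotMap k (Finsupp.single a 1) = a.atBot k := by
  simp only [atBotMap, Finsupp.linearCombination_single, one_smul]

lemma collapseMap_single (a : Letter) : collapseMap k s (Finsupp.single a 1) =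
    Finsupp.single (a.collapse s) 1 := by
  simp only [collapseMap, Finsupp.linearCombination_single, one_smul]

lemma homotopyMap_one : homotopyMap k s (Finsupp.single one 1) = 0 := by
  simp only [homotopyMap, Finsupp.linearCombination_single, smul_zero]

lemma homotopyMap_heav (a : ℤ) : homotopyMap k s (Finsupp.single (heav a) 1) = 0 := by
  simp only [homotopyMap, Finsupp.linearCombination_single, smul_zero]

lemma homotopyMap_dirac (a : ℤ) : homotopyMap k s (Finsupp.single (dirac a) 1) =
    Finsupp.single (heav s) 1 - Finsupp.single (heav a) 1 := by
  simp only [homotopyMap, Finsupp.linearCombination_single, one_smul]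

lemma comulMap_one : comulMap k (Finsupp.single one 1) =
    Finsupp.single one 1 ⊗ₜ Finsupp.single one 1 := by
  simp only [comulMap, Finsupp.linearCombination_single, one_smul]

lemma comulMap_heav (a : ℤ) : comulMap k (Finsupp.single (heav a) 1) =
    Finsupp.single (heav a) 1 ⊗ₜ Finsupp.single (heav a) 1 := by
  simp only [comulMap, Finsupp.linearCombination_single, one_smul]

lemma comulMap_dirac (a : ℤ) : comulMap k (Finsupp.single (dirac a) 1) =
    Finsupp.single (dirac a) 1 ⊗ₜ Finsupp.single (heav a) 1 +
      Finsupp.single (heav a) 1 ⊗ₜ Finsupp.single (dirac a) 1 := by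
  simp only [comulMap, Finsupp.linearCombination_single, one_smul]

lemma hom_ext {V : Type*} [AddCommMonoid V] [Module k V] {φ ψ : (Letter →₀ k) →ₗ[k] V}
    (h₁ : φ (Finsupp.single one 1) = ψ (Finsupp.single one 1))
    (h₂ : ∀ a, φ (Finsupp.single (heav a) 1) = ψ (Finsupp.single (heav a) 1))
    (h₃ : ∀ a, φ (Finsupp.single (dirac a) 1) = ψ (Finsupp.single (dirac a) 1)) : φ = ψ := by
  refine Finsupp.lhom_ext' fun f => LinearMap.ext_ring ?_
  rcases f with _ | a | a
  exacts [h₁, h₂ a, h₃ a]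

lemma sgnMap_sgnMap (x : Letter →₀ k) : sgnMap k (sgnMap k x) = x := by
  refine LinearMap.congr_fun (f := sgnMap k ∘ₗ sgnMap k) (g := LinearMap.id)
    (hom_ext ?_ (fun a => ?_) fun a => ?_) x <;>
    simp [sgnMap_single, deg]

lemma sgnMap_dMap (x : Letter →₀ k) : sgnMap k (dMap k x) = - dMap k (sgnMap k x) := by
  refine LinearMap.congr_fun (f := sgnMap k ∘ₗ dMap k) (g := - (dMap k ∘ₗ sgnMap k))
    (hom_ext ?_ (fun a => ?_) fun a => ?_) x <;>
    simp [sgnMap_single, dMap_single, deg, diff, diffCoeff]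

lemma sgnMap_homotopyMap (x : Letter →₀ k) :
    sgnMap k (homotopyMap k s x) = - homotopyMap k s (sgnMap k x) := by
  refine LinearMap.congr_fun (f := sgnMap k ∘ₗ homotopyMap k s)
    (g := - (homotopyMap k s ∘ₗ sgnMap k)) (hom_ext ?_ (fun a => ?_) fun a => ?_) x <;>
    simp [sgnMap_single, homotopyMap_one, homotopyMap_heav, homotopyMap_dirac, deg]

lemma collapseMap_sgnMap (x : Letter →₀ k) :
    collapseMap k s (sgnMap k x) = sgnMap k (collapseMap k s x) := by
  refine LinearMap.congr_fun (f := collapseMap k s ∘ₗ sgnMap k)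
    (g := sgnMap k ∘ₗ collapseMap k s) (hom_ext ?_ (fun a => ?_) fun a => ?_) x <;>
    simp [sgnMap_single, collapseMap_single, deg, collapse]

lemma collapseMap_dMap (x : Letter →₀ k) :
    collapseMap k s (dMap k x) = dMap k (collapseMap k s x) := by
  refine LinearMap.congr_fun (f := collapseMap k s ∘ₗ dMap k)
    (g := dMap k ∘ₗ collapseMap k s) (hom_ext ?_ (fun a => ?_) fun a => ?_) x <;>
    simp [dMap_single, collapseMap_single, diff, diffCoeff, collapse]

/-- On `heav a` only `h d` contributes, giving `heav a - heav s`. On `dirac a` only `d h`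
contributes, giving `dirac a - dirac s`. -/
lemma dMap_homotopyMap (x : Letter →₀ k) :
    dMap k (homotopyMap k s x) + homotopyMap k s (dMap k x) = x - collapseMap k s x := by
  refine LinearMap.congr_fun (f := dMap k ∘ₗ homotopyMap k s + homotopyMap k s ∘ₗ dMap k)
    (g := LinearMap.id - collapseMap k s) (hom_ext ?_ (fun a => ?_) fun a => ?_) x <;>
    simp [dMap_single, collapseMap_single, homotopyMap_one, homotopyMap_heav, homotopyMap_dirac,
      diff, diffCoeff, collapse]
  abel

/-- All Heaviside functions take the value `1` at `-∞`, so their differences vanish there. This is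
what will make the homotopy commute with the faces. -/
lemma atBotMap_homotopyMap (x : Letter →₀ k) : atBotMap k (homotopyMap k s x) = 0 := by
  refine LinearMap.congr_fun (f := atBotMap k ∘ₗ homotopyMap k s) (g := 0)
    (hom_ext ?_ (fun a => ?_) fun a => ?_) x <;>
    simp [atBotMap_single, homotopyMap_one, homotopyMap_heav, homotopyMap_dirac, atBot]

lemma atBotMap_collapseMap (x : Letter →₀ k) : atBotMap k (collapseMap k s x) = atBotMap k x := by
  refine LinearMap.congr_fun (f := atBotMap k ∘ₗ collapseMap k s) (g := atBotMap k)
    (hom_ext ?_ (fun a => ?_) fun a => ?_) x <;>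
    simp [atBotMap_single, collapseMap_single, atBot, collapse]

lemma atBotMap_sgnMap (x : Letter →₀ k) : atBotMap k (sgnMap k x) = atBotMap k x := by
  refine LinearMap.congr_fun (f := atBotMap k ∘ₗ sgnMap k) (g := atBotMap k)
    (hom_ext ?_ (fun a => ?_) fun a => ?_) x <;>
    simp [atBotMap_single, sgnMap_single, atBot, deg]

lemma comulMap_collapseMap (x : Letter →₀ k) : comulMap k (collapseMap k s x) =
    TensorProduct.map (collapseMap k s) (collapseMap k s) (comulMap k x) := by
  refine LinearMap.congr_fun (f := comulMap k ∘ₗ collapseMap k s)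
    (g := TensorProduct.map (collapseMap k s) (collapseMap k s) ∘ₗ comulMap k)
    (hom_ext ?_ (fun a => ?_) fun a => ?_) x <;>
    simp [collapseMap_single, comulMap_one, comulMap_heav, comulMap_dirac, collapse]

lemma comulMap_sgnMap (x : Letter →₀ k) : comulMap k (sgnMap k x) =
    TensorProduct.map (sgnMap k) (sgnMap k) (comulMap k x) := by
  refine LinearMap.congr_fun (f := comulMap k ∘ₗ sgnMap k)
    (g := TensorProduct.map (sgnMap k) (sgnMap k) ∘ₗ comulMap k)
    (hom_ext ?_ (fun a => ?_) fun a => ?_) x <;>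
    simp [sgnMap_single, comulMap_one, comulMap_heav, comulMap_dirac, deg,
      TensorProduct.neg_tmul, TensorProduct.tmul_neg]
  exact neg_add (α := (Letter →₀ k) ⊗[k] (Letter →₀ k)) _ _

/-- On `dirac a`, the right side is `(heav s - heav a) ⊗ heav a + heav s ⊗ (heav s - heav a)`, which
telescopes to `heav s ⊗ heav s - heav a ⊗ heav a`. This coderivation identity is what will make the
homotopy commute with the degeneracies. -/
lemma comulMap_homotopyMap (x : Letter →₀ k) : comulMap k (homotopyMap k s x) =
    TensorProduct.map (homotopyMap k s) LinearMap.id (comulMap k x) +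
      TensorProduct.map (sgnMap k ∘ₗ collapseMap k s) (homotopyMap k s) (comulMap k x) := by
  refine LinearMap.congr_fun (f := comulMap k ∘ₗ homotopyMap k s)
    (g := TensorProduct.map (homotopyMap k s) LinearMap.id ∘ₗ comulMap k +
      TensorProduct.map (sgnMap k ∘ₗ collapseMap k s) (homotopyMap k s) ∘ₗ comulMap k)
    (hom_ext ?_ (fun a => ?_) fun a => ?_) x <;>
    simp [sgnMap_single, collapseMap_single, homotopyMap_one, homotopyMap_heav, homotopyMap_dirac,
      comulMap_one, comulMap_heav, comulMap_dirac, deg, collapse, TensorProduct.sub_tmul,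
      TensorProduct.tmul_sub]

end Letter

namespace Cube

/-! ### The forms on the cube as a tensor power. -/

section Tprod

variable (k : Type u) [CommRing k]

/-- The tensor product of forms in one variable. -/
noncomputable def tprod (m : ℕ) :
    MultilinearMap k (fun _ : Fin m => Letter →₀ k) ((Fin m → Letter) →₀ k) where
  toFun x := Finsupp.onFinset (Fintype.piFinset fun i => (x i).support) (fun g => ∏ i, x i (g i))
    fun g hg => Fintype.mem_piFinset.2 fun i => Finsupp.mem_support_iff.2 fun h =>
      hg (Finset.prod_eq_zero (Finset.mem_univ i) h)
  map_update_add' x i a b := by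
    ext g
    exact ((MultilinearMap.mkPiAlgebra k (Fin m) k).compLinearMap
      fun i => Finsupp.lapply (g i)).map_update_add x i a b
  map_update_smul' x i c a := by
    ext g
    exact ((MultilinearMap.mkPiAlgebra k (Fin m) k).compLinearMap
      fun i => Finsupp.lapply (g i)).map_update_smul x i c a

variable {k} {m : ℕ}

lemma tprod_apply (x : Fin m → Letter →₀ k) (g : Fin m → Letter) :
    tprod k m x g = ∏ i, x i (g i) := rfl

lemma tprod_single (f : Fin m → Letter) :
    tprod k m (fun i => Finsupp.single (f i) 1) = Finsupp.single f 1 := by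
  classical
  ext g
  rw [tprod_apply, Finsupp.single_apply]
  simp only [Finsupp.single_apply]
  by_cases h : f = g
  · subst h; simp
  · obtain ⟨i, hi⟩ := Function.ne_iff.1 h
    rw [if_neg h]
    exact Finset.prod_eq_zero (Finset.mem_univ i) (if_neg hi)

/-- A coefficient of the tensor product is a product of coefficients, hence zero once one letter is
excluded. Conditions on words can therefore be checked place by place. -/
lemma tprod_mem_supported {x : Fin m → Letter →₀ k} (P : Fin m → Set Letter)
    (h : ∀ i, x i ∈ Finsupp.supported k k (P i)) :
    tprod k m x ∈ Finsupp.supported k k {g | ∀ i, g i ∈ P i} := by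
  rw [Finsupp.mem_supported']
  intro g hg
  simp only [Set.mem_ofPred_eq, not_forall] at hg
  obtain ⟨i, hi⟩ := hg
  exact Finset.prod_eq_zero (Finset.mem_univ i) ((Finsupp.mem_supported' k _).1 (h i) _ hi)

lemma multilinear_ext {N : Type*} [AddCommGroup N] [Module k N]
    {F G : MultilinearMap k (fun _ : Fin m => Letter →₀ k) N}
    (h : ∀ f : Fin m → Letter, F (fun i => Finsupp.single (f i) 1) =
      G fun i => Finsupp.single (f i) 1) : F = G :=
  Module.Basis.ext_multilinear (fun _ => Finsupp.basisSingleOne) (by simpa using h)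

lemma hom_ext_tprod {N : Type*} [AddCommGroup N] [Module k N]
    {φ ψ : ((Fin m → Letter) →₀ k) →ₗ[k] N} (h : ∀ x, φ (tprod k m x) = ψ (tprod k m x)) :
    φ = ψ :=
  Finsupp.lhom_ext' fun f => LinearMap.ext_ring <| by
    simpa [tprod_single] using h fun i => Finsupp.single (f i) 1

lemma hom_ext_insertNth {N : Type*} [AddCommGroup N] [Module k N] (i : Fin (m + 1))
    {φ ψ : ((Fin (m + 1) → Letter) →₀ k) →ₗ[k] N}
    (h : ∀ a w, φ (tprod k (m + 1) (i.insertNth (α := fun _ => Letter →₀ k) a w)) =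
      ψ (tprod k (m + 1) (i.insertNth (α := fun _ => Letter →₀ k) a w))) : φ = ψ :=
  hom_ext_tprod fun x => by rw [← Fin.insertNth_self_removeNth i x]; exact h _ _

variable (k) in
/-- The tensor product of forms in one variable, with the factor at place `i` singled out. -/
noncomputable def tprodAt (i : Fin (m + 1)) : (Letter →₀ k) →ₗ[k]
    MultilinearMap k (fun _ : Fin m => Letter →₀ k) ((Fin (m + 1) → Letter) →₀ k) :=
  (tprod k (m + 1)).curryMid i

lemma tprodAt_apply (i : Fin (m + 1)) (a : Letter →₀ k) (w : Fin m → Letter →₀ k) :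
    tprodAt k i a w = tprod k (m + 1) (i.insertNth (α := fun _ => Letter →₀ k) a w) := rfl

/-- The tensor product of forms in one variable, with the factors at places `i` and `i + 1` singled
out. -/
noncomputable def tprodAtPair (i : Fin (m + 1)) (w : Fin m → Letter →₀ k) :
    (Letter →₀ k) ⊗[k] (Letter →₀ k) →ₗ[k] (Fin (m + 2) → Letter) →₀ k :=
  TensorProduct.lift (LinearMap.mk₂ k
    -- Inserting `b` at `i` and then `a` at the same position puts `a` immediately before `b`, the
    -- convention followed by `insert`.
    (fun a b => tprodAt k i.castSucc a (i.insertNth (α := fun _ => Letter →₀ k) b w))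
    (fun a a' b => by rw [map_add]; rfl) (fun c a b => by rw [map_smul]; rfl)
    (fun a b b' => (tprodAt k i.castSucc a).map_insertNth_add i w b b')
    (fun c a b => (tprodAt k i.castSucc a).map_insertNth_smul i w c b))

lemma tprodAtPair_tmul (i : Fin (m + 1)) (w : Fin m → Letter →₀ k) (a b : Letter →₀ k) :
    tprodAtPair i w (a ⊗ₜ b) = tprod k (m + 2) (i.castSucc.insertNth (α := fun _ => Letter →₀ k) a
      (i.insertNth (α := fun _ => Letter →₀ k) b w)) := rfl

end Tprod

/-! ### The structure maps of the cubes on pure tensors of arbitrary one-variable forms. -/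

variable {k : Type u} [CommRing k] {n : ℕ}

/-- The Koszul sign is absorbed by applying the grading involution to the factors before `j`, which
turns the differential into a sum of staircases. -/
lemma d_tprod (x : Fin (n + 1) → Letter →₀ k) : d k n (tprod k (n + 1) x) =
    ∑ j, tprod k (n + 1) fun l =>
      staircase (fun _ => Letter.sgnMap k) (fun _ => Letter.dMap k) j l (x l) := by
  have : (d k n).compMultilinearMap (tprod k (n + 1)) = ∑ j, (tprod k (n + 1)).compLinearMap
      (staircase (fun _ => Letter.sgnMap k) (fun _ => Letter.dMap k) j) := by
    refine multilinear_ext fun f => ?_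
    rw [LinearMap.compMultilinearMap_apply, tprod_single, d_single, sum_apply]
    refine Finset.sum_congr rfl fun j _ => ?_
    -- All scalars are pulled in front of the letters, one per place. Their product is the Koszul
    -- sign times the coefficient of the differential.
    have e (l : Fin (n + 1)) : staircase (fun _ => Letter.sgnMap k) (fun _ => Letter.dMap k) j l
        (Finsupp.single (f l) 1) =
        ((-1 : k) ^ (if l < j then (f l).deg else 0) * if l = j then (f j).diffCoeff k else 1) •
          Finsupp.single (Function.update f j (f j).diff l) 1 := by
      rcases lt_trichotomy l j with h | rfl | h
      · simp [staircase, h, h.ne, Letter.sgnMap_single]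
      · simp [staircase, Letter.dMap_single]
      · simp [staircase, not_lt.2 h.le, h.ne']
    rw [MultilinearMap.compLinearMap_apply]
    simp_rw [e]
    rw [MultilinearMap.map_smul_univ, tprod_single, Finset.prod_mul_distrib,
      Finset.prod_pow_eq_pow_sum, Finset.prod_ite_eq' Finset.univ j fun _ => (f j).diffCoeff k,
      if_pos (Finset.mem_univ j)]
    rfl
  simpa using congrArg (fun F => F x) this

lemma sgn_tprod (x : Fin (n + 1) → Letter →₀ k) : sgn k n (tprod k (n + 1) x) =
    tprod k (n + 1) fun l => Letter.sgnMap k (x l) := by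
  have : (sgn k n).compMultilinearMap (tprod k (n + 1)) = (tprod k (n + 1)).compLinearMap
      fun _ => Letter.sgnMap k := by
    refine multilinear_ext fun f => ?_
    rw [LinearMap.compMultilinearMap_apply, tprod_single, sgn_single,
      MultilinearMap.compLinearMap_apply]
    simp_rw [Letter.sgnMap_single]
    rw [MultilinearMap.map_smul_univ, tprod_single, Finset.prod_pow_eq_pow_sum]
    rfl
  simpa using congrArg (fun F => F x) this

lemma face_tprod (i : Fin (n + 2)) (a : Letter →₀ k) (w : Fin (n + 1) → Letter →₀ k) :
    face k n i (tprod k (n + 2) (i.insertNth (α := fun _ => Letter →₀ k) a w)) =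
      Letter.atBotMap k a • tprod k (n + 1) w := by
  rw [← tprodAt_apply]
  induction a using Finsupp.induction_linear with
  | zero => simp
  | add a b ha hb => rw [map_add, add_apply, map_add, ha, hb, map_add, add_smul]
  | single a c =>
    rw [← mul_one c, ← smul_eq_mul, ← Finsupp.smul_single, map_smul, smul_apply,
      map_smul, map_smul, smul_assoc]
    congr 1
    have : (face k n i).compMultilinearMap (tprodAt k i (Finsupp.single a 1)) =
        Letter.atBotMap k (Finsupp.single a 1) • tprod k (n + 1) := by
      refine multilinear_ext fun f => ?_
      have e : (i.insertNth (α := fun _ => Letter →₀ k) (Finsupp.single a 1)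
          fun l => Finsupp.single (f l) 1) =
          fun l => Finsupp.single (i.insertNth (α := fun _ => Letter) a f l) 1 := by
        funext l
        induction l using Fin.succAboveCases i <;> simp
      rw [LinearMap.compMultilinearMap_apply, tprodAt_apply, e, tprod_single, face_single,
        smul_apply, tprod_single, Letter.atBotMap_single, Fin.insertNth_apply_same,
        Fin.removeNth_insertNth]
    exact congrArg (fun F => F w) this

/-- By linearity in the singled-out factor it suffices to treat a letter there, and by
multilinearity letters elsewhere. The degeneracy is then the coproduct at place `i` by definition.
-/
lemma degen_tprod (i : Fin (n + 1)) (a : Letter →₀ k) (w : Fin n → Letter →₀ k) :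
    degen k n i (tprod k (n + 1) (i.insertNth (α := fun _ => Letter →₀ k) a w)) =
      tprodAtPair i w (Letter.comulMap k a) := by
  rw [← tprodAt_apply]
  induction a using Finsupp.induction_linear with
  | zero => simp
  | add a b ha hb => simp only [map_add, add_apply, ha, hb]
  | single a c =>
    rw [← mul_one c, ← smul_eq_mul, ← Finsupp.smul_single, map_smul, smul_apply,
      map_smul, map_smul, map_smul]
    congr 1
    have e (a : Letter) (f : Fin n → Letter) :
        (i.insertNth (α := fun _ => Letter →₀ k) (Finsupp.single a 1)
          fun l => Finsupp.single (f l) 1) =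
        fun l => Finsupp.single (i.insertNth (α := fun _ => Letter) a f l) 1 := by
      funext l
      induction l using Fin.succAboveCases i <;> simp
    have e' (a : Letter) (f : Fin (n + 1) → Letter) :
        (i.castSucc.insertNth (α := fun _ => Letter →₀ k) (Finsupp.single a 1)
          fun l => Finsupp.single (f l) 1) =
        fun l => Finsupp.single (i.castSucc.insertNth (α := fun _ => Letter) a f l) 1 := by
      funext l
      induction l using Fin.succAboveCases i.castSucc <;> simp
    have h2 (a b : Letter) (f : Fin n → Letter) :
        (tprodAt k i.castSucc (Finsupp.single a 1)).curryMid i (Finsupp.single b 1)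
          (fun l => Finsupp.single (f l) 1) =
        Finsupp.single (insert i a (i.insertNth (α := fun _ => Letter) b f)) 1 := by
      rw [MultilinearMap.curryMid_apply_apply, e, tprodAt_apply, e', tprod_single]
      rfl
    rcases a with _ | a | a
    · have : (degen k n i).compMultilinearMap (tprodAt k i (Finsupp.single .one 1)) =
          (tprodAt k i.castSucc (Finsupp.single .one 1)).curryMid i (Finsupp.single .one 1) := by
        refine multilinear_ext fun f => ?_
        rw [LinearMap.compMultilinearMap_apply, tprodAt_apply, e, tprod_single, degen_single,
          Fin.insertNth_apply_same, h2]
      rw [Letter.comulMap_one]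
      exact congrArg (fun F => F w) this
    · have : (degen k n i).compMultilinearMap (tprodAt k i (Finsupp.single (.heav a) 1)) =
          (tprodAt k i.castSucc (Finsupp.single (.heav a) 1)).curryMid i
            (Finsupp.single (.heav a) 1) := by
        refine multilinear_ext fun f => ?_
        rw [LinearMap.compMultilinearMap_apply, tprodAt_apply, e, tprod_single, degen_single,
          Fin.insertNth_apply_same, h2]
      rw [Letter.comulMap_heav]
      exact congrArg (fun F => F w) this
    · have : (degen k n i).compMultilinearMap (tprodAt k i (Finsupp.single (.dirac a) 1)) =
          (tprodAt k i.castSucc (Finsupp.single (.dirac a) 1)).curryMid i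
            (Finsupp.single (.heav a) 1) +
          (tprodAt k i.castSucc (Finsupp.single (.heav a) 1)).curryMid i
            (Finsupp.single (.dirac a) 1) := by
        refine multilinear_ext fun f => ?_
        rw [LinearMap.compMultilinearMap_apply, tprodAt_apply, e, tprod_single, degen_single,
          Fin.insertNth_apply_same, add_apply, h2, h2]
        simp only [Fin.update_insertNth]
      rw [Letter.comulMap_dirac, map_add]
      exact congrArg (fun F => F w) this

/-! ### The collapse and its homotopy on the cubes. -/

variable (k) in
/-- The endomorphism of the forms on the cube which moves the singular supports to `s`. -/
noncomputable def collapse (s : ℤ) (n : ℕ) : Cube k n →ₗ[k] Cube k n :=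
  Finsupp.linearCombination k fun f => Finsupp.single (fun l => (f l).collapse s) 1

variable (k) in
/-- The homotopy from the identity to `collapse`. -/
noncomputable def homotopy (s : ℤ) (n : ℕ) : Cube k n →ₗ[k] Cube k n :=
  Finsupp.linearCombination k fun f => ∑ j, tprod k (n + 1) fun l =>
    staircase (fun _ => Letter.sgnMap k ∘ₗ Letter.collapseMap k s) (fun _ => Letter.homotopyMap k s)
      j l (Finsupp.single (f l) 1)

lemma collapse_single (s : ℤ) (f : Word n) : collapse k s n (Finsupp.single f 1) =
    Finsupp.single (fun l => (f l).collapse s) 1 := by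
  simp only [collapse, Finsupp.linearCombination_single, one_smul]

lemma homotopy_single (s : ℤ) (f : Word n) : homotopy k s n (Finsupp.single f 1) =
    ∑ j, tprod k (n + 1) fun l => staircase (fun _ => Letter.sgnMap k ∘ₗ Letter.collapseMap k s)
      (fun _ => Letter.homotopyMap k s) j l (Finsupp.single (f l) 1) := by
  simp only [homotopy, Finsupp.linearCombination_single, one_smul]

lemma collapse_tprod (s : ℤ) (x : Fin (n + 1) → Letter →₀ k) :
    collapse k s n (tprod k (n + 1) x) =
      tprod k (n + 1) fun l => Letter.collapseMap k s (x l) := by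
  have : (collapse k s n).compMultilinearMap (tprod k (n + 1)) = (tprod k (n + 1)).compLinearMap
      fun _ => Letter.collapseMap k s := by
    refine multilinear_ext fun f => ?_
    rw [LinearMap.compMultilinearMap_apply, tprod_single, collapse_single,
      MultilinearMap.compLinearMap_apply]
    simp_rw [Letter.collapseMap_single]
    rw [tprod_single]
  simpa using congrArg (fun F => F x) this

lemma homotopy_tprod (s : ℤ) (x : Fin (n + 1) → Letter →₀ k) :
    homotopy k s n (tprod k (n + 1) x) =
      ∑ j, tprod k (n + 1) fun l =>
        staircase (fun _ => Letter.sgnMap k ∘ₗ Letter.collapseMap k s)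
          (fun _ => Letter.homotopyMap k s) j l (x l) := by
  have : (homotopy k s n).compMultilinearMap (tprod k (n + 1)) =
      ∑ j, (tprod k (n + 1)).compLinearMap
        (staircase (fun _ => Letter.sgnMap k ∘ₗ Letter.collapseMap k s)
          (fun _ => Letter.homotopyMap k s) j) := by
    refine multilinear_ext fun f => ?_
    rw [LinearMap.compMultilinearMap_apply, tprod_single, homotopy_single,
      sum_apply]
    rfl
  simpa using congrArg (fun F => F x) this

/-- The one-variable homotopy identity propagates to the tensor power through `sum_staircase_comm`.
-/
lemma d_homotopy (s : ℤ) (n : ℕ) : d k n ∘ₗ homotopy k s n + homotopy k s n ∘ₗ d k n =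
    LinearMap.id - collapse k s n := by
  refine hom_ext_tprod fun x => ?_
  simp only [LinearMap.add_apply, LinearMap.comp_apply, homotopy_tprod, d_tprod, map_sum,
    LinearMap.sub_apply, LinearMap.id_apply, collapse_tprod]
  exact sum_staircase_comm (tprod k (n + 1)) _ _ (fun _ => Letter.collapseMap k s) _
    (fun _ => Letter.sgnMap_sgnMap) (fun _ => Letter.sgnMap_dMap)
    (fun _ => Letter.sgnMap_homotopyMap s) (fun _ => Letter.collapseMap_sgnMap s)
    (fun _ => Letter.collapseMap_dMap s) (fun _ => Letter.dMap_homotopyMap s) x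

lemma collapse_d (s : ℤ) (n : ℕ) : collapse k s n ∘ₗ d k n = d k n ∘ₗ collapse k s n := by
  refine hom_ext_tprod fun x => ?_
  simp only [LinearMap.comp_apply, d_tprod, map_sum, collapse_tprod]
  refine Finset.sum_congr rfl fun j _ => congrArg _ (funext fun l => ?_)
  unfold staircase
  split_ifs
  exacts [Letter.collapseMap_sgnMap s _, Letter.collapseMap_dMap s _, rfl]

lemma collapse_sgn (s : ℤ) (n : ℕ) : collapse k s n ∘ₗ sgn k n = sgn k n ∘ₗ collapse k s n := by
  refine hom_ext_tprod fun x => ?_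
  simp only [LinearMap.comp_apply, sgn_tprod, collapse_tprod, Letter.collapseMap_sgnMap]

lemma sgn_sgn (n : ℕ) : sgn k n ∘ₗ sgn k n = LinearMap.id := by
  refine hom_ext_tprod fun x => ?_
  simp only [LinearMap.comp_apply, sgn_tprod, Letter.sgnMap_sgnMap, LinearMap.id_apply]

/-- In each term the only odd operator is the one-variable homotopy at place `j`, so exactly one
sign appears. -/
lemma sgn_homotopy (s : ℤ) (n : ℕ) :
    sgn k n ∘ₗ homotopy k s n = - (homotopy k s n ∘ₗ sgn k n) := by
  refine hom_ext_tprod fun x => ?_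
  simp only [LinearMap.comp_apply, LinearMap.neg_apply, sgn_tprod, homotopy_tprod, map_sum,
    ← Finset.sum_neg_distrib]
  refine Finset.sum_congr rfl fun j _ => map_neg_of_eq_off _ j (fun l hl => ?_) ?_
  · unfold staircase
    rw [if_neg hl]
    split_ifs
    · simp [Letter.collapseMap_sgnMap]
    · rfl
  · simp [staircase, Letter.sgnMap_homotopyMap]

/-! ### Compatibility of the homotopy with faces and degeneracies. -/

section Insertion

variable {V : Type*} [AddCommGroup V] [Module k V] {m : ℕ}

lemma staircase_insertNth_same (φ ψ : V →ₗ[k] V) (i : Fin (m + 1)) (a : V) (w : Fin m → V) :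
    (fun l => staircase (fun _ => φ) (fun _ => ψ) i l (i.insertNth (α := fun _ => V) a w l)) =
      i.insertNth (α := fun _ => V) (ψ a) fun l => if i.succAbove l < i then φ (w l) else w l := by
  funext l
  induction l using Fin.succAboveCases i with
  | x => simp [staircase]
  | p l =>
    simp only [staircase, Fin.insertNth_apply_succAbove, Fin.succAbove_ne, if_false]
    split_ifs <;> rfl

lemma staircase_insertNth_succAbove (φ ψ : V →ₗ[k] V) (i : Fin (m + 1)) (j : Fin m) (a : V)
    (w : Fin m → V) :
    (fun l => staircase (fun _ => φ) (fun _ => ψ) (i.succAbove j) l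
      (i.insertNth (α := fun _ => V) a w l)) =
      i.insertNth (α := fun _ => V) ((if i < i.succAbove j then φ else LinearMap.id) a)
        fun l => staircase (fun _ => φ) (fun _ => ψ) j l (w l) := by
  funext l
  induction l using Fin.succAboveCases i with
  | x =>
    simp only [staircase, Fin.insertNth_apply_same, (Fin.succAbove_ne i j).symm, if_false]
  | p l => simp [staircase]

end Insertion

/-- The sum is split according to whether the one-variable homotopy acts at the singled-out place or
at another place `j`. In the second case the singled-out factor is collapsed exactly when it stands
before `j`. -/
lemma homotopy_insertNth (s : ℤ) (i : Fin (n + 1)) (a : Letter →₀ k) (w : Fin n → Letter →₀ k) :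
    homotopy k s n (tprod k (n + 1) (i.insertNth (α := fun _ => Letter →₀ k) a w)) =
      tprod k (n + 1) (i.insertNth (α := fun _ => Letter →₀ k) (Letter.homotopyMap k s a)
        fun l => if i.succAbove l < i then (Letter.sgnMap k ∘ₗ Letter.collapseMap k s) (w l)
          else w l) +
      ∑ j, tprod k (n + 1) (i.insertNth (α := fun _ => Letter →₀ k)
        ((if i < i.succAbove j then Letter.sgnMap k ∘ₗ Letter.collapseMap k s else LinearMap.id) a)
        fun l => staircase (fun _ => Letter.sgnMap k ∘ₗ Letter.collapseMap k s)
          (fun _ => Letter.homotopyMap k s) j l (w l)) := by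
  rw [homotopy_tprod, Fin.sum_univ_succAbove _ i, staircase_insertNth_same]
  simp only [staircase_insertNth_succAbove]

/-- The term with the homotopy at place `i` dies at `-∞`. In the others the factor at `i` is
unchanged or collapsed with a sign, and neither affects its value at `-∞`. -/
lemma face_homotopy (s : ℤ) (i : Fin (n + 2)) :
    face k n i ∘ₗ homotopy k s (n + 1) = homotopy k s n ∘ₗ face k n i := by
  refine hom_ext_insertNth i fun a w => ?_
  rw [LinearMap.comp_apply, LinearMap.comp_apply, homotopy_insertNth, map_add, map_sum,
    face_tprod, Letter.atBotMap_homotopyMap, zero_smul, zero_add, face_tprod, map_smul,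
    homotopy_tprod, Finset.smul_sum]
  refine Finset.sum_congr rfl fun j _ => ?_
  rw [face_tprod]
  congr 1
  split_ifs
  · rw [LinearMap.comp_apply, Letter.atBotMap_sgnMap, Letter.atBotMap_collapseMap]
  · rfl

lemma face_collapse (s : ℤ) (i : Fin (n + 2)) :
    face k n i ∘ₗ collapse k s (n + 1) = collapse k s n ∘ₗ face k n i := by
  refine hom_ext_insertNth i fun a w => ?_
  have e : (fun l => Letter.collapseMap k s (i.insertNth (α := fun _ => Letter →₀ k) a w l)) =
      i.insertNth (α := fun _ => Letter →₀ k) (Letter.collapseMap k s a)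
        fun l => Letter.collapseMap k s (w l) := by
    funext l
    induction l using Fin.succAboveCases i <;> simp
  rw [LinearMap.comp_apply, LinearMap.comp_apply, collapse_tprod, e, face_tprod, face_tprod,
    map_smul, collapse_tprod, Letter.atBotMap_collapseMap]

lemma collapse_tprodAtPair (s : ℤ) (i : Fin (n + 1)) (w : Fin n → Letter →₀ k)
    (z : (Letter →₀ k) ⊗[k] (Letter →₀ k)) : collapse k s (n + 1) (tprodAtPair i w z) =
      tprodAtPair i (fun l => Letter.collapseMap k s (w l))
        (TensorProduct.map (Letter.collapseMap k s) (Letter.collapseMap k s) z) := by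
  induction z with
  | zero => simp
  | add z z' h h' => simp only [map_add, h, h']
  | tmul a b =>
    rw [tprodAtPair_tmul, collapse_tprod, TensorProduct.map_tmul, tprodAtPair_tmul]
    congr 1
    funext l
    induction l using Fin.succAboveCases i.castSucc with
    | x => simp only [Fin.insertNth_apply_same]
    | p l =>
      induction l using Fin.succAboveCases i <;>
        simp only [Fin.insertNth_apply_same, Fin.insertNth_apply_succAbove]

lemma degen_collapse (s : ℤ) (i : Fin (n + 1)) :
    degen k n i ∘ₗ collapse k s n = collapse k s (n + 1) ∘ₗ degen k n i := by
  refine hom_ext_insertNth i fun a w => ?_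
  have e : (fun l => Letter.collapseMap k s (i.insertNth (α := fun _ => Letter →₀ k) a w l)) =
      i.insertNth (α := fun _ => Letter →₀ k) (Letter.collapseMap k s a)
        fun l => Letter.collapseMap k s (w l) := by
    funext l
    induction l using Fin.succAboveCases i <;> simp
  rw [LinearMap.comp_apply, LinearMap.comp_apply, collapse_tprod, e, degen_tprod, degen_tprod,
    collapse_tprodAtPair, Letter.comulMap_collapseMap]

/-- When the homotopy acts at one of the two adjacent places, the two resulting terms form the right
side of `Letter.comulMap_homotopyMap`. When it acts elsewhere, adjacency ensures that both factors
lie on the same side of `j` and receive the same operator. -/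
lemma homotopy_tprodAtPair (s : ℤ) (i : Fin (n + 1)) (w : Fin n → Letter →₀ k)
    (z : (Letter →₀ k) ⊗[k] (Letter →₀ k)) : homotopy k s (n + 1) (tprodAtPair i w z) =
      tprodAtPair i (fun l => if i.succAbove l < i then
          (Letter.sgnMap k ∘ₗ Letter.collapseMap k s) (w l) else w l)
        (TensorProduct.map (Letter.homotopyMap k s) LinearMap.id z +
          TensorProduct.map (Letter.sgnMap k ∘ₗ Letter.collapseMap k s)
            (Letter.homotopyMap k s) z) +
      ∑ j, tprodAtPair i (fun l => staircase
          (fun _ => Letter.sgnMap k ∘ₗ Letter.collapseMap k s) (fun _ => Letter.homotopyMap k s)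
            j l (w l))
        (TensorProduct.map
          (if i < i.succAbove j then Letter.sgnMap k ∘ₗ Letter.collapseMap k s else LinearMap.id)
          (if i < i.succAbove j then Letter.sgnMap k ∘ₗ Letter.collapseMap k s else LinearMap.id)
          z) := by
  induction z with
  | zero => simp
  | add z z' h h' =>
    simp only [map_add, Finset.sum_add_distrib, h, h']
    abel
  | tmul a b =>
    have e1 (φ ψ : (Letter →₀ k) →ₗ[k] Letter →₀ k) (w : Fin n → Letter →₀ k) :
        tprodAtPair i w (TensorProduct.map φ ψ (a ⊗ₜ b)) = tprod k (n + 2)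
          (i.castSucc.insertNth (α := fun _ => Letter →₀ k) (φ a)
            (i.insertNth (α := fun _ => Letter →₀ k) (ψ b) w)) := rfl
    rw [tprodAtPair_tmul i w a b, homotopy_insertNth, Fin.sum_univ_succAbove _ i, ← add_assoc,
      staircase_insertNth_same, map_add (tprodAtPair i _), e1, e1]
    simp only [e1]
    -- The three groups are: homotopy at the first place of the pair, at the second, and outside the
    -- pair.
    refine congrArg₂ (· + ·) (congrArg₂ (· + ·) ?_ ?_) ?_
    · refine congrArg (fun y => tprod k (n + 2)
        (i.castSucc.insertNth (α := fun _ => Letter →₀ k) (Letter.homotopyMap k s a) y)) ?_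
      funext l
      induction l using Fin.succAboveCases i with
      | x => simp [(Fin.castSucc_lt_succ (i := i)).not_gt]
      | p l =>
        have : i.castSucc.succAbove (i.succAbove l) < i.castSucc ↔ i.succAbove l < i := by
          rw [Fin.succAbove_lt_iff_castSucc_lt]; simp
        simp only [this, Fin.insertNth_apply_succAbove]
    · simp
    · refine Finset.sum_congr rfl fun j _ => ?_
      have : i.castSucc < i.castSucc.succAbove (i.succAbove j) ↔ i < i.succAbove j := by
        rw [Fin.lt_succAbove_iff_le_castSucc, Fin.castSucc_le_castSucc_iff,
          (Fin.succAbove_ne i j).symm.le_iff_lt]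
      simp only [staircase_insertNth_succAbove, this]

/-- The term at place `i` matches by the coderivation identity. The others match because the
collapse and the grading involution are morphisms of coalgebras. -/
lemma degen_homotopy (s : ℤ) (i : Fin (n + 1)) :
    degen k n i ∘ₗ homotopy k s n = homotopy k s (n + 1) ∘ₗ degen k n i := by
  refine hom_ext_insertNth i fun a w => ?_
  rw [LinearMap.comp_apply, LinearMap.comp_apply, homotopy_insertNth, degen_tprod, map_add,
    map_sum, degen_tprod, homotopy_tprodAtPair, Letter.comulMap_homotopyMap]
  congr 1
  refine Finset.sum_congr rfl fun j _ => ?_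
  rw [degen_tprod]
  congr 1
  split_ifs
  · rw [LinearMap.comp_apply, Letter.comulMap_sgnMap, Letter.comulMap_collapseMap,
      TensorProduct.map_comp]
    rfl
  · simp

/-- The effect of the homotopy on the degrees and on the singular supports. -/
lemma homotopy_single_mem (s : ℤ) (f : Word n) : homotopy k s n (Finsupp.single f 1) ∈
    Submodule.span k ((fun g : Word n => Finsupp.single g (1 : k)) ''
      {g | (∀ i, f i ≠ .one → g i ≠ .one) ∧ g.supp ⊆ f.supp ∪ {s} ∧ g.deg + 1 = f.deg}) := by
  rw [homotopy_single, ← Finsupp.supported_eq_span_single]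
  refine Submodule.sum_mem _ fun j _ => ?_
  -- The condition on words is split into one condition per place. The drop of the degree by one is
  -- assigned to place `j`, so the degrees add up correctly.
  refine Finsupp.supported_mono ?_ (tprod_mem_supported (fun l => {b | (f l ≠ .one → b ≠ .one) ∧
    b.supp ⊆ (f l).supp ∪ {s} ∧ b.deg + (if l = j then 1 else 0) = (f l).deg}) fun l => ?_)
  · intro g hg
    simp only [Set.mem_ofPred_eq] at hg ⊢
    refine ⟨fun i => (hg i).1, ?_, ?_⟩
    · refine Set.iUnion_subset fun i => (hg i).2.1.trans ?_
      exact Set.union_subset_union_left _ (Set.subset_iUnion (fun i => (f i).supp) i)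
    · simp only [Word.deg, ← fun i => (hg i).2.2, Finset.sum_add_distrib, Finset.sum_ite_eq',
        Finset.mem_univ, if_true]
  · rcases lt_trichotomy l j with h | rfl | h
    · rw [staircase_of_lt _ _ h, LinearMap.comp_apply, Letter.collapseMap_single, Letter.sgnMap_single]
      refine Submodule.smul_mem _ _ (Finsupp.single_mem_supported k _ ?_)
      exact ⟨Letter.collapse_ne_one s, (Letter.supp_collapse s _).trans Set.subset_union_right,
        by rw [if_neg h.ne, Letter.deg_collapse, add_zero]⟩
    · rw [staircase_self]
      -- At the place of the homotopy, the letters of degree `0` are killed. Only a Dirac letter,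
      -- which has a degree to lose, contributes.
      rcases f l with _ | a | a
      · rw [Letter.homotopyMap_one]; exact Submodule.zero_mem _
      · rw [Letter.homotopyMap_heav]; exact Submodule.zero_mem _
      · rw [Letter.homotopyMap_dirac]
        refine Submodule.sub_mem _ (Finsupp.single_mem_supported k _ ?_)
          (Finsupp.single_mem_supported k _ ?_)
        · simp [Letter.supp, Letter.deg]
        · simp [Letter.supp, Letter.deg]
    · rw [staircase_of_gt _ _ h]
      refine Finsupp.single_mem_supported k _ ?_
      exact ⟨id, Set.subset_union_left, by rw [if_neg h.ne', add_zero]⟩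

end Cube

end QuasiCommutative

namespace QuasiCommutative

/-! ### Descent to the simplices, and control of the singular supports. -/

namespace Cube

variable {k : Type u} [CommRing k] {n : ℕ}

lemma vanishing_collapse (s : ℤ) (n : ℕ) :
    vanishing k n ≤ (vanishing k n).comap (collapse k s n) :=
  vanishing_le_comap _ fun f hf => by
    rw [collapse_single]
    exact single_mem_vanishing fun i => Letter.collapse_ne_one s (hf i)

/-- The homotopy never turns a letter other than `1` into `1`, so it preserves the forms that vanish
when some variable is `+∞`. -/
lemma vanishing_homotopy (s : ℤ) (n : ℕ) :
    vanishing k n ≤ (vanishing k n).comap (homotopy k s n) :=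
  vanishing_le_comap _ fun f hf => by
    refine Submodule.span_le.2 ?_ (homotopy_single_mem s f)
    rintro _ ⟨g, hg, rfl⟩
    exact single_mem_vanishing fun i => hg.1 i (hf i)

open Classical in
variable (k) in
/-- The projection onto the span of the pure tensors with singular support in `W`, which kills the
other pure tensors. -/
noncomputable def project (W : Set ℤ) (n : ℕ) : Cube k n →ₗ[k] Cube k n :=
  Finsupp.linearCombination k fun f => if f.supp ⊆ W then Finsupp.single f 1 else 0

open Classical in
lemma project_single (W : Set ℤ) (f : Word n) : project k W n (Finsupp.single f 1) =
    if f.supp ⊆ W then Finsupp.single f 1 else 0 := by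
  simp only [project, Finsupp.linearCombination_single, one_smul]

lemma vanishing_project (W : Set ℤ) (n : ℕ) :
    vanishing k n ≤ (vanishing k n).comap (project k W n) :=
  vanishing_le_comap _ fun f hf => by
    rw [project_single]
    split_ifs
    exacts [single_mem_vanishing hf, Submodule.zero_mem _]

end Cube

namespace Forms

variable (k : Type u) [CommRing k]

/-- The endomorphism of the forms which moves the singular supports to `s`. -/
noncomputable def collapse (s : ℤ) (n : ℕ) : Forms k n →ₗ[k] Forms k n :=
  Submodule.mapQ _ _ (Cube.collapse k s n) (Cube.vanishing_collapse s n)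

/-- The homotopy from the identity to `collapse`. -/
noncomputable def homotopy (s : ℤ) (n : ℕ) : Forms k n →ₗ[k] Forms k n :=
  Submodule.mapQ _ _ (Cube.homotopy k s n) (Cube.vanishing_homotopy s n)

/-- The projection onto the forms with singular support in `W`. -/
noncomputable def project (W : Set ℤ) (n : ℕ) : Forms k n →ₗ[k] Forms k n :=
  Submodule.mapQ _ _ (Cube.project k W n) (Cube.vanishing_project W n)

variable {k} {n : ℕ}

lemma d_homotopy (s : ℤ) (n : ℕ) : d k n ∘ₗ homotopy k s n + homotopy k s n ∘ₗ d k n =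
    LinearMap.id - collapse k s n := by
  refine LinearMap.ext fun x => ?_
  obtain ⟨x, rfl⟩ := Submodule.Quotient.mk_surjective _ x
  exact congrArg Submodule.Quotient.mk (LinearMap.congr_fun (Cube.d_homotopy s n) x)

lemma collapse_d (s : ℤ) (n : ℕ) : collapse k s n ∘ₗ d k n = d k n ∘ₗ collapse k s n := by
  refine LinearMap.ext fun x => ?_
  obtain ⟨x, rfl⟩ := Submodule.Quotient.mk_surjective _ x
  exact congrArg Submodule.Quotient.mk (LinearMap.congr_fun (Cube.collapse_d s n) x)

lemma collapse_sgn (s : ℤ) (n : ℕ) : collapse k s n ∘ₗ sgn k n = sgn k n ∘ₗ collapse k s n := by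
  refine LinearMap.ext fun x => ?_
  obtain ⟨x, rfl⟩ := Submodule.Quotient.mk_surjective _ x
  exact congrArg Submodule.Quotient.mk (LinearMap.congr_fun (Cube.collapse_sgn s n) x)

lemma sgn_sgn (n : ℕ) : sgn k n ∘ₗ sgn k n = LinearMap.id := by
  refine LinearMap.ext fun x => ?_
  obtain ⟨x, rfl⟩ := Submodule.Quotient.mk_surjective _ x
  exact congrArg Submodule.Quotient.mk (LinearMap.congr_fun (Cube.sgn_sgn n) x)

lemma sgn_homotopy (s : ℤ) (n : ℕ) :
    sgn k n ∘ₗ homotopy k s n = - (homotopy k s n ∘ₗ sgn k n) := by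
  refine LinearMap.ext fun x => ?_
  obtain ⟨x, rfl⟩ := Submodule.Quotient.mk_surjective _ x
  exact congrArg Submodule.Quotient.mk (LinearMap.congr_fun (Cube.sgn_homotopy s n) x)

lemma face_homotopy (s : ℤ) (n : ℕ) (i : Fin (n + 2)) :
    face k n i ∘ₗ homotopy k s (n + 1) = homotopy k s n ∘ₗ face k n i := by
  refine LinearMap.ext fun x => ?_
  obtain ⟨x, rfl⟩ := Submodule.Quotient.mk_surjective _ x
  exact congrArg Submodule.Quotient.mk (LinearMap.congr_fun (Cube.face_homotopy s i) x)

lemma face_collapse (s : ℤ) (n : ℕ) (i : Fin (n + 2)) :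
    face k n i ∘ₗ collapse k s (n + 1) = collapse k s n ∘ₗ face k n i := by
  refine LinearMap.ext fun x => ?_
  obtain ⟨x, rfl⟩ := Submodule.Quotient.mk_surjective _ x
  exact congrArg Submodule.Quotient.mk (LinearMap.congr_fun (Cube.face_collapse s i) x)

lemma degen_homotopy (s : ℤ) (n : ℕ) (i : Fin (n + 1)) :
    degen k n i ∘ₗ homotopy k s n = homotopy k s (n + 1) ∘ₗ degen k n i := by
  refine LinearMap.ext fun x => ?_
  obtain ⟨x, rfl⟩ := Submodule.Quotient.mk_surjective _ x
  exact congrArg Submodule.Quotient.mk (LinearMap.congr_fun (Cube.degen_homotopy s i) x)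

lemma degen_collapse (s : ℤ) (n : ℕ) (i : Fin (n + 1)) :
    degen k n i ∘ₗ collapse k s n = collapse k s (n + 1) ∘ₗ degen k n i := by
  refine LinearMap.ext fun x => ?_
  obtain ⟨x, rfl⟩ := Submodule.Quotient.mk_surjective _ x
  exact congrArg Submodule.Quotient.mk (LinearMap.congr_fun (Cube.degen_collapse s i) x)

lemma collapse_of (s : ℤ) (f : Word n) :
    collapse k s n (of f) = of fun l => (f l).collapse s :=
  congrArg Submodule.Quotient.mk (Cube.collapse_single s f)

lemma homotopy_of_mem (s : ℤ) (f : Word n) : homotopy k s n (of f) ∈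
    Submodule.span k {x | ∃ g : Word n, (g.supp ⊆ f.supp ∪ {s} ∧ g.deg + 1 = f.deg) ∧
      x = of g} := by
  have h := Submodule.mem_map_of_mem (f := (Cube.vanishing k n).mkQ)
    (Cube.homotopy_single_mem (k := k) s f)
  rw [Submodule.map_span, ← Set.image_comp] at h
  refine Submodule.span_mono ?_ h
  rintro _ ⟨g, hg, rfl⟩
  exact ⟨g, hg.2, rfl⟩

open Classical in
lemma project_of (W : Set ℤ) (f : Word n) :
    project k W n (of f) = if f.supp ⊆ W then of f else 0 := by
  refine (congrArg Submodule.Quotient.mk (Cube.project_single W f)).trans ?_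
  split_ifs <;> rfl

lemma hom_ext {V : Type*} [AddCommGroup V] [Module k V] {φ ψ : Forms k n →ₗ[k] V}
    (h : ∀ f : Word n, φ (of f) = ψ (of f)) : φ = ψ :=
  Submodule.linearMap_qext _ (Finsupp.lhom_ext' fun f => LinearMap.ext_ring (h f))

lemma supp_collapse (s : ℤ) (f : Word n) : Word.supp (fun l => (f l).collapse s) ⊆ {s} :=
  Set.iUnion_subset fun l => Letter.supp_collapse s (f l)

lemma of_mem_supported {f : Word n} {U : Set ℤ} (h : f.supp ⊆ U) : of f ∈ supported k n U :=
  Submodule.subset_span ⟨f, h, rfl⟩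

lemma collapse_of_mem_supported (s : ℤ) (f : Word n) :
    collapse k s n (of f) ∈ supported k n {s} := by
  rw [collapse_of]
  exact of_mem_supported (supp_collapse s f)

lemma homotopy_of_mem_supported (s : ℤ) (f : Word n) :
    homotopy k s n (of f) ∈ supported k n (f.supp ∪ {s}) := by
  refine Submodule.span_mono ?_ (homotopy_of_mem s f)
  rintro _ ⟨g, hg, rfl⟩
  exact ⟨g, hg.1, rfl⟩

lemma collapse_gr (s : ℤ) {j : ℕ} : gr k n j ≤ (gr k n j).comap (collapse k s n) := by
  refine Submodule.span_le.2 ?_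
  rintro _ ⟨f, rfl, rfl⟩
  rw [SetLike.mem_coe, Submodule.mem_comap, collapse_of]
  refine Submodule.subset_span ⟨_, ?_, rfl⟩
  simp only [Word.deg, Letter.deg_collapse]

lemma homotopy_gr (s : ℤ) {j : ℕ} : gr k n (j + 1) ≤ (gr k n j).comap (homotopy k s n) := by
  refine Submodule.span_le.2 ?_
  rintro _ ⟨f, hf, rfl⟩
  refine Submodule.span_mono ?_ (homotopy_of_mem s f)
  rintro _ ⟨g, hg, rfl⟩
  exact ⟨g, by omega, rfl⟩

/-- Any word occurring in the image would have degree one less than `0`, so the span containing the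
image is that of the empty set. -/
lemma homotopy_comp_gr_zero (s : ℤ) : homotopy k s n ∘ₗ (gr k n 0).subtype = 0 := by
  have : gr k n 0 ≤ LinearMap.ker (homotopy k s n) := by
    refine Submodule.span_le.2 ?_
    rintro _ ⟨f, hf, rfl⟩
    have h := homotopy_of_mem (k := k) s f
    rwa [show {x | ∃ g : Word n, (g.supp ⊆ f.supp ∪ {s} ∧ g.deg + 1 = f.deg) ∧
      x = of (k := k) g} = ∅ from Set.eq_empty_of_forall_notMem fun x ⟨g, hg, _⟩ => by omega,
      Submodule.span_empty, Submodule.mem_bot] at h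
  exact LinearMap.ext fun x => this x.2

lemma project_comp_supported {W U : Set ℤ} (h : U ⊆ W) :
    project k W n ∘ₗ (supported k n U).subtype = (supported k n U).subtype := by
  have : supported k n U ≤ LinearMap.ker (project k W n - LinearMap.id) := by
    refine Submodule.span_le.2 ?_
    rintro _ ⟨f, hf, rfl⟩
    simp [project_of, hf.trans h]
  exact LinearMap.ext fun x => sub_eq_zero.1 (this x.2)

lemma project_comp_project {W W' : Set ℤ} (h : W ⊆ W') :
    project k W' n ∘ₗ project k W n = project k W n := by
  refine hom_ext fun f => ?_
  rw [LinearMap.comp_apply, project_of]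
  split_ifs with hf
  · rw [project_of, if_pos (hf.trans h)]
  · rw [map_zero]

lemma tmul_mem_reduced {p q : ℕ} {U V : Set ℤ} (h : Disjoint U V) {x : Forms k p} {y : Forms k q}
    (hx : x ∈ supported k p U) (hy : y ∈ supported k q V) : x ⊗ₜ[k] y ∈ reduced k p q := by
  have h1 : supported k p U ≤ (reduced k p q).comap ((TensorProduct.mk k _ _).flip y) := by
    refine Submodule.span_le.2 ?_
    rintro _ ⟨f, hf, rfl⟩
    have h2 : supported k q V ≤ (reduced k p q).comap (TensorProduct.mk k _ _ (of f)) := by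
      refine Submodule.span_le.2 ?_
      rintro _ ⟨g, hg, rfl⟩
      exact Submodule.subset_span ⟨f, g, h.mono hf hg, rfl⟩
    exact h2 hy
  exact h1 hx

/-- Maps which only add the points `s` and `t`, respectively, to the singular supports preserve the
reduced tensor products, provided the supports are limited to suitable sets. -/
lemma reduced_le_comap_project {p q : ℕ} {s t : ℤ} {W W' : Set ℤ} (hst : s ≠ t) (hs : s ∉ W')
    (ht : t ∉ W) {φ : Forms k p →ₗ[k] Forms k p} {ψ : Forms k q →ₗ[k] Forms k q}
    (hφ : ∀ f, φ (of f) ∈ supported k p (f.supp ∪ {s}))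
    (hψ : ∀ g, ψ (of g) ∈ supported k q (g.supp ∪ {t})) :
    reduced k p q ≤ (reduced k p q).comap
      (TensorProduct.map (φ ∘ₗ project k W p) (ψ ∘ₗ project k W' q)) := by
  refine Submodule.span_le.2 ?_
  rintro _ ⟨f, g, hfg, rfl⟩
  rw [SetLike.mem_coe, Submodule.mem_comap, TensorProduct.map_tmul, LinearMap.comp_apply,
    LinearMap.comp_apply, project_of, project_of]
  by_cases hf : f.supp ⊆ W
  · by_cases hg : g.supp ⊆ W'
    · rw [if_pos hf, if_pos hg]
      refine tmul_mem_reduced ?_ (hφ f) (hψ g)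
      -- Four conditions: the original supports are disjoint, `t ∉ W` keeps `t` off the first, `s ∉
      -- W'` keeps `s` off the second, and `s ≠ t`.
      rw [Set.disjoint_union_left, Set.disjoint_union_right, Set.disjoint_union_right]
      exact ⟨⟨hfg, Set.disjoint_singleton_right.2 fun h => ht (hf h)⟩,
        Set.disjoint_singleton_left.2 fun h => hs (hg h), by simpa using hst⟩
    · simp [hg]
  · simp [hf]

end Forms

/-! ### The collapse and the homotopy on forms with coefficients. -/

section Cosimplicial

variable {k : Type u} [CommRing k]

/-- Compatibility and finiteness follow from naturality. The supports may grow by the point `s`,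
which is harmless because a finite subset of `S` stays one when `s ∈ S` is added. -/
lemma Family.forms_le_comap_of_natural {M : CosimplicialObject (ModuleCat.{v} k)} {S : Set ℤ}
    {s : ℤ} (hs : s ∈ S) (φ : ∀ n, Forms k n →ₗ[k] Forms k n)
    (hface : ∀ n i, Forms.face k n i ∘ₗ φ (n + 1) = φ n ∘ₗ Forms.face k n i)
    (hdegen : ∀ n i, Forms.degen k n i ∘ₗ φ n = φ (n + 1) ∘ₗ Forms.degen k n i)
    (hsupp : ∀ n f, φ n (Forms.of f) ∈ Forms.supported k n (f.supp ∪ {s})) :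
    forms S M ≤ (forms S M).comap (mapForms M φ) := by
  have hdeg (n : ℕ) :
      Forms.degenerate k n ≤ (Forms.degenerate k n).comap (φ (n + 1)) := by
    refine iSup_le fun i => ?_
    rintro _ ⟨x, rfl⟩
    exact Submodule.mem_iSup_of_mem i ⟨φ n x, LinearMap.congr_fun (hdegen n i) x⟩
  rintro θ ⟨⟨h1, ⟨N, h2⟩⟩, ⟨T, hT, h3⟩⟩
  refine ⟨⟨⟨fun n i => ?_, fun n i => ?_⟩, ⟨N, fun n hn => ?_⟩⟩, ⟨T ∪ {s}, ?_, ?_⟩⟩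
  · change LinearMap.rTensor _ _ (LinearMap.lTensor _ (φ n) (θ n)) =
      LinearMap.lTensor _ _ (LinearMap.lTensor _ (φ (n + 1)) (θ (n + 1)))
    rw [← LinearMap.comp_apply (LinearMap.lTensor _ _) (LinearMap.lTensor _ _),
      ← LinearMap.lTensor_comp, hface, LinearMap.lTensor_comp, LinearMap.comp_apply, ← h1.1 n i,
      ← LinearMap.comp_apply, ← LinearMap.comp_apply, LinearMap.rTensor_comp_lTensor,
      LinearMap.lTensor_comp_rTensor]
  · change LinearMap.rTensor _ _ (LinearMap.lTensor _ (φ (n + 1)) (θ (n + 1))) =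
      LinearMap.lTensor _ _ (LinearMap.lTensor _ (φ n) (θ n))
    rw [← LinearMap.comp_apply (LinearMap.lTensor _ _) (LinearMap.lTensor _ _),
      ← LinearMap.lTensor_comp, hdegen, LinearMap.lTensor_comp, LinearMap.comp_apply, ← h1.2 n i,
      ← LinearMap.comp_apply, ← LinearMap.comp_apply, LinearMap.rTensor_comp_lTensor,
      LinearMap.lTensor_comp_rTensor]
  · change LinearMap.lTensor _ _ (LinearMap.lTensor _ (φ (n + 1)) (θ (n + 1))) = 0
    have e : (Forms.degenerate k n).mkQ ∘ₗ φ (n + 1) =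
        Submodule.mapQ _ _ (φ (n + 1)) (hdeg n) ∘ₗ (Forms.degenerate k n).mkQ := rfl
    rw [← LinearMap.comp_apply, ← LinearMap.lTensor_comp, e, LinearMap.lTensor_comp,
      LinearMap.comp_apply, h2 n hn, map_zero]
  · simp only [Finset.coe_union, Finset.coe_singleton]
    exact Set.union_subset hT (Set.singleton_subset_iff.2 hs)
  · refine valuesIn_le_comap (fun n => ?_) h3
    refine Submodule.span_le.2 ?_
    rintro _ ⟨f, hf, rfl⟩
    refine Forms.supported_mono ?_ (hsupp n f)
    simp only [Finset.coe_union, Finset.coe_singleton]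
    exact Set.union_subset_union_left _ hf

namespace formsDG

variable {S : Set ℤ} (M : CosimplicialObject (ModuleCat.{v} k)) {s : ℤ} (hs : s ∈ S)

/-- The endomorphism of `_S D^*(M)` which moves the singular supports to `s ∈ S`. -/
noncomputable def collapse : (formsDG S M).carrier →ₗ[k] (formsDG S M).carrier :=
  (Family.mapForms M (Forms.collapse k s)).restrict (Family.forms_le_comap_of_natural hs _
    (Forms.face_collapse s) (Forms.degen_collapse s) fun _ f =>
      Forms.supported_mono Set.subset_union_right (Forms.collapse_of_mem_supported s f))

/-- The homotopy from the identity of `_S D^*(M)` to `collapse`. -/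
noncomputable def homotopy : (formsDG S M).carrier →ₗ[k] (formsDG S M).carrier :=
  (Family.mapForms M (Forms.homotopy k s)).restrict (Family.forms_le_comap_of_natural hs _
    (Forms.face_homotopy s) (Forms.degen_homotopy s) fun _ => Forms.homotopy_of_mem_supported s)

lemma lTensor_comp_apply {V A B C : Type*} [AddCommMonoid V] [AddCommMonoid A] [AddCommMonoid B]
    [AddCommMonoid C] [Module k V] [Module k A] [Module k B] [Module k C] (g : B →ₗ[k] C)
    (f : A →ₗ[k] B) (x : V ⊗[k] A) :
    LinearMap.lTensor V g (LinearMap.lTensor V f x) = LinearMap.lTensor V (g ∘ₗ f) x := by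
  rw [LinearMap.lTensor_comp, LinearMap.comp_apply]

variable {M}

lemma d_homotopy (θ : (formsDG S M).carrier) : (formsDG S M).d (homotopy M hs θ) +
    homotopy M hs ((formsDG S M).d θ) = θ - collapse M hs θ := by
  refine Subtype.ext (funext fun n => ?_)
  change LinearMap.lTensor _ (Forms.d k n) (LinearMap.lTensor _ (Forms.homotopy k s n) (θ.1 n)) +
    LinearMap.lTensor _ (Forms.homotopy k s n) (LinearMap.lTensor _ (Forms.d k n) (θ.1 n)) =
    θ.1 n - LinearMap.lTensor _ (Forms.collapse k s n) (θ.1 n)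
  rw [lTensor_comp_apply, lTensor_comp_apply, ← LinearMap.add_apply, ← LinearMap.lTensor_add,
    Forms.d_homotopy, LinearMap.lTensor_sub, LinearMap.sub_apply, LinearMap.lTensor_id,
    LinearMap.id_apply]

lemma collapse_d (θ : (formsDG S M).carrier) :
    collapse M hs ((formsDG S M).d θ) = (formsDG S M).d (collapse M hs θ) := by
  refine Subtype.ext (funext fun n => ?_)
  change LinearMap.lTensor _ (Forms.collapse k s n) (LinearMap.lTensor _ (Forms.d k n) (θ.1 n)) =
    LinearMap.lTensor _ (Forms.d k n) (LinearMap.lTensor _ (Forms.collapse k s n) (θ.1 n))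
  rw [lTensor_comp_apply, lTensor_comp_apply, Forms.collapse_d]

lemma collapse_sgn (θ : (formsDG S M).carrier) :
    collapse M hs ((formsDG S M).sgn θ) = (formsDG S M).sgn (collapse M hs θ) := by
  refine Subtype.ext (funext fun n => ?_)
  change LinearMap.lTensor _ (Forms.collapse k s n) (LinearMap.lTensor _ (Forms.sgn k n) (θ.1 n)) =
    LinearMap.lTensor _ (Forms.sgn k n) (LinearMap.lTensor _ (Forms.collapse k s n) (θ.1 n))
  rw [lTensor_comp_apply, lTensor_comp_apply, Forms.collapse_sgn]

lemma sgn_sgn (θ : (formsDG S M).carrier) :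
    (formsDG S M).sgn ((formsDG S M).sgn θ) = θ := by
  refine Subtype.ext (funext fun n => ?_)
  change LinearMap.lTensor _ (Forms.sgn k n) (LinearMap.lTensor _ (Forms.sgn k n) (θ.1 n)) = θ.1 n
  rw [lTensor_comp_apply, Forms.sgn_sgn, LinearMap.lTensor_id, LinearMap.id_apply]

lemma sgn_homotopy (θ : (formsDG S M).carrier) :
    (formsDG S M).sgn (homotopy M hs θ) = - homotopy M hs ((formsDG S M).sgn θ) := by
  refine Subtype.ext (funext fun n => ?_)
  change LinearMap.lTensor _ (Forms.sgn k n) (LinearMap.lTensor _ (Forms.homotopy k s n) (θ.1 n)) =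
    - LinearMap.lTensor _ (Forms.homotopy k s n) (LinearMap.lTensor _ (Forms.sgn k n) (θ.1 n))
  rw [lTensor_comp_apply, lTensor_comp_apply, Forms.sgn_homotopy, LinearMap.lTensor_neg,
    LinearMap.neg_apply]

lemma collapse_mem_gr {j : ℕ} {θ : (formsDG S M).carrier} (h : θ ∈ (formsDG S M).gr j) :
    collapse M hs θ ∈ (formsDG S M).gr j :=
  Family.valuesIn_le_comap (fun _ => Forms.collapse_gr s) h

lemma homotopy_mem_gr {j : ℕ} {θ : (formsDG S M).carrier} (h : θ ∈ (formsDG S M).gr (j + 1)) :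
    homotopy M hs θ ∈ (formsDG S M).gr j :=
  Family.valuesIn_le_comap (fun _ => Forms.homotopy_gr s) h

lemma homotopy_eq_zero {θ : (formsDG S M).carrier} (h : θ ∈ (formsDG S M).gr 0) :
    homotopy M hs θ = 0 := by
  refine Subtype.ext (funext fun n => ?_)
  obtain ⟨y, hy⟩ := h n
  change LinearMap.lTensor _ (Forms.homotopy k s n) (θ.1 n) = 0
  change LinearMap.lTensor _ (Forms.gr k n 0).subtype y = θ.1 n at hy
  rw [← hy, lTensor_comp_apply, Forms.homotopy_comp_gr_zero, LinearMap.lTensor_zero,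
    LinearMap.zero_apply]

variable (S M) in
/-- The forms in `_S D^*(M)` with singular support in `W`. -/
noncomputable def supportedIn (W : Set ℤ) : Submodule k (formsDG S M).carrier where
  -- The support condition is an equation with a projector: the projector can then be inserted in
  -- front of any map, without intersecting images inside a tensor product.
  carrier := {θ | ∀ n, LinearMap.lTensor _ (Forms.project k W n) (θ.1 n) = θ.1 n}
  add_mem' {a b} ha hb n := by
    change LinearMap.lTensor _ (Forms.project k W n) (a.1 n + b.1 n) = a.1 n + b.1 n
    rw [map_add, ha n, hb n]
  zero_mem' n := map_zero _
  smul_mem' c a ha n := by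
    change LinearMap.lTensor _ (Forms.project k W n) (c • a.1 n) = c • a.1 n
    rw [map_smul, ha n]

lemma supportedIn_mono {W W' : Set ℤ} (h : W ⊆ W') : supportedIn S M W ≤ supportedIn S M W' := by
  intro θ hθ n
  rw [← hθ n, lTensor_comp_apply, Forms.project_comp_project h]

lemma exists_mem_supportedIn (θ : (formsDG S M).carrier) :
    ∃ W : Finset ℤ, ↑W ⊆ S ∧ θ ∈ supportedIn S M W := by
  obtain ⟨θ, -, W, hW, hθ⟩ := θ
  refine ⟨W, hW, fun n => ?_⟩
  obtain ⟨y, hy⟩ := hθ n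
  change LinearMap.lTensor _ (Forms.project k W n) (θ n) = θ n
  change LinearMap.lTensor _ (Forms.supported k n W).subtype y = θ n at hy
  rw [← hy, lTensor_comp_apply, Forms.project_comp_supported le_rfl]

end formsDG

/-! ### Supports in a tensor product of two factors. -/

section Reduced

variable {S T : Set ℤ} {M : CosimplicialObject (ModuleCat.{v} k)}
  {N : CosimplicialObject (ModuleCat.{w} k)}

/-- The sources `L` and `L'` are arbitrary so that the statement applies to the submodules
`supportedIn`, on which a formwise map may be precomposed with a projector. -/
lemma component_map {L L' : Type*} [AddCommGroup L] [Module k L] [AddCommGroup L'] [Module k L']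
    {p q : ℕ} {φ : Forms k p →ₗ[k] Forms k p} {ψ : Forms k q →ₗ[k] Forms k q}
    (a f : L →ₗ[k] (formsDG S M).carrier) (b g : L' →ₗ[k] (formsDG T N).carrier)
    (hf : ∀ x, (f x).1 p = LinearMap.lTensor _ φ ((a x).1 p))
    (hg : ∀ y, (g y).1 q = LinearMap.lTensor _ ψ ((b y).1 q)) (z : L ⊗[k] L') :
    component S T M N p q (TensorProduct.map f g z) =
      LinearMap.lTensor _ (TensorProduct.map φ ψ)
        (component S T M N p q (TensorProduct.map a b z)) := by
  induction z with
  | zero => simp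
  | add z z' h h' => simp only [map_add, h, h']
  | tmul x y =>
    change TensorProduct.tensorTensorTensorComm k _ _ _ _ ((f x).1 p ⊗ₜ (g y).1 q) =
      LinearMap.lTensor _ _
        (TensorProduct.tensorTensorTensorComm k _ _ _ _ ((a x).1 p ⊗ₜ (b y).1 q))
    rw [hf, hg]
    generalize (a x).1 p = α
    generalize (b y).1 q = β
    induction α with
    | zero => simp
    | add α α' hα hα' => simp only [map_add, TensorProduct.add_tmul, hα, hα']
    | tmul m α =>
      induction β with
      | zero => simp
      | add β β' hβ hβ' => simp only [map_add, TensorProduct.tmul_add, hβ, hβ']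
      | tmul n β => simp

variable (S T M N) in
/-- The span of the `θ ⊗ θ'` where the singular supports of `θ` and `θ'` lie in `W` and `W'`
respectively. -/
noncomputable def pairSupported (W W' : Set ℤ) :
    Submodule k ((formsDG S M).carrier ⊗[k] (formsDG T N).carrier) :=
  LinearMap.range (TensorProduct.map (formsDG.supportedIn S M W).subtype
    (formsDG.supportedIn T N W').subtype)

lemma pairSupported_mono {W W₁ W' W₁' : Set ℤ} (h : W ⊆ W₁) (h' : W' ⊆ W₁') :
    pairSupported S T M N W W' ≤ pairSupported S T M N W₁ W₁' :=
  TensorProduct.range_mapIncl_mono (formsDG.supportedIn_mono h) (formsDG.supportedIn_mono h')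

/-- A tensor is a finite sum of pure tensors, and each factor has its supports in a finite set by
definition of the direct limit. -/
lemma exists_mem_pairSupported (z : (formsDG S M).carrier ⊗[k] (formsDG T N).carrier) :
    ∃ W W' : Finset ℤ, ↑W ⊆ S ∧ ↑W' ⊆ T ∧ z ∈ pairSupported S T M N W W' := by
  classical
  induction z with
  | zero => exact ⟨∅, ∅, by simp, by simp, Submodule.zero_mem _⟩
  | add z z' h h' =>
    obtain ⟨W, W', h1, h2, h3⟩ := h
    obtain ⟨W₁, W₁', h1', h2', h3'⟩ := h'
    refine ⟨W ∪ W₁, W' ∪ W₁', by simp [h1, h1'], by simp [h2, h2'], Submodule.add_mem _ ?_ ?_⟩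
    · exact pairSupported_mono (by simp) (by simp) h3
    · exact pairSupported_mono (by simp) (by simp) h3'
  | tmul θ θ' =>
    obtain ⟨W, hW, hθ⟩ := formsDG.exists_mem_supportedIn θ
    obtain ⟨W', hW', hθ'⟩ := formsDG.exists_mem_supportedIn θ'
    exact ⟨W, W', hW, hW', ⟨⟨θ, hθ⟩ ⊗ₜ ⟨θ', hθ'⟩, rfl⟩⟩

lemma pairSupported_eq_top : pairSupported S T M N S T = ⊤ := by
  refine eq_top_iff.2 fun z _ => ?_
  obtain ⟨W, W', h, h', hz⟩ := exists_mem_pairSupported z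
  exact pairSupported_mono h h' hz

/-- On elements supported in `W` and `W'`, the maps `f` and `g` agree with those induced by `φ` and
`ψ` preceded by projectors. Those modified maps send the whole of `Forms.reduced` to itself, by
`Forms.reduced_le_comap_project`. -/
lemma map_mem_reduced {s t : ℤ} {W W' : Set ℤ} (hst : s ≠ t) (hs : s ∉ W') (ht : t ∉ W)
    {φ ψ : ∀ n, Forms k n →ₗ[k] Forms k n}
    (hφ : ∀ n f, φ n (Forms.of f) ∈ Forms.supported k n (f.supp ∪ {s}))
    (hψ : ∀ n g, ψ n (Forms.of g) ∈ Forms.supported k n (g.supp ∪ {t}))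
    (f : (formsDG S M).carrier →ₗ[k] (formsDG S M).carrier)
    (g : (formsDG T N).carrier →ₗ[k] (formsDG T N).carrier)
    (hf : ∀ θ n, (f θ).1 n = LinearMap.lTensor _ (φ n) (θ.1 n))
    (hg : ∀ θ n, (g θ).1 n = LinearMap.lTensor _ (ψ n) (θ.1 n))
    {z : (formsDG S M).carrier ⊗[k] (formsDG T N).carrier} (hz : z ∈ reduced S T M N)
    (hz' : z ∈ pairSupported S T M N W W') : TensorProduct.map f g z ∈ reduced S T M N := by
  obtain ⟨z, rfl⟩ := hz'
  simp only [reduced, Submodule.mem_comap, Submodule.mem_iInf] at hz ⊢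
  intro p q
  obtain ⟨y, hy⟩ := hz p q
  have h := Forms.reduced_le_comap_project hst hs ht (hφ p) (hψ q)
  -- The preimage `y` witnesses that the component is reduced; its transform by the modified maps is
  -- the new witness.
  refine ⟨LinearMap.lTensor _ ((TensorProduct.map (φ p ∘ₗ Forms.project k W p)
    (ψ q ∘ₗ Forms.project k W' q)).restrict h) y, ?_⟩
  rw [← LinearMap.comp_apply (TensorProduct.map f g), ← TensorProduct.map_comp,
    component_map (φ := φ p ∘ₗ Forms.project k W p) (ψ := ψ q ∘ₗ Forms.project k W' q)
      (formsDG.supportedIn S M W).subtype (f ∘ₗ (formsDG.supportedIn S M W).subtype)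
      (formsDG.supportedIn T N W').subtype (g ∘ₗ (formsDG.supportedIn T N W').subtype)
      (fun x => ?_) (fun x => ?_) z, ← hy, formsDG.lTensor_comp_apply,
    formsDG.lTensor_comp_apply]
  · rfl
  · rw [← formsDG.lTensor_comp_apply]
    exact (hf x.1 p).trans (congrArg _ (x.2 p).symm)
  · rw [← formsDG.lTensor_comp_apply]
    exact (hg x.1 q).trans (congrArg _ (x.2 q).symm)

/-- After the collapse, the two factors are supported in `{s}` and `{t}`, which are disjoint. No
condition on `z` is needed. -/
lemma collapse_mem_reduced {s t : ℤ} (hs : s ∈ S) (ht : t ∈ T) (hst : s ≠ t)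
    (z : (formsDG S M).carrier ⊗[k] (formsDG T N).carrier) :
    TensorProduct.map (formsDG.collapse M hs) (formsDG.collapse N ht) z ∈ reduced S T M N := by
  simp only [reduced, Submodule.mem_comap, Submodule.mem_iInf]
  intro p q
  have h (y) : TensorProduct.map (Forms.collapse k s p) (Forms.collapse k t q) y ∈
      Forms.reduced k p q := by
    suffices ⊤ ≤ (Forms.reduced k p q).comap
        (TensorProduct.map (Forms.collapse k s p) (Forms.collapse k t q)) from this trivial
    rw [← TensorProduct.span_tmul_eq_top]
    refine Submodule.span_le.2 ?_
    rintro _ ⟨x, y, rfl⟩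
    have key (n : ℕ) (s : ℤ) (x : Forms k n) :
        Forms.collapse k s n x ∈ Forms.supported k n {s} := by
      obtain ⟨x, rfl⟩ := Submodule.Quotient.mk_surjective _ x
      induction x using Finsupp.induction_linear with
      | zero => exact (map_zero (Forms.collapse k s n)).symm ▸ Submodule.zero_mem _
      | add x y hx hy =>
        rw [Submodule.Quotient.mk_add, map_add]
        exact Submodule.add_mem _ hx hy
      | single f c =>
        rw [← mul_one c, ← smul_eq_mul, ← Finsupp.smul_single, Submodule.Quotient.mk_smul, map_smul]
        exact Submodule.smul_mem _ _ (Forms.collapse_of_mem_supported s f)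
    exact Forms.tmul_mem_reduced (Set.disjoint_singleton.2 hst) (key p s x) (key q t y)
  refine ⟨LinearMap.lTensor _ (LinearMap.codRestrict (Forms.reduced k p q) _ h)
    (component S T M N p q z), ?_⟩
  have e := component_map (p := p) (q := q) LinearMap.id (formsDG.collapse M hs) LinearMap.id
    (formsDG.collapse N ht) (fun _ => rfl) (fun _ => rfl) z
  rw [TensorProduct.map_id, LinearMap.id_apply] at e
  rw [e, formsDG.lTensor_comp_apply]
  rfl

end Reduced

end Cosimplicial

end QuasiCommutative

namespace QuasiCommutative

/-! ### Tensor products of deformations of differential graded modules. -/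

namespace DGModule

variable {k : Type u} [CommRing k]

/-- A homotopy `η` from the identity of a differential graded module to an endomorphism `ρ`. -/
structure Deformation (A : DGModule.{u, v} k) where
  ρ : A.carrier →ₗ[k] A.carrier
  η : A.carrier →ₗ[k] A.carrier
  sgn_sgn : ∀ x, A.sgn (A.sgn x) = x
  sgn_η : ∀ x, A.sgn (η x) = - η (A.sgn x)
  ρ_sgn : ∀ x, ρ (A.sgn x) = A.sgn (ρ x)
  ρ_d : ∀ x, ρ (A.d x) = A.d (ρ x)
  d_η : ∀ x, A.d (η x) + η (A.d x) = x - ρ x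
  ρ_gr : ∀ n, ∀ x ∈ A.gr n, ρ x ∈ A.gr n
  η_gr : ∀ n, ∀ x ∈ A.gr (n + 1), η x ∈ A.gr n
  -- Degrees are natural numbers, so lowering the degree from `0` must be stated as vanishing.
  η_gr_zero : ∀ x ∈ A.gr 0, η x = 0

lemma sgn_mem_gr (A : DGModule.{u, v} k) {n : ℕ} {x : A.carrier} (h : x ∈ A.gr n) :
    A.sgn x ∈ A.gr n := by
  rw [A.sgn_gr n x h]
  exact Submodule.smul_mem _ _ h

namespace Deformation

section Tensor

variable {A : DGModule.{u, v} k} {B : DGModule.{u, w} k} (D : Deformation A) (E : Deformation B)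

/-- The tensor product of two homotopies. -/
noncomputable def tensorη : A.carrier ⊗[k] B.carrier →ₗ[k] A.carrier ⊗[k] B.carrier :=
  TensorProduct.map D.η LinearMap.id + TensorProduct.map (A.sgn ∘ₗ D.ρ) E.η

lemma tensorη_tmul (a : A.carrier) (b : B.carrier) :
    tensorη D E (a ⊗ₜ b) = D.η a ⊗ₜ b + A.sgn (D.ρ a) ⊗ₜ E.η b := rfl

variable (A B) in
/-- The differential of the tensor product. -/
noncomputable def tensorD : A.carrier ⊗[k] B.carrier →ₗ[k] A.carrier ⊗[k] B.carrier :=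
  TensorProduct.map A.d LinearMap.id + TensorProduct.map A.sgn B.d

lemma tensorD_tmul (a : A.carrier) (b : B.carrier) :
    tensorD A B (a ⊗ₜ b) = A.d a ⊗ₜ b + A.sgn a ⊗ₜ B.d b := rfl

/-- The cross terms cancel because `sgn` anticommutes with `D.η` and with `d`. What remains is `(a -
ρ a) ⊗ b + ρ a ⊗ (b - ρ b)`, which telescopes. -/
lemma tensor_d_η (x : A.carrier ⊗[k] B.carrier) :
    tensorD A B (tensorη D E x) + tensorη D E (tensorD A B x) =
      x - TensorProduct.map D.ρ E.ρ x := by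
  induction x with
  | zero => simp
  | add x y hx hy =>
    simp only [map_add] at hx hy ⊢
    rw [add_sub_add_comm, ← hx, ← hy]
    abel
  | tmul a b =>
    have e1 : A.d (D.η a) = a - D.ρ a - D.η (A.d a) := eq_sub_of_add_eq (D.d_η a)
    have e2 : B.d (E.η b) = b - E.ρ b - E.η (B.d b) := eq_sub_of_add_eq (E.d_η b)
    simp only [tensorD_tmul, TensorProduct.map_tmul, tensorη_tmul, map_add,
      D.sgn_η, D.sgn_sgn, D.ρ_d, A.sgn_d, D.ρ_sgn, e1, e2, TensorProduct.sub_tmul,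
      TensorProduct.tmul_sub, TensorProduct.neg_tmul]
    abel

lemma tensor_ρ_gr (n : ℕ) (x : A.carrier ⊗[k] B.carrier) (hx : x ∈ (A.tensor B).gr n) :
    TensorProduct.map D.ρ E.ρ x ∈ (A.tensor B).gr n := by
  suffices (A.tensor B).gr n ≤ ((A.tensor B).gr n).comap (TensorProduct.map D.ρ E.ρ) from this hx
  refine Submodule.span_le.2 ?_
  rintro _ ⟨i, j, rfl, a, ha, b, hb, rfl⟩
  exact Submodule.subset_span ⟨i, j, rfl, _, D.ρ_gr i a ha, _, E.ρ_gr j b hb, rfl⟩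

lemma tensor_η_gr (n : ℕ) (x : A.carrier ⊗[k] B.carrier) (hx : x ∈ (A.tensor B).gr (n + 1)) :
    tensorη D E x ∈ (A.tensor B).gr n := by
  suffices (A.tensor B).gr (n + 1) ≤ ((A.tensor B).gr n).comap (tensorη D E) from this hx
  refine Submodule.span_le.2 ?_
  rintro _ ⟨i, j, hij, a, ha, b, hb, rfl⟩
  change tensorη D E (a ⊗ₜ b) ∈ (A.tensor B).gr n
  rw [tensorη_tmul]
  refine Submodule.add_mem _ ?_ ?_
  · cases i with
    | zero => rw [D.η_gr_zero a ha, TensorProduct.zero_tmul]; exact Submodule.zero_mem _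
    | succ i =>
      exact Submodule.subset_span ⟨i, j, by omega, _, D.η_gr i a ha, b, hb, rfl⟩
  · cases j with
    | zero => rw [E.η_gr_zero b hb, TensorProduct.tmul_zero]; exact Submodule.zero_mem _
    | succ j =>
      exact Submodule.subset_span ⟨i, j, by omega, _, A.sgn_mem_gr (D.ρ_gr i a ha), _,
        E.η_gr j b hb, rfl⟩

lemma tensor_η_gr_zero (x : A.carrier ⊗[k] B.carrier) (hx : x ∈ (A.tensor B).gr 0) :
    tensorη D E x = 0 := by
  suffices (A.tensor B).gr 0 ≤ LinearMap.ker (tensorη D E) from this hx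
  refine Submodule.span_le.2 ?_
  rintro _ ⟨i, j, hij, a, ha, b, hb, rfl⟩
  obtain ⟨rfl, rfl⟩ : i = 0 ∧ j = 0 := by omega
  change tensorη D E (a ⊗ₜ b) = 0
  rw [tensorη_tmul, D.η_gr_zero a ha, E.η_gr_zero b hb, TensorProduct.zero_tmul,
    TensorProduct.tmul_zero, add_zero]

end Tensor

section Pi

variable {r : ℕ} {A : Fin r → DGModule.{u, v} k} (D : ∀ i, Deformation (A i))

/-- The term at place `i` of the tensor product of a family of homotopies. -/
noncomputable def piAtη (i l : Fin r) : (A l).carrier →ₗ[k] (A l).carrier :=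
  staircase (fun l => (A l).sgn ∘ₗ (D l).ρ) (fun l => (D l).η) i l

/-- The tensor product of a family of homotopies. -/
noncomputable def piη : (PiTensorProduct k fun i => (A i).carrier) →ₗ[k]
    PiTensorProduct k fun i => (A i).carrier :=
  ∑ i, PiTensorProduct.map (piAtη D i)

/-- The tensor product of a family of endomorphisms. -/
noncomputable def piρ : (PiTensorProduct k fun i => (A i).carrier) →ₗ[k]
    PiTensorProduct k fun i => (A i).carrier :=
  PiTensorProduct.map fun i => (D i).ρ

variable (A) in
/-- The differential of the tensor product. -/
noncomputable def piD : (PiTensorProduct k fun i => (A i).carrier) →ₗ[k]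
    PiTensorProduct k fun i => (A i).carrier :=
  ∑ i, PiTensorProduct.map (piAt A i)

/-- This is `sum_staircase_comm` for the universal multilinear map, the same identity that gives the
homotopy on the cubes. -/
lemma pi_d_η (x : PiTensorProduct k fun i => (A i).carrier) :
    piD A (piη D x) + piη D (piD A x) = x - piρ D x := by
  have : piD A ∘ₗ piη D + piη D ∘ₗ piD A = LinearMap.id - piρ D := by
    refine PiTensorProduct.ext (MultilinearMap.ext fun a => ?_)
    have h := sum_staircase_comm (PiTensorProduct.tprod k) (fun i => (A i).sgn)
      (fun i => (A i).d) (fun i => (D i).ρ) (fun i => (D i).η) (fun i => (D i).sgn_sgn)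
      (fun i => (A i).sgn_d) (fun i => (D i).sgn_η) (fun i => (D i).ρ_sgn) (fun i => (D i).ρ_d)
      (fun i => (D i).d_η) a
    simp only [LinearMap.compMultilinearMap_apply, LinearMap.add_apply, LinearMap.comp_apply,
      LinearMap.sum_apply, piD, piη, piρ, PiTensorProduct.map_tprod, map_sum, LinearMap.sub_apply,
      LinearMap.id_apply]
    exact h
  exact LinearMap.congr_fun this x

lemma pi_ρ_gr (n : ℕ) (x : PiTensorProduct k fun i => (A i).carrier)
    (hx : x ∈ (DGModule.pi A).gr n) : piρ D x ∈ (DGModule.pi A).gr n := by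
  suffices (DGModule.pi A).gr n ≤ ((DGModule.pi A).gr n).comap (piρ D) from this hx
  refine Submodule.span_le.2 ?_
  rintro _ ⟨e, a, he, ha, rfl⟩
  change piρ D (PiTensorProduct.tprod k a) ∈ (DGModule.pi A).gr n
  rw [piρ, PiTensorProduct.map_tprod]
  exact Submodule.subset_span (M := PiTensorProduct k fun i => (A i).carrier)
    ⟨e, _, he, fun i => (D i).ρ_gr _ _ (ha i), rfl⟩

lemma pi_η_gr (n : ℕ) (x : PiTensorProduct k fun i => (A i).carrier)
    (hx : x ∈ (DGModule.pi A).gr (n + 1)) : piη D x ∈ (DGModule.pi A).gr n := by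
  suffices (DGModule.pi A).gr (n + 1) ≤ ((DGModule.pi A).gr n).comap (piη D) from this hx
  refine Submodule.span_le.2 ?_
  rintro _ ⟨e, a, he, ha, rfl⟩
  change piη D (PiTensorProduct.tprod k a) ∈ (DGModule.pi A).gr n
  rw [piη, LinearMap.sum_apply]
  refine Submodule.sum_mem _ fun i _ => ?_
  rw [PiTensorProduct.map_tprod]
  -- If the factor at place `i` has degree `0`, the term vanishes. Otherwise its degree is lowered
  -- by one and the other degrees are kept.
  rcases h : e i with _ | m
  · have h0 : (D i).η (a i) = 0 := (D i).η_gr_zero _ (h ▸ ha i)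
    rw [MultilinearMap.map_coord_zero _ i (by rw [piAtη, staircase_self, h0])]
    exact Submodule.zero_mem _
  · refine Submodule.subset_span ⟨Function.update e i m, _, ?_, fun l => ?_, rfl⟩
    · rw [← Finset.add_sum_erase _ _ (Finset.mem_univ i)] at he ⊢
      have : ∑ l ∈ Finset.univ.erase i, Function.update e i m l =
          ∑ l ∈ Finset.univ.erase i, e l := Finset.sum_congr rfl fun l hl =>
        Function.update_of_ne (Finset.ne_of_mem_erase hl) m e
      rw [Function.update_self, this]
      omega
    · rcases lt_trichotomy l i with hl | rfl | hl
      · rw [piAtη, staircase_of_lt _ _ hl, Function.update_of_ne hl.ne]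
        exact (A l).sgn_mem_gr ((D l).ρ_gr _ _ (ha l))
      · rw [piAtη, staircase_self, Function.update_self]
        exact (D l).η_gr _ _ (h ▸ ha l)
      · rw [piAtη, staircase_of_gt _ _ hl, Function.update_of_ne hl.ne']
        exact ha l

lemma pi_η_gr_zero (x : PiTensorProduct k fun i => (A i).carrier)
    (hx : x ∈ (DGModule.pi A).gr 0) : piη D x = 0 := by
  suffices (DGModule.pi A).gr 0 ≤ LinearMap.ker (piη D) from this hx
  refine Submodule.span_le.2 ?_
  rintro _ ⟨e, a, he, ha, rfl⟩
  change piη D (PiTensorProduct.tprod k a) = 0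
  rw [piη, LinearMap.sum_apply]
  refine Finset.sum_eq_zero fun i _ => ?_
  have h : e i = 0 := Finset.sum_eq_zero_iff.1 he i (Finset.mem_univ i)
  have h0 : (D i).η (a i) = 0 := (D i).η_gr_zero _ (h ▸ ha i)
  rw [PiTensorProduct.map_tprod]
  exact MultilinearMap.map_coord_zero _ i (by rw [piAtη, staircase_self, h0])

end Pi

end Deformation

end DGModule

/-! ### The quasi-isomorphism for two factors. -/

section Cosimplicial

variable {k : Type u} [CommRing k]

namespace formsDG

variable {S : Set ℤ} {M : CosimplicialObject (ModuleCat.{v} k)} {s : ℤ}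

/-- The deformation of `_S D^*(M)` which moves the singular supports to `s`. -/
noncomputable def deformation (M : CosimplicialObject (ModuleCat.{v} k)) (hs : s ∈ S) :
    DGModule.Deformation (formsDG S M) where
  ρ := collapse M hs
  η := homotopy M hs
  sgn_sgn := sgn_sgn
  sgn_η := sgn_homotopy hs
  ρ_sgn := collapse_sgn hs
  ρ_d := collapse_d hs
  d_η := d_homotopy hs
  ρ_gr _ _ h := collapse_mem_gr hs h
  η_gr _ _ h := homotopy_mem_gr hs h
  η_gr_zero _ h := homotopy_eq_zero hs h

/-- The endomorphisms of `_S D^*(M)` induced by maps between the modules of forms on the simplices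
which only add the point `s` to the singular supports. -/
def IsFormwise (s : ℤ) (f : (formsDG S M).carrier →ₗ[k] (formsDG S M).carrier) : Prop :=
  ∃ φ : ∀ n, Forms k n →ₗ[k] Forms k n,
    (∀ n f, φ n (Forms.of f) ∈ Forms.supported k n (f.supp ∪ {s})) ∧
    ∀ θ n, (f θ).1 n = LinearMap.lTensor _ (φ n) (θ.1 n)

lemma isFormwise_id : IsFormwise s (LinearMap.id : (formsDG S M).carrier →ₗ[k] _) :=
  ⟨fun _ => LinearMap.id, fun _ _ => Forms.of_mem_supported Set.subset_union_left,
    fun θ n => by rw [LinearMap.lTensor_id]; rfl⟩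

lemma isFormwise_homotopy (hs : s ∈ S) : IsFormwise s (homotopy M hs) :=
  ⟨_, fun _ => Forms.homotopy_of_mem_supported s, fun _ _ => rfl⟩

lemma isFormwise_sgn_collapse (hs : s ∈ S) :
    IsFormwise s ((formsDG S M).sgn ∘ₗ collapse M hs) :=
  ⟨fun n => Forms.sgn k n ∘ₗ Forms.collapse k s n,
    fun _ f => Forms.supported_sgn
      (Forms.supported_mono Set.subset_union_right (Forms.collapse_of_mem_supported s f)),
    fun θ n => lTensor_comp_apply (Forms.sgn k n) (Forms.collapse k s n) (θ.1 n)⟩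

end formsDG

lemma IsFormwise.map_mem_reduced {S T : Set ℤ} {M : CosimplicialObject (ModuleCat.{v} k)}
    {N : CosimplicialObject (ModuleCat.{w} k)} {s t : ℤ} {W W' : Set ℤ} (hst : s ≠ t)
    (hs : s ∉ W') (ht : t ∉ W) {f : (formsDG S M).carrier →ₗ[k] (formsDG S M).carrier}
    {g : (formsDG T N).carrier →ₗ[k] (formsDG T N).carrier} (hf : formsDG.IsFormwise s f)
    (hg : formsDG.IsFormwise t g) {z : (formsDG S M).carrier ⊗[k] (formsDG T N).carrier}
    (hz : z ∈ reduced S T M N) (hz' : z ∈ pairSupported S T M N W W') :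
    TensorProduct.map f g z ∈ reduced S T M N := by
  obtain ⟨φ, hφ, hf⟩ := hf
  obtain ⟨ψ, hψ, hg⟩ := hg
  exact QuasiCommutative.map_mem_reduced hst hs ht hφ hψ f g hf hg hz hz'

/-- The inclusion of the reduced tensor product of two differential graded modules of forms is a
quasi-isomorphism when the sets of singular supports are transversal. -/
theorem quasiIso_reducedInclusion {S T : Set ℤ} (h : Transversal S T)
    (M : CosimplicialObject (ModuleCat.{v} k)) (N : CosimplicialObject (ModuleCat.{w} k)) :
    QuasiIso (reducedInclusion S T M N) := by
  obtain ⟨⟨s, hs, hs'⟩, ⟨t, ht, ht'⟩⟩ := h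
  have hst : s ≠ t := fun e => hs' (e ▸ ht)
  let D := formsDG.deformation M hs
  let E := formsDG.deformation N ht
  refine DGModule.quasiIso_inclusion _ _ _ fun z hz => ⟨TensorProduct.map D.ρ E.ρ, D.tensorη E,
    D.tensor_d_η E, D.tensor_ρ_gr E, D.tensor_η_gr E, D.tensor_η_gr_zero E,
    collapse_mem_reduced hs ht hst, ?_⟩
  -- Supports always lie in `S` and `T`, so these serve as the bounding sets. The conditions on the
  -- points become `s ∉ T` and `t ∉ S`.
  have hz' : z ∈ pairSupported S T M N S T := by rw [pairSupported_eq_top]; trivial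
  refine Submodule.add_mem _ ?_ ?_
  · exact IsFormwise.map_mem_reduced hst hs' ht' (formsDG.isFormwise_homotopy hs)
      formsDG.isFormwise_id hz hz'
  · exact IsFormwise.map_mem_reduced hst hs' ht' (formsDG.isFormwise_sgn_collapse hs)
      (formsDG.isFormwise_homotopy ht) hz hz'

/-! ### The quasi-isomorphisms for finitely many factors. -/

section PiReduced

variable {r : ℕ} {S : Fin r → Set ℤ} {M : Fin r → CosimplicialObject (ModuleCat.{v} k)}

lemma mem_piReduced {z : PiTensorProduct k fun l => (formsDG (S l) (M l)).carrier} :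
    z ∈ piReduced S M ↔ ∀ i j (hij : i ≠ j), z ∈ pairReduced S M hij := by
  simp only [piReduced, Submodule.mem_iInf]

variable (S M) in
/-- The part of `pairReduced` coming from the elements of the reduced tensor product of the factors `i`
and `j` with singular supports in `W i` and `W j` respectively. -/
noncomputable def pairReducedIn (W : Fin r → Set ℤ) {i j : Fin r} (hij : i ≠ j) :
    Submodule k (PiTensorProduct k fun l => (formsDG (S l) (M l)).carrier) :=
  ⨆ x : ∀ l, (formsDG (S l) (M l)).carrier,
    (reduced (S i) (S j) (M i) (M j) ⊓ pairSupported (S i) (S j) (M i) (M j) (W i) (W j)).map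
      (insertPair (fun l => formsDG (S l) (M l)) hij x)

lemma pairReducedIn_mono {W W' : Fin r → Set ℤ} (h : ∀ i, W i ⊆ W' i) {i j : Fin r}
    (hij : i ≠ j) : pairReducedIn S M W hij ≤ pairReducedIn S M W' hij :=
  iSup_mono fun _ => Submodule.map_mono (inf_le_inf_left _ (pairSupported_mono (h i) (h j)))

lemma pairReducedIn_self {i j : Fin r} (hij : i ≠ j) :
    pairReducedIn S M S hij = pairReduced S M hij := by
  simp only [pairReducedIn, pairReduced, pairSupported_eq_top, inf_top_eq]

/-- An element of the supremum is a finite sum, and each term involves finitely many singular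
points. This finiteness permits choosing the points of the collapse after `z`. -/
lemma exists_mem_pairReducedIn {i j : Fin r} (hij : i ≠ j)
    {z : PiTensorProduct k fun l => (formsDG (S l) (M l)).carrier}
    (hz : z ∈ pairReduced S M hij) :
    ∃ F : Finset ℤ, z ∈ pairReducedIn S M (fun _ => F) hij := by
  classical
  refine Submodule.iSup_induction _ (motive := fun z => ∃ F : Finset ℤ,
    z ∈ pairReducedIn S M (fun _ => F) hij) hz ?_ ⟨∅, Submodule.zero_mem _⟩ ?_
  · rintro x _ ⟨y, hy, rfl⟩
    obtain ⟨W, W', -, -, h⟩ := exists_mem_pairSupported y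
    exact ⟨W ∪ W', Submodule.mem_iSup_of_mem x
      ⟨y, ⟨hy, pairSupported_mono (by simp) (by simp) h⟩, rfl⟩⟩
  · rintro z z' ⟨F, hF⟩ ⟨F', hF'⟩
    exact ⟨F ∪ F', Submodule.add_mem _ (pairReducedIn_mono (fun _ => by simp) hij hF)
      (pairReducedIn_mono (fun _ => by simp) hij hF')⟩

/-- On a pure tensor, any two factors are collapsed to distinct points, and the other factors merely
fill the remaining places of `insertPair`. -/
lemma piρ_mem_piReduced {s : Fin r → ℤ} (hs : ∀ i, s i ∈ S i) (hinj : s.Injective)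
    (x : PiTensorProduct k fun l => (formsDG (S l) (M l)).carrier) :
    DGModule.Deformation.piρ (fun i => formsDG.deformation (M i) (hs i)) x ∈ piReduced S M := by
  refine mem_piReduced.2 fun i j hij => ?_
  induction x using PiTensorProduct.induction_on with
  | smul_tprod c a =>
    rw [map_smul]
    refine Submodule.smul_mem _ _
      (Submodule.mem_iSup_of_mem (fun l => formsDG.collapse (M l) (hs l) (a l))
        ⟨_, collapse_mem_reduced (hs i) (hs j) (hinj.ne hij) (a i ⊗ₜ a j), ?_⟩)
    rw [DGModule.Deformation.piρ, PiTensorProduct.map_tprod]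
    have e (y : ∀ l, (formsDG (S l) (M l)).carrier) :
        Function.update (Function.update y i (y i)) j (y j) = y := by
      rw [Function.update_eq_self, Function.update_eq_self]
    exact congrArg (PiTensorProduct.tprod k) (e fun l => formsDG.collapse (M l) (hs l) (a l))
  | add x y hx hy => rw [map_add]; exact Submodule.add_mem _ hx hy

/-- Common core of both cases with `r` factors: the points `s i` and the bounds `W i` may depend on
`z`. Each `s i` need only avoid the supports allowed in the other factors. -/
lemma quasiIso_piReducedInclusion (h : ∀ z ∈ piReduced S M, ∃ (s : Fin r → ℤ) (W : Fin r → Set ℤ),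
      (∀ i, s i ∈ S i) ∧ s.Injective ∧ (∀ i j, i ≠ j → s i ∉ W j) ∧
      ∀ i j (hij : i ≠ j), z ∈ pairReducedIn S M W hij) :
    QuasiIso (piReducedInclusion S M) := by
  refine DGModule.quasiIso_inclusion _ _ _ fun z hz => ?_
  obtain ⟨s, W, hs, hinj, hW, hz'⟩ := h z hz
  let D := fun i => formsDG.deformation (M i) (hs i)
  refine ⟨DGModule.Deformation.piρ D, DGModule.Deformation.piη D, DGModule.Deformation.pi_d_η D,
    DGModule.Deformation.pi_ρ_gr D, DGModule.Deformation.pi_η_gr D,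
    DGModule.Deformation.pi_η_gr_zero D, piρ_mem_piReduced hs hinj, ?_⟩
  · refine mem_piReduced.2 fun i j hij => ?_
    -- Wherever the homotopy acts, the operator on factor `i` adds at most `s i` to the supports.
    -- Applying the operators commutes with `insertPair`, so each `pairReduced` reduces to the case
    -- of two factors.
    have hform (l i) : formsDG.IsFormwise (s i) (DGModule.Deformation.piAtη D l i) := by
      rcases lt_trichotomy i l with h | rfl | h
      · rw [DGModule.Deformation.piAtη, staircase_of_lt _ _ h]
        exact formsDG.isFormwise_sgn_collapse (hs i)
      · rw [DGModule.Deformation.piAtη, staircase_self]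
        exact formsDG.isFormwise_homotopy (hs i)
      · rw [DGModule.Deformation.piAtη, staircase_of_gt _ _ h]
        exact formsDG.isFormwise_id
    suffices pairReducedIn S M W hij ≤
        (pairReduced S M hij).comap (DGModule.Deformation.piη D) from this (hz' i j hij)
    refine iSup_le fun x => ?_
    rintro _ ⟨y, hy, rfl⟩
    rw [Submodule.mem_comap, DGModule.Deformation.piη, LinearMap.sum_apply]
    refine Submodule.sum_mem _ fun l _ => ?_
    rw [map_insertPair]
    exact Submodule.mem_iSup_of_mem _ ⟨_, IsFormwise.map_mem_reduced (hinj.ne hij) (hW i j hij)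
      (hW j i hij.symm) (hform l i) (hform l j) hy.1 hy.2, rfl⟩

/-- The inclusion of the reduced tensor product of a family of differential graded modules of forms is
a quasi-isomorphism when the sets of singular supports are transversal. -/
theorem quasiIso_piReducedInclusion_of_transversal (h : TransversalFamily S) :
    QuasiIso (piReducedInclusion S M) := by
  -- The point `s i` lies in `S i` and in none of the other sets. The points are therefore distinct,
  -- and the sets `S j` themselves can serve as bounds.
  choose s hs hs' using fun i => (h i).1
  have hs'' (i j : Fin r) (hij : i ≠ j) : s i ∉ S j := fun hj =>
    hs' i (Set.mem_iUnion₂.2 ⟨j, hij.symm, hj⟩)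
  refine quasiIso_piReducedInclusion fun z hz => ⟨s, S, hs, fun i j e => ?_, hs'',
    fun i j hij => ?_⟩
  · by_contra hij
    exact hs'' i j hij (e ▸ hs j)
  · rw [pairReducedIn_self]
    exact mem_piReduced.1 hz i j hij

/-- The inclusion of the reduced tensor product of a family of differential graded modules of forms is
a quasi-isomorphism when there is no restriction on the singular supports. -/
theorem quasiIso_piReducedInclusion_univ :
    QuasiIso (piReducedInclusion (fun _ => Set.univ) M) := by
  classical
  refine quasiIso_piReducedInclusion fun z hz => ?_
  -- Each pair of places yields its own presentation of `z` and its own finite set. There are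
  -- finitely many pairs, so one finite set `G` bounds them all.
  choose F hF using fun i j hij => exists_mem_pairReducedIn hij (mem_piReduced.1 hz i j hij)
  let G : Finset ℤ := Finset.univ.biUnion fun i => Finset.univ.biUnion fun j =>
    if hij : i ≠ j then F i j hij else ∅
  have hG (i j) (hij : i ≠ j) : F i j hij ⊆ G := fun x hx => by
    simp only [G, Finset.mem_biUnion, Finset.mem_univ, true_and]
    exact ⟨i, j, by rwa [dif_pos hij]⟩
  -- The complement of `G` is infinite, so it contains `r` distinct points to collapse to.
  have : Infinite ↥((G : Set ℤ)ᶜ) := G.finite_toSet.infinite_compl.to_subtype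
  let e := Infinite.natEmbedding ↥((G : Set ℤ)ᶜ)
  refine ⟨fun i => (e i.1).1, fun _ => G, fun _ => trivial, fun i j h => ?_,
    fun i _ _ => (e i.1).2, fun i j hij => ?_⟩
  · exact Fin.ext (e.injective (Subtype.ext h))
  · exact pairReducedIn_mono (fun _ => Finset.coe_subset.2 (hG i j hij)) hij (hF i j hij)

end PiReduced

end Cosimplicial

end QuasiCommutative

theorem mainTheorem4 (k : Type u) [CommRing k]
    (hk : QuasiCommutative.IsCoherentRing k) :
    -- two flat cosimplicial modules and two transversal subsets
    (∀ (S T : Set ℤ), QuasiCommutative.Transversal S T →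
      ∀ (M : CosimplicialObject (ModuleCat.{v} k)) (N : CosimplicialObject (ModuleCat.{w} k)),
        (∀ n, Module.Flat k (M.obj n)) → (∀ n, Module.Flat k (N.obj n)) →
          QuasiIso (QuasiCommutative.reducedInclusion S T M N)) ∧
    -- two simplicial sets and two transversal subsets
    (∀ (S T : Set ℤ), QuasiCommutative.Transversal S T →
      ∀ (X : SSet.{v}) (Y : SSet.{w}),
        QuasiIso (QuasiCommutative.reducedInclusion S T
          (QuasiCommutative.cochains k X) (QuasiCommutative.cochains k Y))) ∧
    -- a finite family of simplicial sets and a transversal family of subsets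
    (∀ (r : ℕ) (S : Fin r → Set ℤ), QuasiCommutative.TransversalFamily S →
      ∀ X : Fin r → SSet.{z},
        QuasiIso (QuasiCommutative.piReducedInclusion S
          fun i => QuasiCommutative.cochains k (X i))) ∧
    -- a finite family of simplicial sets, without restriction on the singular supports
    (∀ (r : ℕ) (X : Fin r → SSet.{z}),
      QuasiIso (QuasiCommutative.piReducedInclusion (fun _ => Set.univ)
        fun i => QuasiCommutative.cochains k (X i))) :=
  ⟨fun _ _ h M N _ _ => QuasiCommutative.quasiIso_reducedInclusion h M N,
    fun _ _ h _ _ => QuasiCommutative.quasiIso_reducedInclusion h _ _,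
    fun _ _ h _ => QuasiCommutative.quasiIso_piReducedInclusion_of_transversal h,
    fun _ _ => QuasiCommutative.quasiIso_piReducedInclusion_univ⟩
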